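/- \textbf{The monotile.} Let $H$ be the closed regular hexagon in $\mathbb{C}$ with centre $0$ and inradius $1/2$, and number its edges $0,\dots,5$ counterclockwise so that the outward normal of edge $k$ is $\omega^k$, $\omega=e^{\pi i/3}$. Write $p_k^{\pm}=\tfrac12\omega^k\pm\tfrac18 i\omega^k$ for two off-centre points of edge $k$. The hexagon carries two decorations: (a) three disjoint \emph{R1-curves}: the straight segment from $p_1^-$ to $p_4^+$, and two small curves (drawn as segments) from $p_2^+$ to $p_3^-$ and from $p_5^+$ to $p_0^-$; (b) an \emph{R2-tree}: the union of the four segments from $0$ to the midpoints of the edges $0,1,3,4$. A \emph{tile} is the image of this decorated hexagon under a direct (orientation preserving) isometry of the plane. A \emph{tiling} $T$ is a set of tiles that covers the plane and in which distinct tiles have disjoint interiors. $T$ satisfies \textbf{R1} if the R1-curves continue across tiles: whenever an R1-curve of a tile of $T$ reaches another tile of $T$, it meets an R1-curve of that tile there. $T$ satisfies \textbf{R2} if the union of the R2-trees of all its tiles is connected. Let $\mathcal{C}$ be the collection of all tilings that satisfy \textbf{R1} and \textbf{R2}. A tiling is \emph{nonperiodic} if no nonzero translation maps it to itself. \textbf{The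 continuous hull.} The tiling metric is $$d(S,T)=\min\bigl\{1,\ \inf\{\varepsilon>0:\ \text{there are } u,v\in\mathbb{C},\ |u|,|v|\le\varepsilon/2,\text{ such that } S+u \text{ and } T+v \text{ have the same tiles meeting the closed ball } \overline{B}(0,1/\varepsilon)\}\bigr\}$$ (with $\inf\emptyset=\infty$). The continuous hull of $\mathcal{C}$ is the completion of $\{T+v: T\in\mathcal{C},\ v\in\mathbb{C}\}$ in this metric, i.e. the set of all tilings that are limits in $d$ of sequences of such translates. \textbf{Theorem.} Let $T$ be any tiling in the continuous hull of $\mathcal{C}$. Then 1. $T$ is nonperiodic; 2. $T$ satisfies \textbf{R1}; 3. the union of the R2-trees of the tiles of $T$ has at most three connected components; 4. each of these connected components crosses (i.e. meets the interior of) infinitely many tiles of $T$. -/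

import Mathlib

open Set Filter Topology

noncomputable section

namespace DendriteTile

/-! ### The prototile

A regular hexagon centred at the origin of the plane `ℂ`, with inradius `1 / 2`.  Its edges are
numbered `0, …, 5` counterclockwise; the outward normal of edge `k` points in direction `k π / 3`. -/

/-- The primitive sixth root of unity `exp (π i / 3)`. -/
def ω : ℂ := Complex.exp ((Real.pi / 3 : ℝ) * Complex.I)

/-- The closed hexagon. -/
def hexagon : Set ℂ := {z | ∀ k : Fin 6, (z * (starRingEnd ℂ) (ω ^ (k : ℕ))).re ≤ 1 / 2}

/-- The midpoint of edge `k`. -/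
def midpt (k : ℕ) : ℂ := ω ^ k / 2

/-- An off-centre point of edge `k`: displaced from the midpoint counterclockwise for `s = 1` and
clockwise for `s = -1` (by `1 / 8`, where half an edge has length `1 / (2 √3) > 1 / 4`). -/
def mark (k : ℕ) (s : ℝ) : ℂ := midpt k + s / 8 * (Complex.I * ω ^ k)

/-- The three disjoint R1-curves of the prototile: a straight line joining the opposite edges
`1` and `4`, and two small curves around the corner between the edges `2, 3` and the corner
between the edges `5, 0`. -/
def protoR1 : Set ℂ :=
  segment ℝ (mark 1 (-1)) (mark 4 1) ∪ segment ℝ (mark 2 1) (mark 3 (-1)) ∪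
    segment ℝ (mark 5 1) (mark 0 (-1))

/-- The R2-tree of the prototile: it joins the midpoints of the edges `0, 1, 3, 4`
through the centre. -/
def protoTree : Set ℂ :=
  segment ℝ 0 (midpt 0) ∪ segment ℝ 0 (midpt 1) ∪ segment ℝ 0 (midpt 3) ∪ segment ℝ 0 (midpt 4)

/-! ### Tiles and tilings -/

/-- A copy of the prototile under the direct isometry `z ↦ rot * z + center`.  The decorated
prototile has no nontrivial rotational symmetry, so tiles correspond to direct isometries. -/
@[ext]
structure Tile where
  rot : Circle
  center : ℂ

namespace Tile

/-- The direct isometry that carries the prototile to the tile. -/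
def map (f : Tile) (z : ℂ) : ℂ := (f.rot : ℂ) * z + f.center

/-- The closed hexagonal region occupied by the tile. -/
def region (f : Tile) : Set ℂ := f.map '' hexagon

/-- The union of the R1-curves of the tile. -/
def r1 (f : Tile) : Set ℂ := f.map '' protoR1

/-- The R2-tree of the tile. -/
def tree (f : Tile) : Set ℂ := f.map '' protoTree

/-- The tile moved by the vector `v`. -/
def translate (v : ℂ) (f : Tile) : Tile := ⟨f.rot, f.center + v⟩

end Tile

/-- A tiling of the plane by direct isometric copies of the prototile: the tiles cover the plane
and distinct tiles meet at most in boundary points. -/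
def IsTiling (T : Set Tile) : Prop :=
  (⋃ f ∈ T, f.region) = univ ∧
    ∀ f ∈ T, ∀ g ∈ T, f ≠ g → Disjoint (interior f.region) (interior g.region)

/-- Rule R1: the R1-curves continue across tiles, that is, wherever an R1-curve of one tile
reaches another tile it meets an R1-curve of that tile. -/
def SatisfiesR1 (T : Set Tile) : Prop :=
  ∀ f ∈ T, ∀ g ∈ T, f ≠ g → f.r1 ∩ g.region ⊆ g.r1

/-- The union of the R2-trees of all tiles. -/
def treeUnion (T : Set Tile) : Set ℂ := ⋃ f ∈ T, f.tree

/-- Rule R2 for tilings: the union of the R2-trees is connected. -/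
def SatisfiesR2 (T : Set Tile) : Prop := IsConnected (treeUnion T)

/-- The class `𝒞` of all tilings by the monotile that satisfy R1 and R2. -/
def classC : Set (Set Tile) := {T | IsTiling T ∧ SatisfiesR1 T ∧ SatisfiesR2 T}

/-- The translate `T + v` of a tiling. -/
def translate (v : ℂ) (T : Set Tile) : Set Tile := Tile.translate v '' T

/-- A tiling is nonperiodic if no nontrivial translation maps it to itself. -/
def Nonperiodic (T : Set Tile) : Prop := ∀ v : ℂ, translate v T = T → v = 0

/-! ### The tiling metric and the continuous hull -/

/-- The tiles of `T` that meet the closed ball of radius `r` about the origin. -/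
def patchOn (T : Set Tile) (r : ℝ) : Set Tile :=
  {f ∈ T | (f.region ∩ Metric.closedBall 0 r).Nonempty}

/-- The tiling metric: the infimum of all `ε > 0` for which `S` and `T` agree on the ball of radius
`1 / ε` about the origin after translations of `S` and of `T` by at most `ε / 2` each, capped
at `1`. -/
def tilingDist (S T : Set Tile) : ℝ :=
  sInf ({1} ∪ {ε : ℝ | 0 < ε ∧ ∃ u v : ℂ, ‖u‖ ≤ ε / 2 ∧ ‖v‖ ≤ ε / 2 ∧
    patchOn (translate u S) (1 / ε) = patchOn (translate v T) (1 / ε)})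

/-- The continuous hull of a collection `Λ` of tilings: the completion of the set of all
translates of members of `Λ` in the tiling metric, that is, all tilings that are limits in
the tiling metric of sequences of such translates. -/
def continuousHull (Λ : Set (Set Tile)) : Set (Set Tile) :=
  {T | IsTiling T ∧ ∃ S : ℕ → Set Tile,
    (∀ n, ∃ T' ∈ Λ, ∃ v : ℂ, S n = translate v T') ∧
      Tendsto (fun n => tilingDist (S n) T) atTop (𝓝 0)}

/-- The connected components of the union of the R2-trees. -/
def treeComponents (T : Set Tile) : Set (Set ℂ) :=
  {K | ∃ x ∈ treeUnion T, K = connectedComponentIn (treeUnion T) x}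

/-- The tiles of `T` that are crossed by the set `K`. -/
def tilesCrossed (T : Set Tile) (K : Set ℂ) : Set Tile :=
  {f ∈ T | (K ∩ interior f.region).Nonempty}

end DendriteTile

end

namespace DendriteTile

/-! A tiling by these hexagons is edge to edge, so its tiles sit on a triangular lattice, and all
that matters of a tile is the class `d x : ZMod 3` of the direction of its long R1-curve. R1 implies
`Alternating`: along a line of class `k`, the values other than `k` alternate. The tree at `x` has
arms in all directions except those of class `d x + 1`, so R2 says that the graph `Adj` is connected
(`TreeConnected`).

The heart of the proof is that every unit triangle then lies in hierarchical triangles `Lev` of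
every side `2 ^ n`. By `Lev.extend`, such a triangle is part of one of twice its side unless its
vertices form one of two exceptional patterns, `Cyc` or `AntiCyc`. Connectedness excludes both. Each
site has at most one parent (`Par`), and in a connected graph any two sets of type `IsSink` meet.
The three lines that leave an anticyclic triangle are each infinite or end in a cyclic triangle; two
of them behave alike, and these yield two disjoint sinks (`not_antiCyc`). A cyclic triangle is
itself a sink and produces an infinite ray, which is another one, disjoint from it (`not_cyc`).

Both exceptional patterns are finite, so they are also absent from limits: tilings of the hull give
patterns that are `LocallyConnected`. Nonperiodicity follows by comparing levels of the hierarchy,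
R1 is a condition on pairs of tiles, and a finite component would also be a component of a connected
approximating pattern. For the number of components, each site of a hierarchical triangle is joined
to one of its three vertices (`Lev.exists_conn`). So three components are the maximum if any finite
set of sites fits into one triangle. If not, some line has its own class as constant value; then
each of its sides has at most one component besides that of the line (`LocallyConnected.conn_side`).
-/

/-! ### The triangular lattice -/

/-- Sites of the triangular lattice; `(a, b)` stands for `a + b ω`. -/
abbrev Site := ℤ × ℤ

/-- Unit vectors of the three line directions; they are `1`, `-ω`, `ω ^ 2`. -/
def e (k : ZMod 3) : Site := if k = 0 then (1, 0) else if k = 1 then (0, -1) else (-1, 1)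

lemma e_add_two (k : ZMod 3) : e (k + 2) = -e k - e (k + 1) := by
  revert k; decide

lemma add_one_add_one (k : ZMod 3) : k + 1 + 1 = k + 2 := by revert k; decide
lemma add_one_add_two (k : ZMod 3) : k + 1 + 2 = k := by revert k; decide
lemma add_two_add_one (k : ZMod 3) : k + 2 + 1 = k := by revert k; decide
lemma add_one_ne (k : ZMod 3) : k + 1 ≠ k := by revert k; decide
lemma add_two_ne (k : ZMod 3) : k + 2 ≠ k := by revert k; decide
lemma add_one_ne_add_two (k : ZMod 3) : k + 1 ≠ k + 2 := by revert k; decide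
lemma add_two_add_two (k : ZMod 3) : k + 2 + 2 = k + 1 := by revert k; decide

/-- The site with coordinates `s` and `t` in the sector at `p` that is spanned by the direction
`ε • e k` and the direction next to it counterclockwise. -/
def pt (p : Site) (k : ZMod 3) (ε : ℤˣ) (s t : ℤ) : Site :=
  p + (s * (ε : ℤ)) • e k - (t * (ε : ℤ)) • e (k + 1)

/-- The `i`-th site on the ray from `p` in the direction `ε • e k`. -/
def ray (p : Site) (k : ZMod 3) (ε : ℤˣ) (i : ℤ) : Site := p + (i * (ε : ℤ)) • e k

/-- The sites strictly between `p` and the `L`-th site on a ray from `p` in a direction of class `k`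
all have the value `k`. -/
def Run (d : Site → ZMod 3) (p : Site) (k : ZMod 3) (ε : ℤˣ) (L : ℕ) : Prop :=
  ∀ i : ℕ, 0 < i → i < L → d (ray p k ε i) = k

/-- Along each line of direction `k`, the values other than `k` alternate. -/
def Alternating (d : Site → ZMod 3) : Prop :=
  ∀ (p : Site) (k : ZMod 3) (ε : ℤˣ) (L : ℕ), 0 < L → d p ≠ k → Run d p k ε L →
    d (ray p k ε L) ≠ d p

/-! ### Hierarchical triangles -/

/-- The triangle with side `2 ^ n`, one vertex `p` and edges in the direction `ε • e k` and in the
direction next to it carries the hierarchical pattern; its three vertices are not restricted. -/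
def Lev (d : Site → ZMod 3) (n : ℕ) (p : Site) (k : ZMod 3) (ε : ℤˣ) : Prop :=
  ∀ v : ℕ, v < n → ∀ a b : ℤ, 0 ≤ a → 0 ≤ b → 2 ^ v * (a + b) ≤ 2 ^ n →
    (a % 2 = 1 → b % 2 = 0 → d (pt p k ε (2 ^ v * a) (2 ^ v * b)) = k) ∧
    (a % 2 = 0 → b % 2 = 1 → d (pt p k ε (2 ^ v * a) (2 ^ v * b)) = k + 1) ∧
    (a % 2 = 1 → b % 2 = 1 → d (pt p k ε (2 ^ v * a) (2 ^ v * b)) = k + 2)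

variable {d : Site → ZMod 3} {n : ℕ} {p : Site} {k : ZMod 3} {ε : ℤˣ}

lemma Run.mono {L M : ℕ} (h : Run d p k ε M) (hLM : L ≤ M) : Run d p k ε L :=
  fun i h0 h1 => h i h0 (h1.trans_le hLM)

lemma Lev.zero : Lev d 0 p k ε := fun v hv => absurd hv (Nat.not_lt_zero v)

lemma Lev.of_succ (h : Lev d (n + 1) p k ε) : Lev d n p k ε := by
  intro v hv a b ha hb hab
  refine h v (by omega) a b ha hb (hab.trans ?_)
  exact pow_le_pow_right₀ (by norm_num) (Nat.le_succ n)

lemma Lev.mono {m : ℕ} (h : Lev d n p k ε) (hmn : m ≤ n) : Lev d m p k ε := by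
  induction hmn with
  | refl => exact h
  | step _ ih => exact ih h.of_succ

/-- The pattern depends on the triangle only, not on the chosen vertex: the turn changes coordinates
by `(s, t) ↦ (2 ^ n - s - t, s)`, which permutes the three parity classes cyclically. -/
lemma Lev.rot (h : Lev d n p k ε) : Lev d n (ray p k ε (2 ^ n)) (k + 2) ε := by
  intro v hv a b ha hb hab
  obtain ⟨w, rfl⟩ : ∃ w, n = v + 1 + w := ⟨n - (v + 1), by omega⟩
  have hN : (2 : ℤ) ^ (v + 1 + w) = 2 ^ v * (2 * 2 ^ w) := by ring
  have hp : (0 : ℤ) < 2 ^ v := by positivity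
  rw [hN] at hab
  have hab' : a + b ≤ 2 * 2 ^ w := le_of_mul_le_mul_left hab hp
  obtain ⟨h1, h2, h3⟩ := h v hv (2 * 2 ^ w - a - b) a (by omega) ha (by
    rw [hN]; exact mul_le_mul_of_nonneg_left (by omega) hp.le)
  have key : pt (ray p k ε (2 ^ (v + 1 + w))) (k + 2) ε (2 ^ v * a) (2 ^ v * b) =
      pt p k ε (2 ^ v * (2 * 2 ^ w - a - b)) (2 ^ v * a) := by
    rw [hN]
    simp only [pt, ray, e_add_two, add_two_add_one]
    module
  rw [key, add_two_add_one, add_two_add_two]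
  exact ⟨fun ha hb => h3 (by omega) (by omega), fun ha hb => h1 (by omega) (by omega),
    fun ha hb => h2 (by omega) (by omega)⟩

lemma exists_eq_two_pow_mul_odd {i : ℤ} (hi : 0 < i) :
    ∃ (w : ℕ) (m : ℤ), 0 < m ∧ m % 2 = 1 ∧ i = 2 ^ w * m := by
  obtain ⟨w, m, hm, h⟩ := Nat.exists_eq_two_pow_mul_odd (n := i.toNat) (by omega)
  refine ⟨w, m, by have := hm.pos; omega, ?_, ?_⟩
  · have := Nat.odd_iff.mp hm; omega
  · have : (i.toNat : ℤ) = i := Int.toNat_of_nonneg hi.le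
    rw [← this, h]; push_cast; ring

lemma pow_lt_of_mul_lt {v w : ℕ} {m : ℤ} (hm : 0 < m) (h : (2 : ℤ) ^ w * m < 2 ^ v) : w < v := by
  by_contra hlt
  have h1 : (2 : ℤ) ^ v ≤ 2 ^ w := pow_le_pow_right₀ (by norm_num) (by omega)
  have h2 : (2 : ℤ) ^ w * 1 ≤ 2 ^ w * m := mul_le_mul_of_nonneg_left (by omega) (by positivity)
  omega

/-- Writing `i = 2 ^ w * m` with `m` odd gives `w < v`, so the site has coordinates `2 ^ w` times
(odd, even) and the clause of level `w` applies. -/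
lemma Lev.edge (h : Lev d n p k ε) {v : ℕ} (hv : v ≤ n) {a b : ℤ} (ha : 0 ≤ a) (hb : 0 ≤ b)
    (hab : 2 ^ v * (a + 1 + b) ≤ 2 ^ n) {i : ℤ} (h0 : 0 < i) (hi : i < 2 ^ v) :
    d (pt p k ε (2 ^ v * a + i) (2 ^ v * b)) = k := by
  obtain ⟨w, m, hm0, hm, rfl⟩ := exists_eq_two_pow_mul_odd h0
  have hw := pow_lt_of_mul_lt hm0 hi
  obtain ⟨u, rfl⟩ : ∃ u, v = w + 1 + u := ⟨v - (w + 1), by omega⟩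
  have hN : (2 : ℤ) ^ (w + 1 + u) = 2 ^ w * (2 * 2 ^ u) := by ring
  have hp : (0 : ℤ) < 2 ^ w := by positivity
  have hm2 : m ≤ 2 * 2 ^ u := by
    rw [hN] at hi; exact (lt_of_mul_lt_mul_left hi hp.le).le
  have hA : 0 ≤ 2 ^ u * a := by positivity
  have hB : 0 ≤ 2 ^ u * b := by positivity
  have := (h w (by omega) (2 * (2 ^ u * a) + m) (2 * (2 ^ u * b)) (by omega) (by omega) (by
    refine le_trans ?_ hab
    rw [hN, mul_assoc]
    refine mul_le_mul_of_nonneg_left ?_ hp.le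
    nlinarith)).1 (by omega) (by omega)
  rw [hN]
  convert this using 3 <;> ring

lemma ray_eq_pt (i : ℤ) : ray p k ε i = pt p k ε i 0 := by simp [ray, pt]

lemma ray_next_eq_pt (i : ℤ) : ray p (k + 1) (-ε) i = pt p k ε 0 i := by
  simp only [ray, pt, Units.val_neg]; module

lemma Lev.run (h : Lev d n p k ε) : Run d p k ε (2 ^ n) := by
  intro i h0 hi
  have := h.edge le_rfl (a := 0) (b := 0) le_rfl le_rfl (by simp) (i := i) (by omega)
    (by exact_mod_cast hi)
  simpa [ray_eq_pt] using this

/-- The line through an interior row of a hierarchical triangle has values other than its class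
at regular distances. -/
lemma Lev.row (h : Lev d n p k ε) {t : ℤ} (h0 : 0 < t) (ht : t < 2 ^ n) :
    ∃ v < n, (2 : ℤ) ^ v ∣ t ∧ ∀ a : ℤ, 0 ≤ a → 2 ^ v * a + t ≤ 2 ^ n →
      d (pt p k ε (2 ^ v * a) t) ≠ k := by
  obtain ⟨v, m, hm0, hm, rfl⟩ := exists_eq_two_pow_mul_odd h0
  have hv := pow_lt_of_mul_lt hm0 ht
  refine ⟨v, hv, Dvd.intro _ rfl, fun a ha hat => ?_⟩
  obtain ⟨-, h2, h3⟩ := h v hv a m ha hm0.le (by linarith)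
  rcases Int.emod_two_eq_zero_or_one a with ha2 | ha2
  · rw [h2 ha2 hm]; exact add_one_ne k
  · rw [h3 ha2 hm]; exact add_two_ne k

/-- A triangle whose three inner edges are in place and whose four parts are hierarchical is
hierarchical. -/
lemma Lev.succ (h1 : Lev d n p k ε) (h2 : Lev d n (ray p k ε (2 ^ n)) k ε)
    (h3 : Lev d n (ray p (k + 1) (-ε) (2 ^ n)) k ε)
    (h4 : Lev d n (pt p k ε (2 ^ n) (2 ^ n)) k (-ε))
    (hq : d (ray p k ε (2 ^ n)) = k) (hr : d (ray p (k + 1) (-ε) (2 ^ n)) = k + 1)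
    (hw : d (pt p k ε (2 ^ n) (2 ^ n)) = k + 2) : Lev d (n + 1) p k ε := by
  intro v hv a b ha hb hab
  have hp : (0 : ℤ) < 2 ^ v := by positivity
  rcases Nat.lt_succ_iff_lt_or_eq.mp hv with hv | rfl
  · obtain ⟨w, rfl⟩ : ∃ w, n = v + 1 + w := ⟨n - (v + 1), by omega⟩
    have hN : (2 : ℤ) ^ (v + 1 + w) = 2 ^ v * (2 * 2 ^ w) := by ring
    rw [pow_succ, hN, mul_assoc] at hab
    replace hab : a + b ≤ 2 * 2 ^ w * 2 := le_of_mul_le_mul_left hab hp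
    -- The site lies in the part at `p`, in one of the parts at the other two vertices, or in the
    -- inverted middle part.
    by_cases c1 : a + b ≤ 2 * 2 ^ w
    · exact h1 v hv a b ha hb (by rw [hN]; exact mul_le_mul_of_nonneg_left c1 hp.le)
    by_cases c2 : 2 * 2 ^ w ≤ a
    · have := h2 v hv (a - 2 * 2 ^ w) b (by omega) hb (by
        rw [hN]; exact mul_le_mul_of_nonneg_left (by omega) hp.le)
      rw [show pt (ray p k ε (2 ^ (v + 1 + w))) k ε (2 ^ v * (a - 2 * 2 ^ w)) (2 ^ v * b) =
        pt p k ε (2 ^ v * a) (2 ^ v * b) by rw [hN]; simp only [pt, ray]; module] at this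
      exact ⟨fun _ _ => this.1 (by omega) (by omega), fun _ _ => this.2.1 (by omega) (by omega),
        fun _ _ => this.2.2 (by omega) (by omega)⟩
    by_cases c3 : 2 * 2 ^ w ≤ b
    · have := h3 v hv a (b - 2 * 2 ^ w) ha (by omega) (by
        rw [hN]; exact mul_le_mul_of_nonneg_left (by omega) hp.le)
      rw [show pt (ray p (k + 1) (-ε) (2 ^ (v + 1 + w))) k ε (2 ^ v * a)
        (2 ^ v * (b - 2 * 2 ^ w)) = pt p k ε (2 ^ v * a) (2 ^ v * b) by
          rw [hN]; simp only [pt, ray, Units.val_neg]; module] at this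
      exact ⟨fun _ _ => this.1 (by omega) (by omega), fun _ _ => this.2.1 (by omega) (by omega),
        fun _ _ => this.2.2 (by omega) (by omega)⟩
    have := h4 v hv (2 * 2 ^ w - a) (2 * 2 ^ w - b) (by omega) (by omega) (by
      rw [hN]; exact mul_le_mul_of_nonneg_left (by omega) hp.le)
    rw [show pt (pt p k ε (2 ^ (v + 1 + w)) (2 ^ (v + 1 + w))) k (-ε)
      (2 ^ v * (2 * 2 ^ w - a)) (2 ^ v * (2 * 2 ^ w - b)) = pt p k ε (2 ^ v * a) (2 ^ v * b) by
        rw [hN]; simp only [pt, Units.val_neg]; module] at this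
    exact ⟨fun _ _ => this.1 (by omega) (by omega), fun _ _ => this.2.1 (by omega) (by omega),
      fun _ _ => this.2.2 (by omega) (by omega)⟩
  -- At the top level `v = n` the only sites concerned are the midpoints of the three edges.
  · rw [pow_succ] at hab
    replace hab : a + b ≤ 2 := le_of_mul_le_mul_left hab hp
    refine ⟨fun h1 h2 => ?_, fun h1 h2 => ?_, fun h1 h2 => ?_⟩
    · obtain ⟨rfl, rfl⟩ : a = 1 ∧ b = 0 := by omega
      simpa [ray_eq_pt] using hq
    · obtain ⟨rfl, rfl⟩ : a = 0 ∧ b = 1 := by omega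
      simpa [ray_next_eq_pt] using hr
    · obtain ⟨rfl, rfl⟩ : a = 1 ∧ b = 1 := by omega
      simpa using hw

/-! ### Cyclic and anticyclic triangles, cells, and the doubling of triangles -/

/-- A hierarchical triangle whose vertices are joined cyclically by the trees. -/
def Cyc (d : Site → ZMod 3) (n : ℕ) (p : Site) (k : ZMod 3) (ε : ℤˣ) : Prop :=
  Lev d n p k ε ∧ d p = k + 1 ∧ d (ray p k ε (2 ^ n)) = k ∧
    d (ray p (k + 1) (-ε) (2 ^ n)) = k + 2

/-- A hierarchical triangle from whose vertices the trees diverge. -/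
def AntiCyc (d : Site → ZMod 3) (n : ℕ) (p : Site) (k : ZMod 3) (ε : ℤˣ) : Prop :=
  Lev d n p k ε ∧ d p = k ∧ d (ray p k ε (2 ^ n)) = k + 2 ∧
    d (ray p (k + 1) (-ε) (2 ^ n)) = k + 1

lemma ray_ray_rot (N : ℤ) : ray (ray p k ε N) (k + 2) ε N = ray p (k + 1) (-ε) N := by
  simp only [ray, e_add_two, Units.val_neg]; module

lemma ray_ray_rot_next (N : ℤ) : ray (ray p k ε N) (k + 2 + 1) (-ε) N = p := by
  simp only [ray, add_two_add_one, Units.val_neg]; module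

lemma ray_neg_ray (N : ℤ) : ray (ray p k (-ε) N) k ε N = p := by
  simp only [ray, Units.val_neg]; module

lemma Cyc.rot (h : Cyc d n p k ε) : Cyc d n (ray p k ε (2 ^ n)) (k + 2) ε := by
  obtain ⟨h1, h2, h3, h4⟩ := h
  refine ⟨h1.rot, ?_, ?_, ?_⟩
  · rw [h3, add_two_add_one]
  · rw [ray_ray_rot, h4]
  · rw [ray_ray_rot_next, h2, add_two_add_two]

lemma AntiCyc.rot (h : AntiCyc d n p k ε) : AntiCyc d n (ray p k ε (2 ^ n)) (k + 2) ε := by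
  obtain ⟨h1, h2, h3, h4⟩ := h
  refine ⟨h1.rot, h3, ?_, ?_⟩
  · rw [ray_ray_rot, h4, add_two_add_two]
  · rw [ray_ray_rot_next, h2, add_two_add_one]

/-- A hierarchical triangle of side `2 ^ n`, or a smaller cyclic one. -/
def Cell (d : Site → ZMod 3) (n m : ℕ) (p : Site) (k : ZMod 3) (ε : ℤˣ) : Prop :=
  (m = n ∧ Lev d m p k ε) ∨ (m < n ∧ Cyc d m p k ε)

lemma Cell.lev {m : ℕ} (h : Cell d n m p k ε) : Lev d m p k ε := by
  rcases h with ⟨-, h⟩ | ⟨-, h⟩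
  exacts [h, h.1]

lemma Cell.le {m : ℕ} (h : Cell d n m p k ε) : m ≤ n := by
  rcases h with ⟨h, -⟩ | ⟨h, -⟩
  exacts [h.le, h.le]

/-- Every unit triangle lies in a cell. -/
def Covered (d : Site → ZMod 3) (n : ℕ) : Prop :=
  ∀ p k ε, ∃ (m : ℕ) (P : Site) (s t : ℤ), 0 ≤ s ∧ 0 ≤ t ∧
    ((Cell d n m P k ε ∧ p = pt P k ε s t ∧ s + t + 1 ≤ 2 ^ m) ∨
      (Cell d n m P k (-ε) ∧ p = pt P k (-ε) s t ∧ 1 ≤ s ∧ 1 ≤ t ∧ s + t ≤ 2 ^ m))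

lemma covered_zero : Covered d 0 := fun p k ε =>
  ⟨0, p, 0, 0, le_rfl, le_rfl, Or.inl ⟨Or.inl ⟨rfl, Lev.zero⟩, by simp [pt], by simp⟩⟩

/-- A long run in the direction of a row of a hierarchical triangle does not pass through its
interior, forwards. -/
lemma Lev.false_of_run {m L : ℕ} {s t : ℤ} (h : Lev d m p k ε) (hm : 2 ^ m ≤ L) (hs : 0 ≤ s)
    (ht : 0 < t) (hst : s + 1 + t ≤ 2 ^ m) (hr : Run d (pt p k ε s t) k ε L) : False := by
  obtain ⟨v, hv, ⟨c, hc⟩, hrow⟩ := h.row ht (by omega)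
  obtain ⟨w, rfl⟩ : ∃ w, m = v + 1 + w := ⟨m - (v + 1), by omega⟩
  have hN : (2 : ℤ) ^ (v + 1 + w) = 2 ^ v * (2 * 2 ^ w) := by ring
  have hp : (0 : ℤ) < 2 ^ v := by positivity
  have h1 := Int.emod_add_mul_ediv s (2 ^ v)
  have h2 := Int.emod_nonneg s hp.ne'
  have h3 := Int.emod_lt_of_pos s hp
  have h4 : 0 ≤ s / 2 ^ v := Int.ediv_nonneg hs hp.le
  generalize s / 2 ^ v = a at *
  have h5 : a + 1 + c ≤ 2 * 2 ^ w := by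
    rw [hN] at hst
    have : 2 ^ v * (a + c) < 2 ^ v * (2 * 2 ^ w) := by
      rw [mul_add, ← hc]; omega
    have := lt_of_mul_lt_mul_left this hp.le
    omega
  -- `2 ^ v * (a + 1)` is the first multiple of `2 ^ v` beyond `s`; the run reaches it after at most
  -- `2 ^ v < 2 ^ m` steps.
  refine hrow (a + 1) (by omega) ?_ ?_
  · rw [hN, hc, ← mul_add]; exact mul_le_mul_of_nonneg_left h5 hp.le
  · have hi : 2 ^ v * (a + 1) - s = 2 ^ v - s % 2 ^ v := by rw [mul_add]; omega
    have hLz : ((2 : ℤ) ^ v) < 2 ^ (v + 1 + w) := pow_lt_pow_right₀ (by norm_num) (by omega)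
    have hL' : ((2 : ℤ) ^ (v + 1 + w)) ≤ L := by exact_mod_cast hm
    have := hr (2 ^ v * (a + 1) - s).toNat (by omega) (by omega)
    rw [Int.toNat_of_nonneg (by omega)] at this
    refine (congrArg d ?_).trans this
    simp only [pt, ray]; module

/-- A long run in the direction of a row of a hierarchical triangle does not pass through its
interior, backwards. -/
lemma Lev.false_of_run_neg {m L : ℕ} {s t : ℤ} (h : Lev d m p k ε) (hm : 2 ^ m ≤ L) (hs : 0 < s)
    (ht : 0 < t) (hst : s + t ≤ 2 ^ m) (hr : Run d (pt p k ε s t) k (-ε) L) : False := by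
  obtain ⟨v, hv, ⟨c, hc⟩, hrow⟩ := h.row ht (by omega)
  have hp : (0 : ℤ) < 2 ^ v := by positivity
  have h1 := Int.emod_add_mul_ediv (s - 1) (2 ^ v)
  have h2 := Int.emod_nonneg (s - 1) hp.ne'
  have h3 := Int.emod_lt_of_pos (s - 1) hp
  have h4 : 0 ≤ (s - 1) / 2 ^ v := Int.ediv_nonneg (by omega) hp.le
  generalize (s - 1) / 2 ^ v = a at *
  -- Dividing `s - 1` instead of `s` makes `2 ^ v * a` the last multiple of `2 ^ v` strictly before
  -- `s`.
  refine hrow a (by omega) (by omega) ?_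
  have hLz : ((2 : ℤ) ^ v) < 2 ^ m := pow_lt_pow_right₀ (by norm_num) (by omega)
  have hL' : ((2 : ℤ) ^ m) ≤ L := by exact_mod_cast hm
  have := hr (s - 2 ^ v * a).toNat (by omega) (by omega)
  rw [Int.toNat_of_nonneg (by omega)] at this
  refine (congrArg d ?_).trans this
  simp only [pt, ray, Units.val_neg]; module

/-- The cell to the left of a long run starts where the run does. -/
lemma Covered.left (hc : Covered d n) (hp : d p ≠ k) (hr : Run d p k ε (2 ^ n)) :
    Lev d n p k ε ∨ ∃ m < n, Cyc d m p k ε := by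
  obtain ⟨m, P, s, t, hs, ht, ⟨hC, rfl, hst⟩ | ⟨hC, rfl, hs1, ht1, hst⟩⟩ := hc p k ε
  · have hmn : 2 ^ m ≤ 2 ^ n := Nat.pow_le_pow_right (by norm_num) hC.le
    -- The site is not in an interior row, which the run would cross, nor inside the base, where the
    -- value is `k`; so it is the vertex `P`.
    rcases ht.lt_or_eq with ht | rfl
    · exact (hC.lev.false_of_run hmn hs ht (by omega) hr).elim
    rcases hs.lt_or_eq with hs | rfl
    · have := hC.lev.edge (v := m) le_rfl (a := 0) (b := 0) le_rfl le_rfl (by simp) hs (by omega)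
      simp only [mul_zero, zero_add] at this
      exact (hp this).elim
    rw [show pt P k ε 0 0 = P by simp [pt]]
    rcases hC with ⟨rfl, h⟩ | ⟨hlt, h⟩
    exacts [Or.inl h, Or.inr ⟨m, hlt, h⟩]
  · have hmn : 2 ^ m ≤ 2 ^ n := Nat.pow_le_pow_right (by norm_num) hC.le
    exact (hC.lev.false_of_run_neg hmn (by omega) (by omega) hst (by rwa [neg_neg])).elim

/-- The cell to the right of a long run starts where the run does. -/
lemma Covered.right (hc : Covered d n) (hp : d p ≠ k) (hr : Run d p k ε (2 ^ n)) :
    Lev d n p (k + 2) (-ε) := by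
  -- The unit triangle to the right of the first step lies to the left of the same step taken
  -- backwards.
  obtain ⟨m, P, s, t, hs, ht, ⟨hC, hq, hst⟩ | ⟨hC, hq, hs1, ht1, hst⟩⟩ := hc (ray p k ε 1) k (-ε)
  · have hmn : 2 ^ m ≤ 2 ^ n := Nat.pow_le_pow_right (by norm_num) hC.le
    obtain rfl : p = pt P k (-ε) (s + 1) t := by
      rw [show p = ray (ray p k ε 1) k (-ε) 1 by simp only [ray, Units.val_neg]; module, hq]
      simp only [pt, ray, Units.val_neg]; module
    rcases ht.lt_or_eq with ht | rfl
    · exact (hC.lev.false_of_run_neg hmn (s := s + 1) (by omega) ht (by omega)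
        (by rwa [neg_neg])).elim
    rcases (show s + 1 ≤ 2 ^ m by omega).lt_or_eq with hs' | hs'
    · have := hC.lev.edge (v := m) le_rfl (a := 0) (b := 0) le_rfl le_rfl (by simp)
        (show 0 < s + 1 by omega) (by omega)
      simp only [mul_zero, zero_add] at this
      exact (hp this).elim
    rw [← ray_eq_pt, hs'] at hp ⊢
    rcases hC with ⟨rfl, h⟩ | ⟨hlt, h⟩
    · exact h.rot
    -- A smaller cyclic cell would have the value `k` at this vertex.
    · exact (hp h.2.2.1).elim
  · have hmn : 2 ^ m ≤ 2 ^ n := Nat.pow_le_pow_right (by norm_num) hC.le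
    rw [neg_neg] at hC hq
    obtain rfl : p = pt P k ε (s - 1) t := by
      rw [show p = ray (ray p k ε 1) k (-ε) 1 by simp only [ray, Units.val_neg]; module, hq]
      simp only [pt, ray, Units.val_neg]; module
    exact (hC.lev.false_of_run hmn (by omega) (by omega) (by omega) hr).elim

lemma Lev.ne (hA : Alternating d) (h : Lev d n p k ε) (hp : d p ≠ k) :
    d (ray p k ε (2 ^ n)) ≠ d p := by
  have := hA p k ε (2 ^ n) (by positivity) hp h.run
  simpa using this

lemma Lev.congr {q : Site} {l : ZMod 3} {δ : ℤˣ} (h : Lev d n p k ε) (hp : p = q) (hk : k = l)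
    (hε : ε = δ) : Lev d n q l δ := by
  subst hp hk hε; exact h

lemma Cyc.congr {q : Site} {l : ZMod 3} (h : Cyc d n p k ε) (hp : p = q) (hk : k = l) :
    Cyc d n q l ε := by
  subst hp hk; exact h

/-- A triangle that lies in the middle extends. -/
lemma Lev.extend_middle (hc : Covered d n) (h : Lev d n p k ε) (hp : d p = k + 2)
    (hq : d (ray p k ε (2 ^ n)) = k + 1) (hr : d (ray p (k + 1) (-ε) (2 ^ n)) = k) :
    Lev d (n + 1) (pt p k ε (2 ^ n) (2 ^ n)) k (-ε) := by
  -- No vertex has as value the class of the edge that starts there, so each edge bounds a further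
  -- triangle on its outer side; around the given one they form the doubled triangle.
  have t1 := hc.right (by rw [hp]; exact add_two_ne k) h.run
  have t2 := hc.right (by rw [hq]; exact add_one_ne_add_two k) h.rot.run
  have t3 := hc.right (by rw [ray_ray_rot, hr, add_two_add_two]; exact (add_one_ne k).symm)
    h.rot.rot.run
  refine Lev.succ (t2.rot.congr ?_ ?_ rfl) (t3.congr ?_ ?_ rfl) (t1.rot.rot.congr ?_ ?_ rfl)
    (h.congr ?_ rfl ?_) ((congrArg d ?_).trans hr) ((congrArg d ?_).trans hq)
    ((congrArg d ?_).trans hp)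
  all_goals first
    | (simp only [add_two_add_two, add_one_add_two, neg_neg]; done)
    | (simp only [pt, ray, add_two_add_two, e_add_two, Units.val_neg]; module)

/-- A triangle whose longest lines meet at `p` extends away from `p`. -/
lemma Lev.extend_corner (hA : Alternating d) (hc : Covered d n) (h : Lev d n p k ε)
    (hq : d (ray p k ε (2 ^ n)) = k) (hr : d (ray p (k + 1) (-ε) (2 ^ n)) = k + 1) :
    Lev d (n + 1) p k ε := by
  -- `t` is the reflection of the triangle in the edge opposite `p`. Alternation along its two new
  -- edges excludes `k` and `k + 1` at the new vertex; with the remaining value `k + 2` the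
  -- reflected triangle is a middle one.
  have t := hc.right (by rw [hq]; exact (add_two_ne k).symm) h.rot.run
  rw [add_two_add_two] at t
  have hw1 : d (pt p k ε (2 ^ n) (2 ^ n)) ≠ k := by
    have := t.ne hA (by rw [hq]; exact (add_one_ne k).symm)
    rw [hq] at this
    convert this using 3
    simp only [pt, ray, Units.val_neg]; module
  have t' := t.rot
  rw [add_one_add_two] at t'
  have hw2 : d (pt p k ε (2 ^ n) (2 ^ n)) ≠ k + 1 := by
    have hrep : ray (ray (ray p k ε (2 ^ n)) (k + 1) (-ε) (2 ^ n)) k (-ε) (2 ^ n) =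
        ray p (k + 1) (-ε) (2 ^ n) := by simp only [ray, Units.val_neg]; module
    intro hw
    have hwr : d (ray (ray p k ε (2 ^ n)) (k + 1) (-ε) (2 ^ n)) = k + 1 := by
      refine (congrArg d ?_).trans hw; simp only [pt, ray, Units.val_neg]; module
    have := t'.ne hA (by rw [hwr]; exact add_one_ne k)
    rw [hrep, hr, hwr] at this
    exact this rfl
  have hw : d (pt p k ε (2 ^ n) (2 ^ n)) = k + 2 := by
    clear hq hr t t' h
    revert hw1 hw2
    generalize d (pt p k ε (2 ^ n) (2 ^ n)) = x
    revert k x; decide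
  have hW : ray (ray p k ε (2 ^ n)) (k + 1) (-ε) (2 ^ n) = pt p k ε (2 ^ n) (2 ^ n) := by
    simp only [pt, ray, Units.val_neg]; module
  rw [hW] at t'
  refine (t'.extend_middle hc hw ((congrArg d ?_).trans hr) ((congrArg d ?_).trans hq)).congr
    ?_ rfl (neg_neg ε)
  all_goals simp only [pt, ray, Units.val_neg]; module

-- The hypotheses are alternation along the three edges. The first outcome is the middle position in
-- a doubled triangle, the next three are the corner positions, and the last two are `Cyc` and
-- `AntiCyc`.
set_option synthInstance.maxSize 1000 in
lemma triangle_values : ∀ k x y z : ZMod 3, (x ≠ k → y ≠ x) → (y ≠ k + 2 → z ≠ y) →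
    (z ≠ k + 1 → x ≠ z) →
    x = k + 2 ∧ y = k + 1 ∧ z = k ∨ y = k ∧ z = k + 1 ∨ z = k + 2 ∧ x = k ∨ x = k + 1 ∧ y = k + 2 ∨
      x = k + 1 ∧ y = k ∧ z = k + 2 ∨ x = k ∧ y = k + 2 ∧ z = k + 1 := by
  decide

lemma Lev.cases (hA : Alternating d) (h : Lev d n p k ε) :
    (d p = k + 2 ∧ d (ray p k ε (2 ^ n)) = k + 1 ∧ d (ray p (k + 1) (-ε) (2 ^ n)) = k) ∨
    (d (ray p k ε (2 ^ n)) = k ∧ d (ray p (k + 1) (-ε) (2 ^ n)) = k + 1) ∨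
    (d (ray p (k + 1) (-ε) (2 ^ n)) = k + 2 ∧ d p = k) ∨
    (d p = k + 1 ∧ d (ray p k ε (2 ^ n)) = k + 2) ∨
    Cyc d n p k ε ∨ AntiCyc d n p k ε := by
  have h1 := h.ne hA
  have h2 := h.rot.ne hA
  have h3 := h.rot.rot.ne hA
  rw [ray_ray_rot] at h2
  have hrep : ray (ray p (k + 1) (-ε) (2 ^ n)) (k + 1) ε (2 ^ n) = p := ray_neg_ray _
  rw [ray_ray_rot, add_two_add_two, hrep] at h3
  rw [Cyc, AntiCyc]
  simp only [h, true_and]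
  exact triangle_values k _ _ _ h1 h2 h3

/-- A triangle that is neither cyclic nor anticyclic is part of a triangle of twice its size. -/
lemma Lev.extend (hA : Alternating d) (hc : Covered d n) (h : Lev d n p k ε)
    (h1 : ¬ Cyc d n p k ε) (h2 : ¬ AntiCyc d n p k ε) :
    Lev d (n + 1) (pt p k ε (2 ^ n) (2 ^ n)) k (-ε) ∨ Lev d (n + 1) p k ε ∨
      Lev d (n + 1) (ray p k (-ε) (2 ^ n)) k ε ∨ Lev d (n + 1) (ray p (k + 1) ε (2 ^ n)) k ε := by
  rcases h.cases hA with ⟨ha, hb, hc'⟩ | ⟨hb, hc'⟩ | ⟨hc', ha⟩ | ⟨ha, hb⟩ | h' | h'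
  · exact Or.inl (h.extend_middle hc ha hb hc')
  · exact Or.inr (Or.inl (h.extend_corner hA hc hb hc'))
  · refine Or.inr (Or.inr (Or.inl ?_))
    refine (h.rot.extend_corner hA hc ?_ ?_).rot.rot.congr ?_ ?_ rfl
    · rw [ray_ray_rot, hc']
    · rw [ray_ray_rot_next, ha, add_two_add_one]
    · simp only [ray, add_two_add_two, e_add_two, Units.val_neg]; module
    · rw [add_two_add_two, add_two_add_one]
  · refine Or.inr (Or.inr (Or.inr ?_))
    refine (h.rot.rot.extend_corner hA hc ?_ ?_).rot.congr ?_ ?_ rfl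
    · rw [ray_ray_rot, ray_ray_rot_next, ha, add_two_add_two]
    · rw [add_two_add_two, add_one_add_one]
      refine (congrArg d ?_).trans hb
      simp only [ray, e_add_two, Units.val_neg]; module
    · simp only [ray, add_two_add_two, e_add_two]; module
    · rw [add_two_add_two, add_two_add_one]
  · exact (h1 h').elim
  · exact (h2 h').elim

/-- Cyclic triangles of side `2 ^ n` stop growing and are kept as smaller cells; `Lev.extend`
applies to the others. -/
lemma Cell.succ {m : ℕ} (hA : Alternating d) (hc : Covered d n)
    (hn : ∀ p k ε, ¬ AntiCyc d n p k ε) (h : Cell d n m p k ε) :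
    Cell d (n + 1) m p k ε ∨
    (m = n ∧ (Lev d (n + 1) (pt p k ε (2 ^ n) (2 ^ n)) k (-ε) ∨ Lev d (n + 1) p k ε ∨
      Lev d (n + 1) (ray p k (-ε) (2 ^ n)) k ε ∨
      Lev d (n + 1) (ray p (k + 1) ε (2 ^ n)) k ε)) := by
  rcases h with ⟨rfl, h⟩ | ⟨hlt, h⟩
  · by_cases hC : Cyc d m p k ε
    · exact Or.inl (Or.inr ⟨by omega, hC⟩)
    · exact Or.inr ⟨rfl, h.extend hA hc hC (hn p k ε)⟩
  · exact Or.inl (Or.inr ⟨by omega, h⟩)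

/-- In the doubled triangle the coordinates of a unit triangle are kept or shifted by `2 ^ n`, or
reflected if the old cell is the inverted middle part. -/
lemma Covered.succ (hA : Alternating d) (hc : Covered d n) (hn : ∀ p k ε, ¬ AntiCyc d n p k ε) :
    Covered d (n + 1) := by
  intro p k ε
  have hN : (2 : ℤ) ^ (n + 1) = 2 ^ n + 2 ^ n := by ring
  have hN0 : (0 : ℤ) < 2 ^ n := by positivity
  obtain ⟨m, P, s, t, hs, ht, ⟨hC, rfl, hst⟩ | ⟨hC, rfl, hs1, ht1, hst⟩⟩ := hc p k ε
  · rcases hC.succ hA hc hn with h | ⟨rfl, h | h | h | h⟩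
    · exact ⟨m, P, s, t, hs, ht, Or.inl ⟨h, rfl, hst⟩⟩
    · refine ⟨m + 1, _, 2 ^ m - s, 2 ^ m - t, by omega, by omega,
        Or.inr ⟨Or.inl ⟨rfl, h⟩, ?_, by omega, by omega, by omega⟩⟩
      simp only [pt, Units.val_neg]; module
    · exact ⟨m + 1, _, s, t, hs, ht, Or.inl ⟨Or.inl ⟨rfl, h⟩, rfl, by omega⟩⟩
    · refine ⟨m + 1, _, s + 2 ^ m, t, by omega, ht, Or.inl ⟨Or.inl ⟨rfl, h⟩, ?_, by omega⟩⟩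
      simp only [pt, ray, Units.val_neg]; module
    · refine ⟨m + 1, _, s, t + 2 ^ m, hs, by omega, Or.inl ⟨Or.inl ⟨rfl, h⟩, ?_, by omega⟩⟩
      simp only [pt, ray]; module
  · rcases hC.succ hA hc hn with h | ⟨rfl, h | h | h | h⟩
    · exact ⟨m, P, s, t, hs, ht, Or.inr ⟨h, rfl, hs1, ht1, hst⟩⟩
    · rw [neg_neg] at h
      refine ⟨m + 1, _, 2 ^ m - s, 2 ^ m - t, by omega, by omega,
        Or.inl ⟨Or.inl ⟨rfl, h⟩, ?_, by omega⟩⟩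
      simp only [pt, Units.val_neg]; module
    · exact ⟨m + 1, _, s, t, hs, ht, Or.inr ⟨Or.inl ⟨rfl, h⟩, rfl, by omega, by omega, by omega⟩⟩
    · refine ⟨m + 1, _, s + 2 ^ m, t, by omega, ht,
        Or.inr ⟨Or.inl ⟨rfl, h⟩, ?_, by omega, by omega, by omega⟩⟩
      simp only [pt, ray, Units.val_neg]; module
    · refine ⟨m + 1, _, s, t + 2 ^ m, hs, by omega,
        Or.inr ⟨Or.inl ⟨rfl, h⟩, ?_, by omega, by omega, by omega⟩⟩
      simp only [pt, ray, Units.val_neg]; module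

lemma covered_of_forall_not_antiCyc (hA : Alternating d)
    (hn : ∀ m < n, ∀ p k ε, ¬ AntiCyc d m p k ε) : Covered d n := by
  induction n with
  | zero => exact covered_zero
  | succ n ih => exact (ih fun m hm => hn m (by omega)).succ hA (hn n (by omega))

/-! ### The line that leaves an anticyclic triangle -/

/-- Two hierarchical triangles on both sides of a line of class `k` with a common vertex `p`
of value `k` and with equal values at the opposite vertices. -/
def Link (d : Site → ZMod 3) (n : ℕ) (p : Site) (k : ZMod 3) (ε : ℤˣ) : Prop :=
  d p = k ∧ Lev d n p k ε ∧ Lev d n p (k + 2) (-ε) ∧ d (ray p (k + 1) (-ε) (2 ^ n)) ≠ k ∧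
    d (ray p (k + 2) (-ε) (2 ^ n)) = d (ray p (k + 1) (-ε) (2 ^ n))

lemma Lev.ne_next (hA : Alternating d) (h : Lev d n p k ε) (hp : d p ≠ k + 1) :
    d (ray p (k + 1) (-ε) (2 ^ n)) ≠ d p := by
  have h3 := h.rot.rot.ne hA
  have hrep : ray (ray p (k + 1) (-ε) (2 ^ n)) (k + 1) ε (2 ^ n) = p := ray_neg_ray _
  rw [ray_ray_rot, add_two_add_two, hrep] at h3
  intro heq
  exact h3 (by rwa [heq]) heq.symm

lemma Lev.ne_far (hA : Alternating d) (h : Lev d n p k ε) (hp : d (ray p k ε (2 ^ n)) ≠ k + 2) :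
    d (ray p (k + 1) (-ε) (2 ^ n)) ≠ d (ray p k ε (2 ^ n)) := by
  have h3 := h.rot.ne hA hp
  rwa [ray_ray_rot] at h3

lemma Lev.run_next (h : Lev d n p k ε) : Run d p (k + 1) (-ε) (2 ^ n) := by
  intro i h0 hi
  have := h.rot.rot.run (2 ^ n - i) (by omega) (by omega)
  rw [add_two_add_two] at this
  refine (congrArg d ?_).trans this
  rw [Nat.cast_sub hi.le]
  simp only [ray, e_add_two, Units.val_neg]; push_cast; module

set_option synthInstance.maxSize 1000 in
lemma link_values : ∀ k x y z w : ZMod 3, y ≠ k → z ≠ k → z ≠ y → w ≠ k → y ≠ w →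
    (x ≠ k + 2 → w ≠ x) →
    x = k ∧ z ≠ k ∧ w = z ∨ x = k + 1 ∧ z = k + 2 ∨ x = k + 2 := by
  decide

/-- The six sectors at `p` are filled one after the other from the two given ones. The value `k` at
`p` rules out a smaller cyclic cell everywhere except in the third sector above the line, which is
the first alternative. If all six are filled, alternation along the edges leaves three possibilities
for the next vertex. -/
lemma Link.step (hA : Alternating d) (hc : Covered d n) (h : Link d n p k ε) :
    (∃ m, Cyc d m p (k + 2) ε) ∨ (Run d p k (-ε) (2 ^ n) ∧
      (Link d n (ray p k (-ε) (2 ^ n)) k ε ∨ Cyc d n (ray p k (-ε) (2 ^ n)) k ε ∨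
        d (ray p k (-ε) (2 ^ n)) = k + 2)) := by
  obtain ⟨hp, hu, hl, hs, hss⟩ := h
  rcases hc.left (by rw [hp]; exact (add_one_ne k).symm) hu.run_next with hu2 | ⟨m, -, hm⟩
  swap
  · have := hm.2.1
    rw [hp, add_one_add_one] at this
    exact (add_two_ne k this.symm).elim
  have r2 := hu2.run_next
  rw [add_one_add_one, neg_neg] at r2
  have hs1 : d (ray p (k + 2) ε (2 ^ n)) ≠ k := by
    have := hu2.ne_next hA (by rw [hp, add_one_add_one]; exact (add_two_ne k).symm)
    rwa [hp, add_one_add_one, neg_neg] at this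
  have hs2 : d (ray p (k + 2) ε (2 ^ n)) ≠ d (ray p (k + 1) (-ε) (2 ^ n)) := by
    have := hu2.ne_far hA (by rwa [add_one_add_two])
    rwa [add_one_add_one, neg_neg] at this
  rcases hc.left (by rw [hp]; exact (add_two_ne k).symm) r2 with hu3 | ⟨m, -, hm⟩
  swap
  · exact Or.inl ⟨m, hm⟩
  have hl2 := hc.right (by rw [hp]; exact (add_two_ne k).symm) hl.run
  rw [add_two_add_two, neg_neg] at hl2
  have ht1 : d (ray p (k + 1) ε (2 ^ n)) ≠ k := by
    have := hl2.ne hA (by rw [hp]; exact (add_one_ne k).symm)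
    rwa [hp] at this
  have ht2 : d (ray p (k + 2) (-ε) (2 ^ n)) ≠ d (ray p (k + 1) ε (2 ^ n)) := by
    have := hl2.ne_far hA
    rw [add_one_add_one] at this
    intro heq
    by_cases h3 : d (ray p (k + 1) ε (2 ^ n)) = k + 1 + 2
    · rw [add_one_add_two] at h3; exact ht1 h3
    · exact this h3 heq
  have hl3 := hc.right (by rw [hp]; exact (add_one_ne k).symm) hl2.run
  rw [add_one_add_two] at hl3
  have e1 : Lev d n (ray p k (-ε) (2 ^ n)) k ε := by
    refine hu3.rot.rot.congr ?_ ?_ rfl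
    · simp only [ray, add_two_add_two, e_add_two, Units.val_neg]; module
    · rw [add_two_add_two, add_two_add_one]
  have e2 := hl3.rot
  have a1 : ray (ray p k (-ε) (2 ^ n)) (k + 1) (-ε) (2 ^ n) = ray p (k + 2) ε (2 ^ n) := by
    simp only [ray, e_add_two, Units.val_neg]; module
  have a2 : ray (ray p k (-ε) (2 ^ n)) (k + 2) (-ε) (2 ^ n) = ray p (k + 1) ε (2 ^ n) := by
    simp only [ray, e_add_two, Units.val_neg]; module
  have a3 : ray (ray p k (-ε) (2 ^ n)) k ε (2 ^ n) = p := ray_neg_ray _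
  have c3 := e2.ne hA
  rw [a2] at c3
  refine Or.inr ⟨hl3.run, ?_⟩
  rw [Link, Cyc, a1, a2, a3]
  simp only [e1, e2, hp, true_and]
  rw [hss] at ht2
  exact link_values k _ _ _ _ hs hs1 hs2 ht1 ht2 c3

/-- The value `k + 2` at the far end of the edge yields a triangle on the other side, and
alternation along its two other edges forces its opposite vertex to have the value `k + 1`, like
that of the given triangle. -/
lemma AntiCyc.link (hA : Alternating d) (hc : Covered d n) (h : AntiCyc d n p k ε) :
    Link d n p k ε := by
  obtain ⟨h1, h2, h3, h4⟩ := h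
  have hrun : Run d (ray p k ε (2 ^ n)) k (-ε) (2 ^ n) := by
    have := h1.rot.run_next
    rwa [add_two_add_one] at this
  have a3 : ray (ray p k ε (2 ^ n)) k (-ε) (2 ^ n) = p := by
    simp only [ray, Units.val_neg]; module
  rcases hc.left (by rw [h3]; exact add_two_ne k) hrun with hl | ⟨m, -, hm⟩
  swap
  · have := hm.2.1
    rw [h3] at this
    exact (add_one_ne_add_two k this.symm).elim
  have hl' := hl.rot
  rw [a3] at hl'
  have b1 := hl'.ne hA (by rw [h2]; exact (add_two_ne k).symm)
  have a4 : ray (ray p k ε (2 ^ n)) (k + 1) ε (2 ^ n) = ray p (k + 2) (-ε) (2 ^ n) := by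
    simp only [ray, e_add_two, Units.val_neg]; module
  have b2 := hl.ne_next hA (by rw [h3]; exact (add_one_ne_add_two k).symm)
  rw [neg_neg, a4, h3] at b2
  rw [h2] at b1
  refine ⟨h2, h1, hl', by rw [h4]; exact add_one_ne k, ?_⟩
  rw [h4]
  clear h1 hl' hl a4 a3 hrun h2 h3 h4
  revert b1 b2
  generalize d (ray p (k + 2) (-ε) (2 ^ n)) = x
  revert k x; decide

lemma ray_ray (i j : ℤ) : ray (ray p k ε i) k ε j = ray p k ε (i + j) := by
  simp only [ray]; module

lemma ray_zero : ray p k ε 0 = p := by simp [ray]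

/-- The line of value `k` that leaves an anticyclic triangle ends in a cyclic one, or nowhere. -/
lemma AntiCyc.chain (hA : Alternating d) (hc : Covered d n) (h : AntiCyc d n p k ε) :
    (∀ t : ℕ, d (ray p k (-ε) t) = k) ∨
      ∃ m, ∃ t : ℕ, Cyc d m (ray p k (-ε) (t + 2 ^ m)) k ε := by
  by_contra! hcon
  obtain ⟨hinf, hcyc⟩ := hcon
  have key : ∀ i : ℕ, (∀ t : ℕ, t ≤ i * 2 ^ n → d (ray p k (-ε) t) = k) ∧
      Link d n (ray p k (-ε) ((i * 2 ^ n : ℕ) : ℤ)) k ε := by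
    intro i
    induction i with
    | zero =>
      refine ⟨fun t ht => ?_, ?_⟩
      · obtain rfl : t = 0 := by omega
        simpa [ray] using h.2.1
      · simpa [ray] using h.link hA hc
    | succ i ih =>
      obtain ⟨ih1, ih2⟩ := ih
      have hN : (0 : ℤ) < 2 ^ n := by positivity
      have hi1 : ((i + 1 : ℕ) * 2 ^ n : ℕ) = i * 2 ^ n + 2 ^ n := by ring
      rw [hi1]
      rcases ih2.step hA hc with ⟨m, hm⟩ | ⟨hrun, h'⟩
      · refine (hcyc m (i * 2 ^ n) (hm.rot.rot.congr ?_ ?_)).elim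
        · simp only [ray, add_two_add_two, e_add_two, Units.val_neg]; module
        · rw [add_two_add_two, add_two_add_one]
      have hlt : ∀ t : ℕ, t < i * 2 ^ n + 2 ^ n → d (ray p k (-ε) t) = k := by
        intro t ht
        by_cases hti : t ≤ i * 2 ^ n
        · exact ih1 t hti
        · have := hrun (t - i * 2 ^ n) (by omega) (by omega)
          rw [ray_ray] at this
          refine (congrArg d ?_).trans this
          congr 1; push_cast [Nat.cast_sub (show i * 2 ^ n ≤ t by omega)]; ring
      rw [ray_ray] at h'
      have hcast : ((i * 2 ^ n : ℕ) : ℤ) + 2 ^ n = ((i * 2 ^ n + 2 ^ n : ℕ) : ℤ) := by push_cast; ring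
      rw [hcast] at h'
      rcases h' with h' | h' | h'
      · refine ⟨fun t ht => ?_, h'⟩
        rcases ht.lt_or_eq with ht | rfl
        exacts [hlt t ht, h'.1]
      · refine (hcyc n (i * 2 ^ n) ?_).elim
        convert h' using 2
      -- The value `k + 2` would occur at both ends of a run of class `k`: here, and at the vertex
      -- of the anticyclic triangle from which the line comes.
      · exfalso
        have hb := h.2.2.1
        refine hA (ray p k ε (2 ^ n)) k (-ε) (2 ^ n + (i * 2 ^ n + 2 ^ n)) (by positivity)
          (by rw [hb]; exact add_two_ne k) ?_ ?_
        · intro t h0 ht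
          by_cases h2 : t < 2 ^ n
          · have := h.1.run (2 ^ n - t) (by omega) (by omega)
            refine (congrArg d ?_).trans this
            rw [Nat.cast_sub h2.le]
            simp only [ray, Units.val_neg]; push_cast; module
          · refine (congrArg d ?_).trans (hlt (t - 2 ^ n) (by omega))
            rw [Nat.cast_sub (by omega)]
            simp only [ray, Units.val_neg]; push_cast; module
        · rw [hb, ← h']
          congr 1
          simp only [ray, Units.val_neg]; push_cast; module
  refine hinf.elim fun t ht => ht ((key t).1 t ?_)
  exact Nat.le_mul_of_pos_right t (by positivity)

/-! ### The graph formed by the trees -/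

/-- The trees of two neighbouring tiles meet. -/
def Adj (d : Site → ZMod 3) (x y : Site) : Prop :=
  ∃ (k : ZMod 3) (ε : ℤˣ), y = ray x k ε 1 ∧ d x + 1 ≠ k ∧ d y + 1 ≠ k

/-- The graph of the trees is connected. -/
def TreeConnected (d : Site → ZMod 3) : Prop :=
  ∀ K : Set Site, K.Nonempty → (∀ x ∈ K, ∀ y, Adj d x y → y ∈ K) → K = univ

/-- On the line along which `x` is not central, `y` is the central site of the piece
that contains `x`. -/
def Par (d : Site → ZMod 3) (x y : Site) : Prop :=
  ∃ (ε : ℤˣ) (L : ℕ), 0 < L ∧ Run d x (d x) ε L ∧ y = ray x (d x) ε L ∧ d y = d x + 1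

lemma Adj.symm {x y : Site} (h : Adj d x y) : Adj d y x := by
  obtain ⟨k, ε, rfl, h1, h2⟩ := h
  exact ⟨k, -ε, by simp only [ray, Units.val_neg]; module, h2, h1⟩

lemma int_units_eq_or (ε δ : ℤˣ) : δ = ε ∨ δ = -ε := by
  rcases Int.units_eq_one_or ε with rfl | rfl <;> rcases Int.units_eq_one_or δ with rfl | rfl <;>
    simp

/-- Two candidates in the same direction exclude each other; in opposite directions they would be
two equal values at the ends of a run, against alternation. -/
lemma Par.unique (hA : Alternating d) {x y z : Site} (hy : Par d x y) (hz : Par d x z) :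
    y = z := by
  obtain ⟨ε, L, hL, hrun, rfl, hdy⟩ := hy
  obtain ⟨δ, M, hM, hrun', rfl, hdz⟩ := hz
  rcases int_units_eq_or ε δ with rfl | rfl
  · rcases lt_trichotomy L M with h | rfl | h
    · exact (add_one_ne _ (hdy.symm.trans (hrun' L hL h))).elim
    · rfl
    · exact (add_one_ne _ (hdz.symm.trans (hrun M hM h))).elim
  · exfalso
    refine hA (ray x (d x) ε L) (d x) (-ε) (L + M) (by omega) (by rw [hdy]; exact add_one_ne _)
      ?_ ?_
    · intro i h0 hi
      rcases lt_trichotomy i L with h | rfl | h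
      · refine (congrArg d ?_).trans (hrun (L - i) (by omega) (by omega))
        rw [Nat.cast_sub h.le]; simp only [ray, Units.val_neg]; module
      · congr 1; simp only [ray, Units.val_neg]; module
      · refine (congrArg d ?_).trans (hrun' (i - L) (by omega) (by omega))
        rw [Nat.cast_sub h.le]; simp only [ray, Units.val_neg]; module
    · rw [hdy, ← hdz]; congr 1; push_cast; simp only [ray, Units.val_neg]; module

/-- Both values are `k` or `k + 1`, because `k + 2` has no arms of class `k`; alternation excludes
`k + 1` twice. -/
lemma adj_values : ∀ k x y : ZMod 3, x + 1 ≠ k → y + 1 ≠ k → (x ≠ k → y ≠ x) →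
    (k = x ∧ y = x + 1) ∨ (k = y ∧ x = y + 1) ∨ (x = y ∧ k = x) := by
  decide

lemma Adj.cases (hA : Alternating d) {x y : Site} (h : Adj d x y) :
    Par d x y ∨ Par d y x ∨ (d x = d y ∧ ∃ ε, y = ray x (d x) ε 1) := by
  obtain ⟨k, ε, hy, h1, h2⟩ := h
  have h3 : d x ≠ k → d y ≠ d x := fun hx => by
    have := hA x k ε 1 one_pos hx (fun i h0 hi => by omega)
    rwa [Nat.cast_one, ← hy] at this
  rcases adj_values k _ _ h1 h2 h3 with ⟨rfl, h⟩ | ⟨rfl, h⟩ | ⟨h, rfl⟩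
  · exact Or.inl ⟨ε, 1, one_pos, fun i h0 hi => by omega, by simpa using hy, h⟩
  · refine Or.inr (Or.inl ⟨-ε, 1, one_pos, fun i h0 hi => by omega, ?_, h⟩)
    have hx : x = ray (ray x (d y) ε 1) (d y) (-ε) 1 := by
      simp only [ray, Units.val_neg]; module
    rw [← hy] at hx
    simpa using hx
  · exact Or.inr (Or.inr ⟨h, ε, hy⟩)

/-- Two sites on the same piece of a line of their own class have the same central site; the
distance to it changes by one. -/
lemma Par.of_ray {x z : Site} (hx : d (ray x (d x) ε 1) = d x) (h : Par d x z) :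
    Par d (ray x (d x) ε 1) z := by
  obtain ⟨δ, L, hL, hrun, rfl, hz⟩ := h
  rcases int_units_eq_or ε δ with rfl | rfl
  · have hL1 : L ≠ 1 := by
      rintro rfl
      rw [Nat.cast_one, hx] at hz
      exact add_one_ne _ hz.symm
    refine ⟨δ, L - 1, by omega, ?_, ?_, by rw [hz, hx]⟩
    · intro i h0 hi
      rw [hx]
      refine (congrArg d ?_).trans (hrun (i + 1) (by omega) (by omega))
      push_cast; simp only [ray]; module
    · rw [hx, Nat.cast_sub (by omega)]; push_cast; simp only [ray]; module
  · refine ⟨-ε, L + 1, by omega, ?_, ?_, by rw [hz, hx]⟩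
    · intro i h0 hi
      rw [hx]
      rcases (show 1 ≤ i by omega).lt_or_eq with h1 | rfl
      · refine (congrArg d ?_).trans (hrun (i - 1) (by omega) (by omega))
        rw [Nat.cast_sub h1.le]; push_cast; simp only [ray, Units.val_neg]; module
      · congr 1; simp only [ray, Units.val_neg]; push_cast; module
    · rw [hx]; push_cast; simp only [ray, Units.val_neg]; module

/-! ### Sinks -/

/-- A set of sites that is closed under passing to parents, and contains whole pieces of lines
that have no central site. -/
structure IsSink (d : Site → ZMod 3) (R : Set Site) : Prop where
  nonempty : R.Nonempty
  par : ∀ x ∈ R, ∀ y, Par d x y → y ∈ R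
  line : ∀ x ∈ R, (∀ y, ¬ Par d x y) → ∀ ε, d (ray x (d x) ε 1) = d x → ray x (d x) ε 1 ∈ R

/-- The sites with an ancestor in `R` are closed under adjacency, hence they are all sites. A site
of `S` thus has an ancestor in `R`, and this ancestor is still in `S`. -/
lemma IsSink.inter_nonempty (hA : Alternating d) (hd : TreeConnected d) {R S : Set Site}
    (hR : IsSink d R) (hS : IsSink d S) : (R ∩ S).Nonempty := by
  have key : {x | ∃ y ∈ R, Relation.ReflTransGen (Par d) x y} = univ := by
    refine hd _ ?_ ?_
    · obtain ⟨x, hx⟩ := hR.nonempty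
      exact ⟨x, x, hx, .refl⟩
    · rintro x ⟨z, hz, hxz⟩ y hxy
      have hpar : ∀ w, Par d x w → w ∈ {x | ∃ y ∈ R, Relation.ReflTransGen (Par d) x y} := by
        intro w hw
        rcases Relation.ReflTransGen.cases_head hxz with rfl | ⟨w', h1, h2⟩
        · exact ⟨w, hR.par x hz w hw, .refl⟩
        · rw [hw.unique hA h1]; exact ⟨z, hz, h2⟩
      rcases hxy.cases hA with h | h | ⟨h, ε, rfl⟩
      · exact hpar y h
      · exact ⟨z, hz, .head h hxz⟩
      · by_cases hx : ∃ w, Par d x w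
        · obtain ⟨w, hw⟩ := hx
          obtain ⟨z', hz', hwz⟩ := hpar w hw
          exact ⟨z', hz', .head (hw.of_ray h.symm) hwz⟩
        · rcases Relation.ReflTransGen.cases_head hxz with rfl | ⟨w', h1, -⟩
          · exact ⟨_, hR.line x hz (not_exists.mp hx) ε h.symm, .refl⟩
          · exact (hx ⟨w', h1⟩).elim
  obtain ⟨x, hx⟩ := hS.nonempty
  obtain ⟨y, hy, hxy⟩ : x ∈ {x | ∃ y ∈ R, Relation.ReflTransGen (Par d) x y} := key ▸ mem_univ x
  refine ⟨y, hy, ?_⟩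
  clear hy
  induction hxy with
  | refl => exact hx
  | tail _ h ih => exact hS.par _ ih _ h

lemma Cyc.par (h : Cyc d n p k ε) : Par d p (ray p (k + 1) (-ε) (2 ^ n)) := by
  obtain ⟨h1, h2, -, h4⟩ := h
  refine ⟨-ε, 2 ^ n, by positivity, by rw [h2]; exact h1.run_next, by rw [h2]; push_cast; rfl, ?_⟩
  rw [h4, h2, add_one_add_one]

/-- The parent map permutes the three vertices cyclically. -/
lemma Cyc.isSink (hA : Alternating d) (h : Cyc d n p k ε) :
    IsSink d {p, ray p k ε (2 ^ n), ray p (k + 1) (-ε) (2 ^ n)} := by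
  have h1 := h.par
  have h2 := h.rot.par
  have h3 := h.rot.rot.par
  rw [ray_ray_rot_next] at h2
  rw [ray_ray_rot, add_two_add_two, add_one_add_one] at h3
  have hrep : ray (ray p (k + 1) (-ε) (2 ^ n)) (k + 2) (-ε) (2 ^ n) = ray p k ε (2 ^ n) := by
    simp only [ray, e_add_two, Units.val_neg]; module
  rw [hrep] at h3
  refine ⟨⟨p, by simp⟩, ?_, ?_⟩
  · rintro x (rfl | rfl | rfl) y hy
    · rw [hy.unique hA h1]; simp
    · rw [hy.unique hA h2]; simp
    · rw [hy.unique hA h3]; simp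
  · rintro x (rfl | rfl | rfl) hy
    · exact (hy _ h1).elim
    · exact (hy _ h2).elim
    · exact (hy _ h3).elim

/-- An infinite ray of equal values, cut at its start. -/
lemma isSink_ray (hp : d p = k + 2) (hr : ∀ i : ℕ, 0 < i → d (ray p k ε i) = k) :
    IsSink d {x | ∃ i : ℕ, 0 < i ∧ x = ray p k ε i} := by
  refine ⟨⟨_, 1, one_pos, rfl⟩, ?_, ?_⟩
  · rintro x ⟨i, hi, rfl⟩ y ⟨δ, L, hL, hrun, rfl, hy⟩
    rw [hr i hi] at hrun hy ⊢
    rcases int_units_eq_or ε δ with rfl | rfl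
    · exact ⟨i + L, by omega, by rw [ray_ray]; push_cast; rfl⟩
    · rcases lt_trichotomy L i with h | rfl | h
      · refine ⟨i - L, by omega, ?_⟩
        rw [Nat.cast_sub h.le]; simp only [ray, Units.val_neg]; module
      · rw [show ray (ray p k ε L) k (-ε) L = p by simp only [ray, Units.val_neg]; module, hp] at hy
        exact (add_one_ne_add_two k hy.symm).elim
      · have := hrun i hi h
        rw [show ray (ray p k ε i) k (-ε) i = p by simp only [ray, Units.val_neg]; module, hp] at this
        exact (add_two_ne k this).elim
  · rintro x ⟨i, hi, rfl⟩ - δ hδ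
    rw [hr i hi] at hδ ⊢
    rcases int_units_eq_or ε δ with rfl | rfl
    · exact ⟨i + 1, by omega, by rw [ray_ray]; push_cast; rfl⟩
    · rcases (show 1 ≤ i by omega).lt_or_eq with h | rfl
      · refine ⟨i - 1, by omega, ?_⟩
        rw [Nat.cast_sub h.le]; push_cast; simp only [ray, Units.val_neg]; module
      · rw [show ray (ray p k ε ((1 : ℕ) : ℤ)) k (-ε) 1 = p by
          push_cast; simp only [ray, Units.val_neg]; module, hp] at hδ
        exact (add_two_ne k hδ).elim

lemma pt_inj {s t s' t' : ℤ} (h : pt p k ε s t = pt p k ε s' t') : s = s' ∧ t = t' := by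
  have h1 : ((s - s') * (ε : ℤ)) • e k = ((t - t') * (ε : ℤ)) • e (k + 1) := by
    rw [← sub_eq_zero] at h ⊢
    rw [← h]; simp only [pt]; module
  have h2 : ∀ k : ZMod 3, e k = (1, 0) ∧ e (k + 1) = (0, -1) ∨ e k = (0, -1) ∧ e (k + 1) = (-1, 1) ∨
      e k = (-1, 1) ∧ e (k + 1) = (1, 0) := by decide
  rcases Int.units_eq_one_or ε with rfl | rfl <;> rcases h2 k with ⟨ha, hb⟩ | ⟨ha, hb⟩ | ⟨ha, hb⟩ <;>
    · rw [ha, hb, Prod.ext_iff] at h1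
      simp at h1
      omega

/-! ### Exclusion of anticyclic and of cyclic triangles -/

/-- The lines leaving an anticyclic triangle at two of its vertices are not both infinite. -/
lemma not_two_infinite (hA : Alternating d) (hd : TreeConnected d) (h : AntiCyc d n p k ε)
    (h1 : ∀ t : ℕ, d (ray p k (-ε) t) = k)
    (h2 : ∀ t : ℕ, d (ray (ray p k ε (2 ^ n)) (k + 2) (-ε) t) = k + 2) : False := by
  -- The ray is cut at the previous vertex, of value `l + 2`; it runs along the edge to `q` and on
  -- through the infinite line.
  have key : ∀ {q l} , AntiCyc d n q l ε → (∀ t : ℕ, d (ray q l (-ε) t) = l) →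
      IsSink d {x | ∃ i : ℕ, 0 < i ∧ x = ray (ray q l ε (2 ^ n)) l (-ε) i} ∧
      ∀ x ∈ {x | ∃ i : ℕ, 0 < i ∧ x = ray (ray q l ε (2 ^ n)) l (-ε) i}, d x = l := by
    intro q l h h1
    have hv : ∀ i : ℕ, 0 < i → d (ray (ray q l ε (2 ^ n)) l (-ε) i) = l := by
      intro i hi
      by_cases hi2 : i < 2 ^ n
      · refine (congrArg d ?_).trans (h.1.run (2 ^ n - i) (by omega) (by omega))
        rw [Nat.cast_sub hi2.le]; push_cast; simp only [ray, Units.val_neg]; module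
      · refine (congrArg d ?_).trans (h1 (i - 2 ^ n))
        rw [Nat.cast_sub (by omega)]; push_cast; simp only [ray, Units.val_neg]; module
    refine ⟨isSink_ray h.2.2.1 hv, ?_⟩
    rintro x ⟨i, hi, rfl⟩
    exact hv i hi
  obtain ⟨s1, v1⟩ := key h h1
  obtain ⟨s2, v2⟩ := key h.rot h2
  obtain ⟨x, hx1, hx2⟩ := s1.inter_nonempty hA hd s2
  exact add_two_ne k ((v2 x hx2).symm.trans (v1 x hx1))

/-- The lines leaving an anticyclic triangle at two of its vertices do not both end. -/
lemma not_two_cyc (hA : Alternating d) (hd : TreeConnected d) {m m' t t' : ℕ}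
    (h1 : Cyc d m (ray p k (-ε) (t + 2 ^ m)) k ε)
    (h2 : Cyc d m' (ray (ray p k ε (2 ^ n)) (k + 2) (-ε) (t' + 2 ^ m')) (k + 2) ε) : False := by
  obtain ⟨x, hx1, hx2⟩ := (h1.isSink hA).inter_nonempty hA hd (h2.isSink hA)
  -- The two cyclic triangles are disjoint because the coordinate along `e k` is at most `0` on the
  -- first and positive on the second.
  obtain ⟨s, b, hs, rfl⟩ : ∃ s b : ℤ, s ≤ 0 ∧ x = pt p k ε s b := by
    have : (0 : ℤ) < 2 ^ m := by positivity
    rcases hx1 with rfl | rfl | rfl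
    · refine ⟨-(t + 2 ^ m), 0, by omega, ?_⟩
      simp only [pt, ray, Units.val_neg]; module
    · refine ⟨-t, 0, by omega, ?_⟩
      simp only [pt, ray, Units.val_neg]; module
    · refine ⟨-(t + 2 ^ m), 2 ^ m, by omega, ?_⟩
      simp only [pt, ray, Units.val_neg]; module
  obtain ⟨s', b', hs', hx⟩ : ∃ s' b' : ℤ, 0 < s' ∧ pt p k ε s b = pt p k ε s' b' := by
    have : (0 : ℤ) < 2 ^ n := by positivity
    have : (0 : ℤ) < 2 ^ m' := by positivity
    rcases hx2 with hx | hx | hx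
    · refine ⟨2 ^ n + (t' + 2 ^ m'), -(t' + 2 ^ m'), by omega, hx.trans ?_⟩
      simp only [pt, ray, e_add_two, Units.val_neg]; module
    · refine ⟨2 ^ n + t', -t', by omega, hx.trans ?_⟩
      simp only [pt, ray, e_add_two, Units.val_neg]; module
    · refine ⟨2 ^ n + t', -(t' + 2 ^ m'), by omega, hx.trans ?_⟩
      simp only [pt, ray, e_add_two, add_two_add_one, Units.val_neg]; module
  have := (pt_inj hx).1
  omega

/-- Of the three lines that leave the triangle, two are infinite or two end in cyclic triangles; by
`AntiCyc.rot` it does not matter which two. -/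
lemma not_antiCyc_of_covered (hA : Alternating d) (hd : TreeConnected d) (hc : Covered d n) :
    ¬ AntiCyc d n p k ε := by
  intro h
  have c1 := h.chain hA hc
  have c2 := h.rot.chain hA hc
  have c3 := h.rot.rot.chain hA hc
  have h3 : ray (ray (ray p k ε (2 ^ n)) (k + 2) ε (2 ^ n)) (k + 2 + 2) ε (2 ^ n) = p := by
    simp only [ray, e_add_two, add_two_add_two]; module
  have h4 : k + 2 + 2 + 2 = k := by rw [add_two_add_two, add_two_add_one]
  rcases c1 with i1 | ⟨m1, t1, i1⟩ <;> rcases c2 with i2 | ⟨m2, t2, i2⟩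
  · exact not_two_infinite hA hd h i1 i2
  · rcases c3 with i3 | ⟨m3, t3, i3⟩
    · refine not_two_infinite hA hd h.rot.rot i3 ?_
      rw [h3, h4]; exact i1
    · exact not_two_cyc hA hd i2 i3
  · rcases c3 with i3 | ⟨m3, t3, i3⟩
    · exact not_two_infinite hA hd h.rot i2 i3
    · refine not_two_cyc (n := n) hA hd i3 (t' := t1) (m' := m1) ?_
      rw [h3, h4]; exact i1
  · exact not_two_cyc hA hd i1 i2

lemma not_antiCyc (hA : Alternating d) (hd : TreeConnected d) : ¬ AntiCyc d n p k ε := by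
  induction n using Nat.strong_induction_on generalizing p k ε with
  | _ n ih =>
    exact not_antiCyc_of_covered hA hd
      (covered_of_forall_not_antiCyc hA fun m hm p k ε => ih m hm)

lemma covered (hA : Alternating d) (hd : TreeConnected d) (n : ℕ) : Covered d n :=
  covered_of_forall_not_antiCyc hA fun _ _ _ _ _ => not_antiCyc hA hd

lemma cyc_values : ∀ k x : ZMod 3, x ≠ k + 1 → (x ≠ k + 1 → k ≠ x) → x = k + 2 := by decide

/-- To the right of a cyclic triangle there are hierarchical triangles of all sizes. -/
lemma Cyc.lev (hA : Alternating d) (hc : ∀ n, Covered d n) {m : ℕ} (h : Cyc d m p k ε)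
    (hn : m ≤ n) : Lev d n p (k + 2) (-ε) := by
  have hp : d p ≠ k := by rw [h.2.1]; exact add_one_ne k
  induction n, hn using Nat.le_induction with
  | base => exact (hc m).right hp h.1.run
  | succ n hn ih =>
    have hΓ : Run d p k ε (2 ^ n) := by
      have := ih.run_next
      rwa [add_two_add_one, neg_neg] at this
    have b1 := ih.ne hA (by rw [h.2.1]; exact add_one_ne_add_two k)
    have b2 := ih.ne_far hA
    have b3 := ih.ne_next hA (by rw [h.2.1, add_two_add_one]; exact add_one_ne k)
    rw [add_two_add_one, neg_neg] at b2 b3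
    rw [h.2.1] at b1 b3
    rw [add_two_add_two] at b2
    by_cases hk : d (ray p k ε (2 ^ n)) = k
    · refine ih.extend_corner hA (hc n) ?_ ?_
      · rw [hk] at b2
        exact cyc_values k _ b1 b2
      · rw [add_two_add_one, neg_neg]; exact hk
    -- Otherwise a triangle of side `2 ^ n` lies on the other side of the run, over the cyclic one.
    -- Its edge from `p` of class `k + 1` has the value `k + 1` inside, but passes through the third
    -- vertex of the cyclic triangle, which has the value `k + 2`.
    · exfalso
      have hr := h.2.2.2
      have hmn : m < n := by
        refine lt_of_le_of_ne hn ?_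
        rintro rfl
        exact hk h.2.2.1
      have t := (hc n).right (p := ray p k ε (2 ^ n)) (k := k) (ε := -ε) hk ?_
      · rw [neg_neg] at t
        have := t.rot.run (2 ^ n - 2 ^ m) (by
          have := Nat.pow_lt_pow_right (a := 2) (by norm_num) hmn; omega) (by
          have : 0 < (2 : ℕ) ^ n := by positivity
          have : 0 < (2 : ℕ) ^ m := by positivity
          omega)
        rw [add_two_add_two, Nat.cast_sub (Nat.pow_le_pow_right (by norm_num) hn)] at this
        refine add_one_ne_add_two k (this.symm.trans ((congrArg d ?_).trans hr))
        push_cast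
        simp only [ray, e_add_two, Units.val_neg]; module
      · intro i h0 hi
        refine (congrArg d ?_).trans (hΓ (2 ^ n - i) (by omega) (by omega))
        rw [Nat.cast_sub hi.le]; push_cast; simp only [ray, Units.val_neg]; module

/-- The triangles of all sizes at `p` have a common edge line, an infinite ray of value `k + 2`. It
is a sink that avoids the three vertices, which also form a sink. -/
lemma not_cyc (hA : Alternating d) (hd : TreeConnected d) : ¬ Cyc d n p k ε := by
  intro h
  have hray : ∀ i : ℕ, 0 < i → d (ray p (k + 2) (-ε) i) = k + 2 := fun i hi =>
    (h.lev hA (covered hA hd) (show n ≤ n + i by omega)).run i hi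
      ((Nat.lt_two_pow_self).trans_le (Nat.pow_le_pow_right (by norm_num) (by omega)))
  have hs := isSink_ray (by rw [h.2.1, add_two_add_two]) hray
  obtain ⟨x, hx, i, hi, rfl⟩ := (h.isSink hA).inter_nonempty hA hd hs
  have hv := hray i hi
  rcases hx with hx | hx | hx
  · rw [hx, h.2.1] at hv
    exact add_one_ne_add_two k hv
  · rw [hx, h.2.2.1] at hv
    exact add_two_ne k hv.symm
  · have h1 : pt p k ε i (-i) = pt p k ε 0 (2 ^ n) := by
      refine Eq.trans ?_ (hx.trans ?_) <;> simp only [pt, ray, e_add_two, Units.val_neg] <;> module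
    have := (pt_inj h1).1
    omega

/-! ### Components inside a hierarchical triangle -/

/-- The sites `x` and `y` lie in the same component of the graph of the trees. -/
def Conn (d : Site → ZMod 3) : Site → Site → Prop := Relation.ReflTransGen (Adj d)

lemma Conn.trans {x y z : Site} (h : Conn d x y) (h' : Conn d y z) : Conn d x z :=
  Relation.ReflTransGen.trans h h'

lemma Conn.symm {x y : Site} (h : Conn d x y) : Conn d y x := by
  induction h with
  | refl => exact .refl
  | tail _ h ih => exact .head h.symm ih

/-- `k + 2` is the only value whose tree has no arms of class `k`. -/
lemma conn_ray {L : ℕ} (h : ∀ i : ℕ, i ≤ L → d (ray p k ε i) ≠ k + 2) :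
    Conn d p (ray p k ε L) := by
  have harm : ∀ k x : ZMod 3, x ≠ k + 2 → x + 1 ≠ k := by decide
  induction L with
  | zero => rw [Nat.cast_zero, ray_zero]; exact .refl
  | succ L ih =>
    refine (ih fun i hi => h i (by omega)).tail
      ⟨k, ε, ?_, harm _ _ (h L (by omega)), harm _ _ (h (L + 1) le_rfl)⟩
    rw [ray_ray]; push_cast; rfl

lemma conn_run {L : ℕ} (hp : d p ≠ k + 2) (hr : Run d p k ε L) (hL : d (ray p k ε L) ≠ k + 2) :
    Conn d p (ray p k ε L) := by
  refine conn_ray fun i hi => ?_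
  rcases hi.lt_or_eq with hi | rfl
  · rcases Nat.eq_zero_or_pos i with rfl | h0
    · rwa [Nat.cast_zero, ray_zero]
    · rw [hr i h0 hi]; exact (add_two_ne k).symm
  · exact hL

/-- A site in the middle of a piece of a line is joined to one of its ends. -/
lemma conn_or_conn (hA : Alternating d) {L : ℕ} (hp : d p = k) (hL : 0 < L) (h1 : Run d p k ε L)
    (h2 : Run d p k (-ε) L) : Conn d p (ray p k ε L) ∨ Conn d p (ray p k (-ε) L) := by
  have hp' : d p ≠ k + 2 := by rw [hp]; exact (add_two_ne k).symm
  -- Only the value `k + 2` blocks an end, and alternation forbids it at both ends.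
  by_cases hz : d (ray p k ε L) = k + 2
  · refine Or.inr (conn_run hp' h2 fun hz2 => ?_)
    refine hA (ray p k ε L) k (-ε) (L + L) (by omega) (by rw [hz]; exact add_two_ne k) ?_ ?_
    · intro i h0 hi
      rcases lt_trichotomy i L with h | rfl | h
      · refine (congrArg d ?_).trans (h1 (L - i) (by omega) (by omega))
        rw [Nat.cast_sub h.le]; simp only [ray, Units.val_neg]; module
      · refine (congrArg d ?_).trans hp; simp only [ray, Units.val_neg]; module
      · refine (congrArg d ?_).trans (h2 (i - L) (by omega) (by omega))
        rw [Nat.cast_sub h.le]; simp only [ray, Units.val_neg]; module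
    · rw [hz, ← hz2]; congr 1; push_cast; simp only [ray, Units.val_neg]; module
  · exact Or.inl (conn_run hp' h1 hz)

lemma Lev.conn_step (hA : Alternating d) (h : Lev d n p k ε) {v : ℕ} (hv : v < n) {a b : ℤ}
    (ha : 0 ≤ a) (hb : 0 ≤ b) (hab : 2 ^ v * (a + b) ≤ 2 ^ n) (ha2 : a % 2 = 1)
    (hb2 : b % 2 = 0) :
    Conn d (pt p k ε (2 ^ v * a) (2 ^ v * b)) (pt p k ε (2 ^ v * (a + 1)) (2 ^ v * b)) ∨
      Conn d (pt p k ε (2 ^ v * a) (2 ^ v * b)) (pt p k ε (2 ^ v * (a - 1)) (2 ^ v * b)) := by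
  obtain ⟨w, rfl⟩ : ∃ w, n = v + 1 + w := ⟨n - (v + 1), by omega⟩
  have hN : (2 : ℤ) ^ (v + 1 + w) = 2 ^ v * (2 * 2 ^ w) := by ring
  have hp : (0 : ℤ) < 2 ^ v := by positivity
  have hab' : a + 1 + b ≤ 2 * 2 ^ w := by
    rw [hN] at hab
    have := le_of_mul_le_mul_left hab hp
    omega
  have hle : 2 ^ v * (a + 1 + b) ≤ (2 : ℤ) ^ (v + 1 + w) := by
    rw [hN]; exact mul_le_mul_of_nonneg_left hab' hp.le
  have := conn_or_conn (L := 2 ^ v) (ε := ε) hA ((h v hv a b ha hb hab).1 ha2 hb2) (by positivity)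
    ?_ ?_
  · refine this.imp (fun h => ?_) (fun h => ?_)
    all_goals
      convert h using 1
      push_cast; simp only [pt, ray, Units.val_neg]; module
  · intro i h0 hi
    refine (congrArg d ?_).trans (h.edge hv.le ha hb hle (i := i) (by omega) (by exact_mod_cast hi))
    simp only [pt, ray]; module
  · intro i h0 hi
    have hi' : (i : ℤ) < 2 ^ v := by exact_mod_cast hi
    refine (congrArg d ?_).trans (h.edge hv.le (a := a - 1) (by omega) hb
      (by refine le_trans (mul_le_mul_of_nonneg_left ?_ hp.le) hle; omega) (i := 2 ^ v - i)
        (by omega) (by omega))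
    simp only [pt, ray, Units.val_neg]; module

/-- The induction goes from coarse levels to fine ones: a site with an odd coordinate at level `v`
is the midpoint of an edge and is joined to one of its ends, which has level `v + 1`. The three edge
directions are reduced to one by `Lev.rot`. -/
lemma Lev.exists_conn_aux (hA : Alternating d) (h : Lev d n p k ε) (j : ℕ) :
    ∀ v : ℕ, v + j = n → ∀ a b : ℤ, 0 ≤ a → 0 ≤ b → 2 ^ v * (a + b) ≤ 2 ^ n →
      Conn d (pt p k ε (2 ^ v * a) (2 ^ v * b)) p ∨
      Conn d (pt p k ε (2 ^ v * a) (2 ^ v * b)) (ray p k ε (2 ^ n)) ∨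
      Conn d (pt p k ε (2 ^ v * a) (2 ^ v * b)) (ray p (k + 1) (-ε) (2 ^ n)) := by
  induction j with
  | zero =>
    rintro v rfl a b ha hb hab
    have hp : (0 : ℤ) < 2 ^ v := by positivity
    have hab' : a + b ≤ 1 := by
      refine le_of_mul_le_mul_left ?_ hp
      rw [mul_one]; exact hab
    rcases ha.lt_or_eq with ha | rfl
    · obtain ⟨rfl, rfl⟩ : a = 1 ∧ b = 0 := by omega
      refine Or.inr (Or.inl ?_)
      rw [mul_one, mul_zero, ← ray_eq_pt]
      exact .refl
    rcases hb.lt_or_eq with hb | rfl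
    · obtain rfl : b = 1 := by omega
      refine Or.inr (Or.inr ?_)
      rw [mul_one, mul_zero, ← ray_next_eq_pt]
      exact .refl
    · refine Or.inl ?_
      rw [mul_zero, ← ray_eq_pt, ray_zero]
      exact .refl
  | succ j ih =>
    intro v hv a b ha hb hab
    obtain ⟨w, rfl⟩ : ∃ w, n = v + 1 + w := ⟨n - (v + 1), by omega⟩
    have hN : (2 : ℤ) ^ (v + 1 + w) = 2 ^ v * (2 * 2 ^ w) := by ring
    have hp : (0 : ℤ) < 2 ^ v := by positivity
    rw [hN] at hab
    have hab' : a + b ≤ 2 * 2 ^ w := le_of_mul_le_mul_left hab hp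
    have even : ∀ a' b' : ℤ, 0 ≤ a' → 0 ≤ b' → a' + b' ≤ 2 * 2 ^ w → a' % 2 = 0 → b' % 2 = 0 →
        Conn d (pt p k ε (2 ^ v * a) (2 ^ v * b)) (pt p k ε (2 ^ v * a') (2 ^ v * b')) →
        Conn d (pt p k ε (2 ^ v * a) (2 ^ v * b)) p ∨
        Conn d (pt p k ε (2 ^ v * a) (2 ^ v * b)) (ray p k ε (2 ^ (v + 1 + w))) ∨
        Conn d (pt p k ε (2 ^ v * a) (2 ^ v * b)) (ray p (k + 1) (-ε) (2 ^ (v + 1 + w))) := by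
      intro a' b' ha' hb' hab' ha2 hb2 hc
      obtain ⟨a', rfl⟩ := Int.dvd_of_emod_eq_zero ha2
      obtain ⟨b', rfl⟩ := Int.dvd_of_emod_eq_zero hb2
      have := ih (v + 1) (by omega) a' b' (by omega) (by omega) (by
        rw [hN, pow_succ, mul_assoc]; exact mul_le_mul_of_nonneg_left (by omega) hp.le)
      rw [pow_succ, mul_assoc, mul_assoc] at this
      exact this.imp hc.trans (Or.imp hc.trans hc.trans)
    rcases Int.emod_two_eq_zero_or_one a with ha2 | ha2 <;>
      rcases Int.emod_two_eq_zero_or_one b with hb2 | hb2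
    · exact even a b ha hb hab' ha2 hb2 .refl
    · have := h.rot.rot.conn_step hA (v := v) (a := 2 * 2 ^ w - a - b) (b := a) (by omega)
        (by omega) ha (by rw [hN]; exact mul_le_mul_of_nonneg_left (by omega) hp.le) (by omega) ha2
      have e1 : ∀ x : ℤ, pt (ray (ray p k ε (2 ^ (v + 1 + w))) (k + 2) ε (2 ^ (v + 1 + w)))
          (k + 2 + 2) ε (2 ^ v * x) (2 ^ v * a) =
          pt p k ε (2 ^ v * a) (2 ^ v * (2 * 2 ^ w - x - a)) := by
        intro x
        rw [hN]
        simp only [pt, ray, e_add_two, add_two_add_two, add_one_add_one]; module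
      rw [e1, e1, e1] at this
      rw [show 2 * 2 ^ w - (2 * 2 ^ w - a - b) - a = b by ring] at this
      rcases this with h | h
      · exact even _ _ ha (by omega) (by omega) ha2 (by omega) h
      · exact even _ _ ha (by omega) (by omega) ha2 (by omega) h
    · rcases h.conn_step hA (v := v) (by omega) ha hb (by rw [hN]; exact hab) ha2 hb2 with h | h
      · exact even _ _ (by omega) hb (by omega) (by omega) hb2 h
      · exact even _ _ (by omega) hb (by omega) (by omega) hb2 h
    · have := h.rot.conn_step hA (v := v) (a := b) (b := 2 * 2 ^ w - a - b) (by omega) hb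
        (by omega) (by rw [hN]; exact mul_le_mul_of_nonneg_left (by omega) hp.le) hb2 (by omega)
      have e1 : ∀ x : ℤ, pt (ray p k ε (2 ^ (v + 1 + w))) (k + 2) ε (2 ^ v * x)
          (2 ^ v * (2 * 2 ^ w - a - b)) = pt p k ε (2 ^ v * (a + b - x)) (2 ^ v * x) := by
        intro x
        rw [hN]
        simp only [pt, ray, e_add_two, add_two_add_one]; module
      rw [e1, e1, e1] at this
      rw [show a + b - b = a by ring] at this
      rcases this with h | h
      · exact even _ _ (by omega) (by omega) (by omega) (by omega) (by omega) h
      · exact even _ _ (by omega) (by omega) (by omega) (by omega) (by omega) h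

/-- Each site of a hierarchical triangle is joined to one of its vertices. -/
lemma Lev.exists_conn (hA : Alternating d) (h : Lev d n p k ε) {s t : ℤ} (hs : 0 ≤ s) (ht : 0 ≤ t)
    (hst : s + t ≤ 2 ^ n) :
    Conn d (pt p k ε s t) p ∨ Conn d (pt p k ε s t) (ray p k ε (2 ^ n)) ∨
      Conn d (pt p k ε s t) (ray p (k + 1) (-ε) (2 ^ n)) := by
  simpa using h.exists_conn_aux hA n 0 (by omega) s t hs ht (by simpa using hst)

/-! ### Patterns that look locally like connected ones -/

/-- On each finite set of sites, the pattern agrees with one whose trees form a connected graph. -/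
def LocallyConnected (d : Site → ZMod 3) : Prop :=
  ∀ F : Finset Site, ∃ d' : Site → ZMod 3, Alternating d' ∧ TreeConnected d' ∧ ∀ x ∈ F, d x = d' x

lemma LocallyConnected.alternating (h : LocallyConnected d) : Alternating d := by
  intro p k ε L hL hp hr
  obtain ⟨d', hA, -, hF⟩ := h ((Finset.range (L + 1)).image fun i : ℕ => ray p k ε i)
  have hF' : ∀ i : ℕ, i ≤ L → d (ray p k ε i) = d' (ray p k ε i) := fun i hi =>
    hF _ (Finset.mem_image.mpr ⟨i, by simpa [Nat.lt_succ_iff] using hi, rfl⟩)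
  have h0 := hF' 0 (by omega)
  rw [Nat.cast_zero, ray_zero] at h0
  rw [h0] at hp ⊢
  rw [hF' L le_rfl]
  exact hA p k ε L hL hp fun i h1 h2 => (hF' i h2.le).symm.trans (hr i h1 h2)

/-- `Cyc` and `AntiCyc` depend on finitely many values, so their absence passes from connected
patterns to locally connected ones. -/
lemma exists_finset_agree (n : ℕ) (p : Site) (k : ZMod 3) (ε : ℤˣ) : ∃ F : Finset Site,
    ∀ d d' : Site → ZMod 3, (∀ x ∈ F, d x = d' x) →
      (Lev d n p k ε → Lev d' n p k ε) ∧ d p = d' p ∧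
      d (ray p k ε (2 ^ n)) = d' (ray p k ε (2 ^ n)) ∧
      d (ray p (k + 1) (-ε) (2 ^ n)) = d' (ray p (k + 1) (-ε) (2 ^ n)) := by
  refine ⟨((Finset.Icc (0 : ℤ) (2 ^ n)) ×ˢ (Finset.Icc (0 : ℤ) (2 ^ n))).image
    fun x => pt p k ε x.1 x.2, fun d d' hF => ?_⟩
  have hF' : ∀ s t : ℤ, 0 ≤ s → s ≤ 2 ^ n → 0 ≤ t → t ≤ 2 ^ n →
      d (pt p k ε s t) = d' (pt p k ε s t) := fun s t h1 h2 h3 h4 =>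
    hF _ (Finset.mem_image.mpr ⟨(s, t), by simp [*], rfl⟩)
  have hN : (0 : ℤ) ≤ 2 ^ n := by positivity
  refine ⟨fun h v hv a b ha hb hab => ?_, ?_, ?_, ?_⟩
  · have h1 : 0 ≤ 2 ^ v * a := by positivity
    have h2 : 0 ≤ 2 ^ v * b := by positivity
    rw [← hF' _ _ h1 (by linarith) h2 (by linarith)]
    exact h v hv a b ha hb hab
  · simpa [pt] using hF' 0 0 le_rfl hN le_rfl hN
  · simpa [ray_eq_pt] using hF' (2 ^ n) 0 hN le_rfl le_rfl hN
  · simpa [ray_next_eq_pt] using hF' 0 (2 ^ n) le_rfl hN hN le_rfl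

lemma LocallyConnected.not_antiCyc (h : LocallyConnected d) : ¬ AntiCyc d n p k ε := by
  rintro ⟨h1, h2, h3, h4⟩
  obtain ⟨F, hF⟩ := exists_finset_agree n p k ε
  obtain ⟨d', hA, hd, hF'⟩ := h F
  obtain ⟨e1, e2, e3, e4⟩ := hF d d' hF'
  exact DendriteTile.not_antiCyc hA hd ⟨e1 h1, e2.symm.trans h2, e3.symm.trans h3, e4.symm.trans h4⟩

lemma LocallyConnected.not_cyc (h : LocallyConnected d) : ¬ Cyc d n p k ε := by
  rintro ⟨h1, h2, h3, h4⟩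
  obtain ⟨F, hF⟩ := exists_finset_agree n p k ε
  obtain ⟨d', hA, hd, hF'⟩ := h F
  obtain ⟨e1, e2, e3, e4⟩ := hF d d' hF'
  exact DendriteTile.not_cyc hA hd ⟨e1 h1, e2.symm.trans h2, e3.symm.trans h3, e4.symm.trans h4⟩

lemma LocallyConnected.covered (h : LocallyConnected d) (n : ℕ) : Covered d n :=
  covered_of_forall_not_antiCyc h.alternating fun _ _ _ _ _ => h.not_antiCyc

lemma LocallyConnected.left (h : LocallyConnected d) (hp : d p ≠ k) (hr : Run d p k ε (2 ^ n)) :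
    Lev d n p k ε := by
  rcases (h.covered n).left hp hr with h' | ⟨m, -, hm⟩
  exacts [h', (h.not_cyc hm).elim]

lemma LocallyConnected.right (h : LocallyConnected d) (hp : d p ≠ k) (hr : Run d p k ε (2 ^ n)) :
    Lev d n p (k + 2) (-ε) :=
  (h.covered n).right hp hr

/-- Without cyclic triangles every cell has the full side `2 ^ n`. -/
lemma LocallyConnected.exists_lev (h : LocallyConnected d) (n : ℕ) (p : Site) (k : ZMod 3)
    (ε : ℤˣ) : ∃ (P : Site) (s t : ℤ), 0 ≤ s ∧ 0 ≤ t ∧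
    ((Lev d n P k ε ∧ p = pt P k ε s t ∧ s + t + 1 ≤ 2 ^ n) ∨
      (Lev d n P k (-ε) ∧ p = pt P k (-ε) s t ∧ 1 ≤ s ∧ 1 ≤ t ∧ s + t ≤ 2 ^ n)) := by
  have hcell : ∀ {m P δ}, Cell d n m P k δ → m = n ∧ Lev d n P k δ := by
    rintro m P δ (⟨rfl, h'⟩ | ⟨-, h'⟩)
    exacts [⟨rfl, h'⟩, (h.not_cyc h').elim]
  obtain ⟨m, P, s, t, hs, ht, ⟨hC, h1⟩ | ⟨hC, h1⟩⟩ := h.covered n p k ε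
  · obtain ⟨rfl, hL⟩ := hcell hC
    exact ⟨P, s, t, hs, ht, Or.inl ⟨hL, h1⟩⟩
  · obtain ⟨rfl, hL⟩ := hcell hC
    exact ⟨P, s, t, hs, ht, Or.inr ⟨hL, h1⟩⟩

/-- Components are infinite. -/
lemma LocallyConnected.infinite_conn (h : LocallyConnected d) (x : Site) :
    {y | Conn d x y}.Infinite := by
  intro hfin
  set K := {y | Conn d x y}
  have hnb : {y | ∃ z ∈ K, ∃ (k : ZMod 3) (ε : ℤˣ), y = ray z k ε 1}.Finite := by
    have : {y | ∃ z ∈ K, ∃ (k : ZMod 3) (ε : ℤˣ), y = ray z k ε 1} =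
        (fun w : Site × ZMod 3 × ℤˣ => ray w.1 w.2.1 w.2.2 1) '' (K ×ˢ univ) := by
      ext y; constructor
      · rintro ⟨z, hz, k, ε, rfl⟩; exact ⟨(z, k, ε), ⟨hz, mem_univ _⟩, rfl⟩
      · rintro ⟨⟨z, k, ε⟩, ⟨hz, -⟩, rfl⟩; exact ⟨z, hz, k, ε, rfl⟩
    rw [this]
    exact (hfin.prod finite_univ).image _
  -- Adjacency at the sites of `K` involves only the values on `K` and its neighbours, so `K` is
  -- closed under adjacency for `d'` as well.
  obtain ⟨d', hA, hd, hF⟩ := h (hfin.toFinset ∪ hnb.toFinset)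
  have huniv : K = univ := by
    refine hd K ⟨x, .refl⟩ ?_
    rintro y hy z ⟨k, ε, rfl, h1, h2⟩
    rw [← hF y (by simp [hy])] at h1
    rw [← hF _ (Finset.mem_union_right _ (by
      rw [Set.Finite.mem_toFinset]; exact ⟨y, hy, k, ε, rfl⟩))] at h2
    exact Relation.ReflTransGen.tail hy ⟨k, ε, rfl, h1, h2⟩
  rw [huniv] at hfin
  exact Set.infinite_univ hfin

lemma exists_pt_eq (x : Site) (k : ZMod 3) (ε : ℤˣ) (q : Site) : ∃ s t : ℤ, x = pt q k ε s t := by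
  have h2 : ∀ k : ZMod 3, e k = (1, 0) ∧ e (k + 1) = (0, -1) ∨ e k = (0, -1) ∧ e (k + 1) = (-1, 1) ∨
      e k = (-1, 1) ∧ e (k + 1) = (1, 0) := by decide
  have : ∃ s t : ℤ, x = pt q k 1 s t := by
    rcases h2 k with ⟨ha, hb⟩ | ⟨ha, hb⟩ | ⟨ha, hb⟩
    · exact ⟨x.1 - q.1, x.2 - q.2, by ext <;> simp [pt, ha, hb]⟩
    · exact ⟨-(x.1 - q.1) - (x.2 - q.2), x.1 - q.1, by ext <;> (simp [pt, ha, hb]; try ring)⟩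
    · exact ⟨x.2 - q.2, -(x.1 - q.1) - (x.2 - q.2), by ext <;> (simp [pt, ha, hb]; try ring)⟩
  obtain ⟨s, t, h⟩ := this
  rcases Int.units_eq_one_or ε with rfl | rfl
  · exact ⟨s, t, h⟩
  · exact ⟨-s, -t, by rw [h]; simp [pt]⟩

lemma exists_two_pow_mul (m : ℕ) : ∀ s t : ℤ, s.natAbs + t.natAbs ≤ m → s ≠ 0 ∨ t ≠ 0 →
    ∃ (v : ℕ) (a b : ℤ), s = 2 ^ v * a ∧ t = 2 ^ v * b ∧ (a % 2 = 1 ∨ b % 2 = 1) := by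
  induction m with
  | zero => intro s t h h'; omega
  | succ m ih =>
    intro s t h h'
    by_cases hodd : s % 2 = 1 ∨ t % 2 = 1
    · exact ⟨0, s, t, by simp, by simp, hodd⟩
    · obtain ⟨v, a, b, h1, h2, h3⟩ := ih (s / 2) (t / 2) (by omega) (by omega)
      refine ⟨v + 1, a, b, ?_, ?_, h3⟩
      · rw [pow_succ, mul_comm ((2 : ℤ) ^ v), mul_assoc, ← h1]; omega
      · rw [pow_succ, mul_comm ((2 : ℤ) ^ v), mul_assoc, ← h2]; omega

/-- The period carries the site with coordinates `2 ^ (v + 1) * (2 * M + α)` and `2 ^ (v + 1) * (2 *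
M + β)` to a site of level exactly `v`, whose value depends only on the parities of `a` and `b`. A
suitable choice of `α` and `β` gives another value before the translation. The offset `M` keeps
coordinates nonnegative, and the bound on `n` keeps both sites in the triangle. -/
lemma Lev.false_of_period (h : Lev d n p k ε) {v : ℕ} {a b : ℤ} (hab : a % 2 = 1 ∨ b % 2 = 1)
    (hn : v + 2 + (16 * (a.natAbs + b.natAbs + 1)) ≤ n)
    (hx : ∀ y, d (y + pt 0 k ε (2 ^ v * a) (2 ^ v * b)) = d y) : False := by
  obtain ⟨M, hM⟩ : ∃ M : ℤ, M = a.natAbs + b.natAbs + 1 := ⟨_, rfl⟩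
  have hp : (0 : ℤ) < 2 ^ v := by positivity
  obtain ⟨w, rfl⟩ : ∃ w, n = v + 1 + w := ⟨n - (v + 1), by omega⟩
  have hN : (2 : ℤ) ^ (v + 1 + w) = 2 ^ v * (2 * 2 ^ w) := by ring
  have hw : (w : ℤ) < 2 ^ w := by exact_mod_cast Nat.lt_two_pow_self
  have main : ∀ α β : ℤ, 0 ≤ α → α ≤ 1 → 0 ≤ β → β ≤ 1 →
      d (pt p k ε (2 ^ v * (2 * (2 * M + α) + a)) (2 ^ v * (2 * (2 * M + β) + b))) =
      d (pt p k ε (2 ^ (v + 1) * (2 * M + α)) (2 ^ (v + 1) * (2 * M + β))) := by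
    intro α β _ _ _ _
    rw [← hx (pt p k ε (2 ^ (v + 1) * (2 * M + α)) (2 ^ (v + 1) * (2 * M + β)))]; congr 1
    rw [pow_succ]
    simp only [pt]; module
  have c1 : ∀ α β : ℤ, 0 ≤ α → α ≤ 1 → 0 ≤ β → β ≤ 1 → _ := fun α β _ _ _ _ =>
    h v (by omega) (2 * (2 * M + α) + a) (2 * (2 * M + β) + b) (by omega) (by omega)
      (by rw [hN]; exact mul_le_mul_of_nonneg_left (by omega) hp.le)
  have c2 : ∀ α β : ℤ, 0 ≤ α → α ≤ 1 → 0 ≤ β → β ≤ 1 → _ := fun α β _ _ _ _ =>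
    h (v + 1) (by omega) (2 * M + α) (2 * M + β) (by omega) (by omega)
      (by rw [hN, pow_succ, mul_assoc]; exact mul_le_mul_of_nonneg_left (by omega) hp.le)
  rcases Int.emod_two_eq_zero_or_one a with ha2 | ha2 <;>
    rcases Int.emod_two_eq_zero_or_one b with hb2 | hb2
  · omega
  · have h1 := main 1 0 (by norm_num) (by norm_num) (by norm_num) (by norm_num)
    rw [(c1 1 0 (by norm_num) (by norm_num) (by norm_num) (by norm_num)).2.1 (by omega) (by omega),
      (c2 1 0 (by norm_num) (by norm_num) (by norm_num) (by norm_num)).1 (by omega) (by omega)] at h1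
    exact add_one_ne k h1
  · have h1 := main 0 1 (by norm_num) (by norm_num) (by norm_num) (by norm_num)
    rw [(c1 0 1 (by norm_num) (by norm_num) (by norm_num) (by norm_num)).1 (by omega) (by omega),
      (c2 0 1 (by norm_num) (by norm_num) (by norm_num) (by norm_num)).2.1
        (by omega) (by omega)] at h1
    exact add_one_ne k h1.symm
  · have h1 := main 1 0 (by norm_num) (by norm_num) (by norm_num) (by norm_num)
    rw [(c1 1 0 (by norm_num) (by norm_num) (by norm_num) (by norm_num)).2.2 (by omega) (by omega),
      (c2 1 0 (by norm_num) (by norm_num) (by norm_num) (by norm_num)).1 (by omega) (by omega)] at h1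
    exact add_two_ne k h1

/-- The pattern has no periods. -/
lemma LocallyConnected.eq_zero_of_period (h : LocallyConnected d) {x : Site}
    (hx : ∀ y, d (y + x) = d y) : x = 0 := by
  by_contra hx0
  obtain ⟨s, t, rfl⟩ := exists_pt_eq x 0 1 0
  have hst : s ≠ 0 ∨ t ≠ 0 := by
    by_contra! hst
    exact hx0 (by rw [hst.1, hst.2]; simp [pt])
  obtain ⟨v, a, b, rfl, rfl, hab⟩ := exists_two_pow_mul _ s t le_rfl hst
  obtain ⟨P, -, -, -, -, ⟨hL, -⟩ | ⟨hL, -⟩⟩ :=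
    h.exists_lev (v + 2 + (16 * (a.natAbs + b.natAbs + 1))) 0 0 1
  · exact hL.false_of_period hab le_rfl hx
  · refine hL.false_of_period (a := -a) (b := -b) (v := v) (by omega)
      (by rw [Int.natAbs_neg, Int.natAbs_neg]) ?_
    convert hx using 4
    simp only [pt, Units.val_neg]; module

/-- Pigeonhole form of compactness: it turns finite configurations of every size into one infinite
configuration. -/
lemma exists_forall_of_antitone {ι : Type*} [Finite ι] {Q : ι → ℕ → Prop}
    (hQ : ∀ i m n, m ≤ n → Q i n → Q i m) (h : ∀ n, ∃ i, Q i n) : ∃ i, ∀ n, Q i n := by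
  by_contra! hcon
  choose N hN using hcon
  obtain ⟨M, hM⟩ := (Set.finite_range N).bddAbove
  obtain ⟨i, hi⟩ := h M
  exact hN i (hQ i _ _ (hM ⟨i, rfl⟩) hi)

/-! ### Full lines and the number of components -/

/-- A full line of class `k` through `p` on which all values are `k`. -/
def FullLine (d : Site → ZMod 3) (p : Site) (k : ZMod 3) : Prop :=
  ∀ (ε : ℤˣ) (i : ℕ), d (ray p k ε i) = k

lemma FullLine.ray_int (h : FullLine d p k) (i : ℤ) : d (ray p k ε i) = k := by
  obtain ⟨m, rfl | rfl⟩ := Int.eq_nat_or_neg i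
  · exact h ε m
  · refine (congrArg d ?_).trans (h (-ε) m)
    simp only [ray, Units.val_neg]; module

lemma run_of_forall_lev (h : ∀ n, Lev d n p k ε) (i : ℕ) (hi : 0 < i) : d (ray p k ε i) = k :=
  (h i).run i hi Nat.lt_two_pow_self

lemma run_next_of_forall_lev (h : ∀ n, Lev d n p k ε) (i : ℕ) (hi : 0 < i) :
    d (ray p (k + 1) (-ε) i) = k + 1 :=
  (h i).run_next i hi Nat.lt_two_pow_self

/-- An infinite ray forces a full line. -/
lemma LocallyConnected.exists_fullLine_of_end (h : LocallyConnected d) (hp : d p ≠ k)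
    (hr : ∀ i : ℕ, 0 < i → d (ray p k ε i) = k) : ∃ k', FullLine d p k' := by
  have hL : ∀ n, Lev d n p k ε := fun n => h.left hp fun i h0 _ => hr i h0
  have hR : ∀ n, Lev d n p (k + 2) (-ε) := fun n => h.right hp fun i h0 _ => hr i h0
  have hr1 := run_next_of_forall_lev hL
  have hr2 := run_of_forall_lev hR
  have hcases : ∀ k x : ZMod 3, x ≠ k → x = k + 1 ∨ x = k + 2 := by decide
  have hline : ∀ {l : ZMod 3} {δ : ℤˣ}, d p = l → (∀ i : ℕ, 0 < i → d (ray p l δ i) = l) →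
      (∀ i : ℕ, 0 < i → d (ray p l (-δ) i) = l) → FullLine d p l := by
    intro l δ h0 h1 h2 γ i
    rcases Nat.eq_zero_or_pos i with rfl | hi
    · rw [Nat.cast_zero, ray_zero, h0]
    · rcases int_units_eq_or δ γ with rfl | rfl
      exacts [h1 i hi, h2 i hi]
  -- The two known sectors bound rays of classes `k + 1` and `k + 2`. One more sector at `p`
  -- supplies the opposite ray of class `d p`.
  rcases hcases k _ hp with hk | hk
  · have hR2 : ∀ n, Lev d n p (k + 1) ε := fun n => by
      have := h.right (n := n) (p := p) (k := k + 2) (ε := -ε)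
        (by rw [hk]; exact add_one_ne_add_two k) fun i h0 _ => hr2 i h0
      rwa [add_two_add_two, neg_neg] at this
    exact ⟨k + 1, hline hk (run_of_forall_lev hR2) hr1⟩
  · have hL2 : ∀ n, Lev d n p (k + 1) (-ε) := fun n => h.left
      (by rw [hk]; exact (add_one_ne_add_two k).symm) fun i h0 _ => hr1 i h0
    have hr3 := run_next_of_forall_lev hL2
    rw [add_one_add_one, neg_neg] at hr3
    exact ⟨k + 2, hline hk hr3 hr2⟩

/-- Followed backwards, the ray is a full line or has a first site of another value, to which
`exists_fullLine_of_end` applies. -/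
lemma LocallyConnected.exists_fullLine (h : LocallyConnected d)
    (hr : ∀ i : ℕ, 0 < i → d (ray p k ε i) = k) : ∃ q k', FullLine d q k' := by
  by_cases hall : ∀ i : ℕ, d (ray p k (-ε) i) = k
  · refine ⟨p, k, fun δ i => ?_⟩
    rcases int_units_eq_or ε δ with rfl | rfl
    · rcases Nat.eq_zero_or_pos i with rfl | hi
      · simpa [ray_zero] using hall 0
      · exact hr i hi
    · exact hall i
  · push Not at hall
    classical
    have hmin : ∀ {m}, m < Nat.find hall → _ := fun h => Nat.find_min hall h
    have hspec := Nat.find_spec hall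
    set m := Nat.find hall
    obtain ⟨k', hk'⟩ := h.exists_fullLine_of_end (ε := ε) hspec fun i hi => by
      rcases lt_or_ge m i with hlt | hle
      · refine (congrArg d ?_).trans (hr (i - m) (by omega))
        rw [Nat.cast_sub hlt.le]; simp only [ray, Units.val_neg]; module
      · have := hmin (show m - i < m by omega)
        push Not at this
        refine (congrArg d ?_).trans this
        rw [Nat.cast_sub hle]; simp only [ray, Units.val_neg]; module
    exact ⟨_, k', hk'⟩

lemma conn_of_forall_eq (h : ∀ i : ℕ, 0 < i → d (ray p k ε i) = k) {i : ℕ} (hi : 0 < i) :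
    Conn d (ray p k ε i) (ray p k ε 1) := by
  refine Conn.symm ?_
  have := conn_ray (d := d) (p := ray p k ε 1) (k := k) (ε := ε) (L := i - 1) fun j hj => by
    rw [ray_ray, show (1 : ℤ) + j = ((1 + j : ℕ) : ℤ) by push_cast; rfl, h _ (by omega)]
    exact (add_two_ne k).symm
  rwa [ray_ray, show (1 : ℤ) + (i - 1 : ℕ) = i by rw [Nat.cast_sub hi]; push_cast; ring] at this

lemma FullLine.conn (h : FullLine d p k) (i : ℤ) : Conn d (ray p k ε i) p := by
  refine Conn.symm ?_
  obtain ⟨m, rfl | rfl⟩ := Int.eq_nat_or_neg i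
  · exact conn_ray fun j _ => by rw [h]; exact (add_two_ne k).symm
  · have := conn_ray (d := d) (p := p) (k := k) (ε := -ε) (L := m)
      fun j _ => by rw [h]; exact (add_two_ne k).symm
    rwa [show ray p k (-ε) m = ray p k ε (-m) by simp only [ray, Units.val_neg]; module] at this

/-- The half-plane above a full line, seen from a site where hierarchical triangles of all sizes
on the line meet. -/
lemma LocallyConnected.conn_of_sector (h : LocallyConnected d) (hl : FullLine d p k)
    (h1 : ∀ n, Lev d n p k ε) (h2 : ∀ n, Lev d n p (k + 1) (-ε)) (h3 : ∀ n, Lev d n p (k + 2) ε)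
    {s t : ℤ} (ht : 0 ≤ t) :
    Conn d (pt p k ε s t) p ∨ Conn d (pt p k ε s t) (ray p (k + 1) (-ε) 1) := by
  have hA := h.alternating
  have hp : d p = k := by simpa [ray_zero] using hl 1 0
  obtain ⟨n, hn⟩ : ∃ n : ℕ, |s| + t ≤ 2 ^ n :=
    ⟨(|s| + t).toNat, by
      have : (((|s| + t).toNat : ℕ) : ℤ) < 2 ^ (|s| + t).toNat := by exact_mod_cast Nat.lt_two_pow_self
      omega⟩
  have hcast : ((2 ^ n : ℕ) : ℤ) = 2 ^ n := by push_cast; rfl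
  have r1 : Conn d (ray p k ε (2 ^ n)) p := hl.conn _
  -- The value `k` at `p` has no arms of class `k + 1`, so this ray is joined to its first site
  -- instead of to `p`.
  have r2 : Conn d (ray p (k + 1) (-ε) (2 ^ n)) (ray p (k + 1) (-ε) 1) := by
    rw [← hcast]
    exact conn_of_forall_eq (run_next_of_forall_lev h1) (by positivity)
  have r3 : Conn d (ray p (k + 2) ε (2 ^ n)) p := by
    rw [← hcast]
    refine (conn_ray fun i _ => ?_).symm
    rcases Nat.eq_zero_or_pos i with rfl | hi
    · rw [Nat.cast_zero, ray_zero, hp, add_two_add_two]; exact (add_one_ne k).symm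
    · rw [run_of_forall_lev h3 i hi]; exact (add_two_ne _).symm
  have r4 : Conn d (ray p k (-ε) (2 ^ n)) p := hl.conn _
  have habs := abs_nonneg s
  have habs1 := le_abs_self s
  have habs2 := neg_abs_le s
  by_cases hs : 0 ≤ s
  · rcases (h1 n).exists_conn hA hs ht (by omega) with hc | hc | hc
    · exact Or.inl hc
    · exact Or.inl (hc.trans r1)
    · exact Or.inr (hc.trans r2)
  by_cases hst : 0 ≤ s + t
  · have hc := (h2 n).exists_conn hA hst (show 0 ≤ -s by omega) (by omega)
    rw [show pt p (k + 1) (-ε) (s + t) (-s) = pt p k ε s t by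
      simp only [pt, add_one_add_one, e_add_two, Units.val_neg]; module, add_one_add_one,
      neg_neg] at hc
    rcases hc with hc | hc | hc
    · exact Or.inl hc
    · exact Or.inr (hc.trans r2)
    · exact Or.inl (hc.trans r3)
  · have hc := (h3 n).exists_conn hA ht (show 0 ≤ -s - t by omega) (by omega)
    rw [show pt p (k + 2) ε t (-s - t) = pt p k ε s t by
      simp only [pt, add_two_add_one, e_add_two]; module, add_two_add_one] at hc
    rcases hc with hc | hc | hc
    · exact Or.inl hc
    · exact Or.inl (hc.trans r3)
    · exact Or.inl (hc.trans r4)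

/-- On one side of a full line there is at most one component that does not contain the line. -/
lemma LocallyConnected.conn_side (h : LocallyConnected d) (hl : FullLine d p k) {s t s' t' : ℤ}
    (ht : 0 ≤ t) (ht' : 0 ≤ t') :
    Conn d (pt p k ε s t) p ∨ Conn d (pt p k ε s' t') p ∨
      Conn d (pt p k ε s t) (pt p k ε s' t') := by
  have hA := h.alternating
  obtain ⟨D, hD⟩ : ∃ D : ℕ, (D : ℤ) = |s| + t + |s'| + t' :=
    ⟨(|s| + t + |s'| + t').toNat, by
      have := abs_nonneg s; have := abs_nonneg s'; omega⟩
  have b1 := abs_nonneg s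
  have b2 := le_abs_self s
  have b3 := neg_abs_le s
  have b1' := abs_nonneg s'
  have b2' := le_abs_self s'
  have b3' := neg_abs_le s'
  have hrun : ∀ (a : ℤ) (δ : ℤˣ) L, Run d (ray p k ε a) k δ L := fun a δ L i _ _ => by
    rcases int_units_eq_or ε δ with rfl | rfl
    · rw [ray_ray]; exact hl.ray_int _
    · refine (congrArg d ?_).trans (hl.ray_int (ε := ε) (a - i))
      simp only [ray, Units.val_neg]; module
  -- A triangle that contains the unit triangle at `p` has its base on the full line, because a
  -- constant line crosses no interior row.
  have hbase : ∀ n, ∃ a : ℤ, 0 ≤ a ∧ a < 2 ^ n ∧ Lev d n (ray p k (-ε) a) k ε := by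
    intro n
    obtain ⟨P, a, b, ha, hb, ⟨hL, hp, hab⟩ | ⟨hL, hp, ha1, hb1, hab⟩⟩ := h.exists_lev n p k ε
    · rcases hb.lt_or_eq with hb | rfl
      · refine (hL.false_of_run (L := 2 ^ n) le_rfl ha hb (by omega) ?_).elim
        rw [← hp]; simpa [ray_zero] using hrun 0 ε (2 ^ n)
      · refine ⟨a, ha, by omega, hL.congr ?_ rfl rfl⟩
        rw [hp]; simp only [pt, ray, Units.val_neg]; module
    · refine (hL.false_of_run_neg (L := 2 ^ n) le_rfl (by omega) (by omega) hab ?_).elim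
      rw [← hp, neg_neg]; simpa [ray_zero] using hrun 0 ε (2 ^ n)
  -- Either some base reaches at least `D` to both sides of `p`, and its triangle contains both
  -- sites, or for every size one end of the base stays within `D` of `p`. Then some site of the
  -- line is such an end for all sizes.
  by_cases hbig : ∃ n : ℕ, ∃ a : ℤ, (D : ℤ) ≤ a ∧ a + D ≤ 2 ^ n ∧ Lev d n (ray p k (-ε) a) k ε
  · obtain ⟨n, a, ha, ha2, hL⟩ := hbig
    have c1 := hL.exists_conn hA (s := s + a) (t := t) (by omega) ht (by omega)
    have c2 := hL.exists_conn hA (s := s' + a) (t := t') (by omega) ht' (by omega)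
    have e1 : ∀ s t : ℤ, pt (ray p k (-ε) a) k ε (s + a) t = pt p k ε s t := fun s t => by
      simp only [pt, ray, Units.val_neg]; module
    rw [e1] at c1 c2
    have r1 : Conn d (ray p k (-ε) a) p := hl.conn _
    have r2 : Conn d (ray (ray p k (-ε) a) k ε (2 ^ n)) p := by
      rw [show ray (ray p k (-ε) a) k ε (2 ^ n) = ray p k ε (2 ^ n - a) by
        simp only [ray, Units.val_neg]; module]
      exact hl.conn _
    rcases c1 with c1 | c1 | c1
    · exact Or.inl (c1.trans r1)
    · exact Or.inl (c1.trans r2)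
    rcases c2 with c2 | c2 | c2
    · exact Or.inr (Or.inl (c2.trans r1))
    · exact Or.inr (Or.inl (c2.trans r2))
    · exact Or.inr (Or.inr (c1.trans c2.symm))
  · push Not at hbig
    have hpig : ∃ i : Fin (D + 1) × Bool, ∀ n, (i.2 = true → Lev d n (ray p k (-ε) i.1) k ε) ∧
        (i.2 = false → Lev d n (ray p k ε i.1) (k + 2) ε) := by
      refine exists_forall_of_antitone
        (Q := fun (i : Fin (D + 1) × Bool) n => (i.2 = true → Lev d n (ray p k (-ε) i.1) k ε) ∧
        (i.2 = false → Lev d n (ray p k ε i.1) (k + 2) ε))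
        (fun i m n hmn hQ => ⟨fun h => (hQ.1 h).mono hmn, fun h => (hQ.2 h).mono hmn⟩)
        fun n => ?_
      obtain ⟨a, ha, han, hL⟩ := hbase n
      by_cases hDa : (D : ℤ) ≤ a
      · have := hbig n a hDa
        refine ⟨(⟨(2 ^ n - a).toNat, ?_⟩, false), by simp, fun _ => ?_⟩
        · by_contra hcon
          exact this (by omega) hL
        · refine hL.rot.congr ?_ rfl rfl
          simp only [Int.toNat_of_nonneg (show 0 ≤ 2 ^ n - a by omega)]
          simp only [ray, Units.val_neg]; module
      · refine ⟨(⟨a.toNat, by omega⟩, true), fun _ => ?_, by simp⟩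
        simpa only [Int.toNat_of_nonneg ha] using hL
    obtain ⟨q, hq, hql, h1, h2, h3⟩ : ∃ q : Site, (∃ c : ℤ, q = ray p k ε c) ∧ FullLine d q k ∧
        (∀ n, Lev d n q k ε) ∧ (∀ n, Lev d n q (k + 1) (-ε)) ∧ (∀ n, Lev d n q (k + 2) ε) := by
      have hfull : ∀ c : ℤ, FullLine d (ray p k ε c) k := fun c δ i => by
        rcases int_units_eq_or ε δ with rfl | rfl
        · rw [ray_ray]; exact hl.ray_int _
        · refine (congrArg d ?_).trans (hl.ray_int (ε := ε) (c - i))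
          simp only [ray, Units.val_neg]; module
      have hq0 : ∀ c : ℤ, d (ray p k ε c) = k := fun c => hl.ray_int c
      -- From the one sector at this site with triangles of all sizes the other two are filled, as
      -- the value `k` there differs from the classes of the rays between the sectors.
      obtain ⟨⟨i, b⟩, hi⟩ := hpig
      cases b
      · have h3 : ∀ n, Lev d n (ray p k ε i) (k + 2) ε := fun n => (hi n).2 rfl
        have h2 : ∀ n, Lev d n (ray p k ε i) (k + 1) (-ε) := fun n => by
          have := h.right (n := n) (by rw [hq0]; exact (add_two_ne k).symm) (h3 n).run
          rwa [add_two_add_two] at this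
        refine ⟨_, ⟨_, rfl⟩, hfull _, fun n => ?_, h2, h3⟩
        have := h.right (n := n) (by rw [hq0]; exact (add_one_ne k).symm) (h2 n).run
        rwa [add_one_add_two, neg_neg] at this
      · have hr : ray p k (-ε) i = ray p k ε (-(i : ℤ)) := by
          simp only [ray, Units.val_neg]; module
        have h1 : ∀ n, Lev d n (ray p k ε (-(i : ℤ))) k ε := fun n => hr ▸ (hi n).1 rfl
        have h2 : ∀ n, Lev d n (ray p k ε (-(i : ℤ))) (k + 1) (-ε) := fun n =>
          h.left (by rw [hq0]; exact (add_one_ne k).symm) (h1 n).run_next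
        refine ⟨_, ⟨_, rfl⟩, hfull _, h1, h2, fun n => ?_⟩
        have := (h2 n).run_next
        rw [add_one_add_one, neg_neg] at this
        exact h.left (by rw [hq0]; exact (add_two_ne k).symm) this
    obtain ⟨c, rfl⟩ := hq
    have e1 : ∀ s t : ℤ, pt p k ε s t = pt (ray p k ε c) k ε (s - c) t := fun s t => by
      simp only [pt, ray]; module
    have c1 := h.conn_of_sector hql h1 h2 h3 (s := s - c) ht
    have c2 := h.conn_of_sector hql h1 h2 h3 (s := s' - c) ht'
    rw [← e1] at c1 c2
    have r : Conn d (ray p k ε c) p := hl.conn c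
    rcases c1 with c1 | c1
    · exact Or.inl (c1.trans r)
    rcases c2 with c2 | c2
    · exact Or.inr (Or.inl (c2.trans r))
    · exact Or.inr (Or.inr (c1.trans c2.symm))

/-- Sites are coloured by their side of the line, except that those joined to the line get a third
colour; two of four sites share a colour. -/
lemma LocallyConnected.exists_conn_of_fullLine (h : LocallyConnected d) (hl : FullLine d p k)
    (x : Fin 4 → Site) : ∃ i j, i ≠ j ∧ Conn d (x i) (x j) := by
  have hside : ∀ i, ∃ ε : ℤˣ, ∃ s t : ℤ, 0 ≤ t ∧ x i = pt p k ε s t := by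
    intro i
    obtain ⟨s, t, hst⟩ := exists_pt_eq (x i) k 1 p
    rcases le_total 0 t with ht | ht
    · exact ⟨1, s, t, ht, hst⟩
    · exact ⟨-1, -s, -t, by omega, by rw [hst]; simp [pt]⟩
  choose δ s t ht hx using hside
  classical
  by_contra! hcon
  obtain ⟨i, j, hij, hf⟩ : ∃ i j, i ≠ j ∧
      (fun i => (if Conn d (x i) p then none else some (δ i) : Option ℤˣ)) i =
      (fun i => (if Conn d (x i) p then none else some (δ i) : Option ℤˣ)) j := by
    have : ¬ Function.Injective
        (fun i : Fin 4 => (if Conn d (x i) p then none else some (δ i) : Option ℤˣ)) := by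
      intro hinj
      have := Fintype.card_le_of_injective _ hinj
      simp at this
    simp only [Function.Injective] at this
    push Not at this
    obtain ⟨i, j, h1, h2⟩ := this
    exact ⟨i, j, h2, h1⟩
  refine hcon i j hij ?_
  simp only at hf
  by_cases hi : Conn d (x i) p <;> by_cases hj : Conn d (x j) p
  · exact hi.trans hj.symm
  · simp [hi, hj] at hf
  · simp [hi, hj] at hf
  · simp only [hi, hj, if_false, Option.some.injEq] at hf
    have h1 := hx i
    have h2 := hx j
    rw [← hf] at h2
    rw [h1] at hi ⊢
    rw [h2] at hj ⊢
    rcases h.conn_side hl (ht i) (ht j) with h | h | h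
    exacts [(hi h).elim, (hj h).elim, h]

lemma exists_ne_eq_of_three (f : Fin 4 → Fin 3) : ∃ i j, i ≠ j ∧ f i = f j :=
  Fintype.exists_ne_map_eq_of_card_lt f (by simp)

/-- Among four sites, two lie in the same component. -/
lemma LocallyConnected.exists_conn (h : LocallyConnected d) (x : Fin 4 → Site) :
    ∃ i j, i ≠ j ∧ Conn d (x i) (x j) := by
  by_cases hline : ∃ q k, FullLine d q k
  · obtain ⟨q, k, hl⟩ := hline
    exact h.exists_conn_of_fullLine hl x
  have hA := h.alternating
  choose σ τ hx using fun i => exists_pt_eq (x i) 0 1 (x 0)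
  obtain ⟨D, hD⟩ : ∃ D : ℕ, ∀ i, |σ i| + |τ i| ≤ D := by
    refine ⟨∑ i, ((σ i).natAbs + (τ i).natAbs), fun i => ?_⟩
    have := Finset.single_le_sum (f := fun i => (σ i).natAbs + (τ i).natAbs)
      (fun i _ => Nat.zero_le _) (Finset.mem_univ i)
    rw [Int.abs_eq_natAbs, Int.abs_eq_natAbs]
    exact_mod_cast this
  have hcoord : ∀ δ : ℤˣ, ∃ σ' τ' : Fin 4 → ℤ, (∀ i, x i = pt (x 0) 0 δ (σ' i) (τ' i)) ∧
      ∀ i, |σ' i| + |τ' i| ≤ D := by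
    intro δ
    rcases Int.units_eq_one_or δ with rfl | rfl
    · exact ⟨σ, τ, hx, hD⟩
    · refine ⟨-σ, -τ, fun i => (hx i).trans ?_, fun i => ?_⟩
      · simp [pt]
      · simpa only [Pi.neg_apply, abs_neg] using hD i
  have htri : ∀ n, ∃ (δ : ℤˣ) (P : Site) (s t : ℤ), 0 ≤ s ∧ 0 ≤ t ∧ s + t ≤ 2 ^ n ∧
      Lev d n P 0 δ ∧ x 0 = pt P 0 δ s t := by
    intro n
    obtain ⟨P, s, t, hs, ht, ⟨hL, hp, hst⟩ | ⟨hL, hp, -, -, hst⟩⟩ := h.exists_lev n (x 0) 0 1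
    · exact ⟨1, P, s, t, hs, ht, by omega, hL, hp⟩
    · exact ⟨-1, P, s, t, hs, ht, hst, hL, hp⟩
  -- If `x 0` has distance at least `D` from all edges, the triangle contains all four sites, and
  -- two of them are joined to the same vertex.
  by_cases hin : ∃ n, ∃ (δ : ℤˣ) (P : Site) (s t : ℤ), D ≤ s ∧ D ≤ t ∧ s + t + D ≤ 2 ^ n ∧
      Lev d n P 0 δ ∧ x 0 = pt P 0 δ s t
  · obtain ⟨n, δ, P, s, t, hs, ht, hst, hL, h0⟩ := hin
    obtain ⟨σ', τ', hx', hD'⟩ := hcoord δ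
    have hv : ∀ i, ∃ c : Fin 3, Conn d (x i)
        (![P, ray P 0 δ (2 ^ n), ray P (0 + 1) (-δ) (2 ^ n)] c) := by
      intro i
      have := hD' i
      have := neg_abs_le (σ' i)
      have := neg_abs_le (τ' i)
      have := le_abs_self (σ' i)
      have := le_abs_self (τ' i)
      have hxi : x i = pt P 0 δ (s + σ' i) (t + τ' i) := by
        rw [hx' i, h0]; simp only [pt]; module
      rw [hxi]
      rcases hL.exists_conn hA (s := s + σ' i) (t := t + τ' i) (by omega) (by omega)
        (by omega) with hc | hc | hc
      exacts [⟨0, hc⟩, ⟨1, hc⟩, ⟨2, hc⟩]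
    choose f hf using hv
    obtain ⟨i, j, hij, hfij⟩ := exists_ne_eq_of_three f
    exact ⟨i, j, hij, (hf i).trans (hfij ▸ (hf j).symm)⟩
  exfalso
  push Not at hin
  have hedge : ∀ n, ∃ (κ : ZMod 3) (δ : ℤˣ) (P : Site) (s t : ℤ), 0 ≤ s ∧ s ≤ 2 ^ n ∧ 0 ≤ t ∧
      t ≤ D ∧ Lev d n P κ δ ∧ x 0 = pt P κ δ s t := by
    intro n
    obtain ⟨δ, P, s, t, hs, ht, hst, hL, h0⟩ := htri n
    by_cases c1 : D ≤ t
    swap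
    · exact ⟨0, δ, P, s, t, hs, by omega, ht, by omega, hL, h0⟩
    by_cases c2 : D ≤ s
    swap
    · refine ⟨_, δ, _, 2 ^ n - s - t, s, by omega, by omega, hs, by omega, hL.rot.rot, ?_⟩
      rw [h0]; generalize (0 : ZMod 3) = κ
      simp only [pt, ray, e_add_two, add_two_add_two, add_one_add_one]; module
    · have : ¬ s + t + D ≤ 2 ^ n := fun hle => hin n δ P s t c2 c1 hle hL h0
      refine ⟨_, δ, _, t, 2 ^ n - s - t, by omega, by omega, by omega, by omega, hL.rot, ?_⟩
      rw [h0]; generalize (0 : ZMod 3) = κ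
      simp only [pt, ray, e_add_two, add_two_add_one]; module
  -- For every size some edge passes within `D` of `x 0`, and one half of it or the other contains a
  -- long run from the foot point. There are finitely many choices of distance, class and
  -- directions, so one of them gives runs of all lengths, an infinite ray.
  obtain ⟨⟨c, κ, δ, γ⟩, hrun⟩ := exists_forall_of_antitone
    (Q := fun (i : Fin (D + 1) × ZMod 3 × ℤˣ × ℤˣ) n =>
      Run d (ray (x 0) (i.2.1 + 1) i.2.2.1 i.1) i.2.1 i.2.2.2 n)
    (fun i m n hmn hQ => hQ.mono hmn) fun n => by
      obtain ⟨κ, δ, P, s, t, hs, hsn, ht, htD, hL, h0⟩ := hedge (n + 1)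
      have hn : (n : ℤ) < 2 ^ n := by exact_mod_cast Nat.lt_two_pow_self
      have hy : ray (x 0) (κ + 1) δ t = ray P κ δ s := by
        rw [h0]; simp only [pt, ray]; module
      have hP : ∀ j : ℤ, 0 < j → j < 2 ^ (n + 1) → d (ray P κ δ j) = κ := by
        intro j hj hj2
        have := hL.run j.toNat (by omega) (by zify; rw [Int.toNat_of_nonneg hj.le]; exact hj2)
        rwa [Int.toNat_of_nonneg hj.le] at this
      have hpow : (2 : ℤ) ^ (n + 1) = 2 ^ n + 2 ^ n := by ring
      rcases le_total s (2 ^ n) with hs2 | hs2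
      · refine ⟨(⟨t.toNat, by omega⟩, κ, δ, δ), fun i hi0 hi => ?_⟩
        simp only [Int.toNat_of_nonneg ht]
        rw [hy, ray_ray]
        exact hP _ (by omega) (by omega)
      · refine ⟨(⟨t.toNat, by omega⟩, κ, δ, -δ), fun i hi0 hi => ?_⟩
        simp only [Int.toNat_of_nonneg ht]
        rw [hy]
        refine (congrArg d ?_).trans (hP (s - i) (by omega) (by omega))
        simp only [ray, Units.val_neg]; module
  exact hline (h.exists_fullLine fun i hi => hrun (i + 1) i hi (Nat.lt_succ_self i))

/-! ### The hexagon -/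

lemma ω_re : ω.re = 1 / 2 := by
  rw [ω, Complex.exp_ofReal_mul_I_re, Real.cos_pi_div_three]

lemma ω_im : ω.im = √3 / 2 := by
  rw [ω, Complex.exp_ofReal_mul_I_im, Real.sin_pi_div_three]

lemma ω_im_mul_self : ω.im * ω.im = 3 / 4 := by
  rw [ω_im]
  have := Real.mul_self_sqrt (show (0 : ℝ) ≤ 3 by norm_num)
  linarith

lemma ω_im_pos : 0 < ω.im := by rw [ω_im]; positivity

lemma ω_sq : ω ^ 2 = ω - 1 := by
  have h := ω_im_mul_self
  apply Complex.ext
  · rw [pow_two, Complex.mul_re, ω_re, h, Complex.sub_re, ω_re, Complex.one_re]; norm_num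
  · rw [pow_two, Complex.mul_im, ω_re, Complex.sub_im, Complex.one_im]; ring

lemma ω_pow_three : ω ^ 3 = -1 := by linear_combination (ω + 1) * ω_sq

lemma ω_pow_six : ω ^ 6 = 1 := by linear_combination (ω ^ 3 - 1) * ω_pow_three

lemma norm_ω : ‖ω‖ = 1 := by
  rw [ω]; exact Complex.norm_exp_ofReal_mul_I _

lemma norm_ω_pow (k : ℕ) : ‖ω ^ k‖ = 1 := by rw [norm_pow, norm_ω, one_pow]

lemma ω_pow_mul_conj (k : ℕ) : ω ^ k * (starRingEnd ℂ) (ω ^ k) = 1 := by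
  rw [Complex.mul_conj, Complex.normSq_eq_norm_sq, norm_ω_pow]; norm_num

lemma ω_pow_mod (k : ℕ) : ω ^ (k % 6) = ω ^ k := by
  conv_rhs => rw [← Nat.mod_add_div k 6, pow_add, pow_mul, ω_pow_six, one_pow, mul_one]

lemma ω_pow_eq_iff {i j : ℕ} : ω ^ i = ω ^ j ↔ i % 6 = j % 6 := by
  have hprim : IsPrimitiveRoot ω 6 := by
    have := Complex.isPrimitiveRoot_exp 6 (by norm_num)
    convert this using 1
    rw [ω]; congr 1; push_cast; ring
  constructor
  · intro h
    rw [← ω_pow_mod i, ← ω_pow_mod j] at h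
    exact hprim.pow_inj (Nat.mod_lt _ (by norm_num)) (Nat.mod_lt _ (by norm_num)) h
  · intro h
    rw [← ω_pow_mod i, h, ω_pow_mod]

lemma mem_hexagon_iff_nat {z : ℂ} :
    z ∈ hexagon ↔ ∀ k : ℕ, (z * (starRingEnd ℂ) (ω ^ k)).re ≤ 1 / 2 := by
  constructor
  · intro h k
    have := h ⟨k % 6, Nat.mod_lt _ (by norm_num)⟩
    rwa [ω_pow_mod] at this
  · intro h k
    exact h k

lemma mul_mem_hexagon {z : ℂ} (h : z ∈ hexagon) (j : ℕ) : ω ^ j * z ∈ hexagon := by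
  rw [mem_hexagon_iff_nat] at h ⊢
  intro k
  have := h (5 * j + k)
  rwa [show ω ^ j * z * (starRingEnd ℂ) (ω ^ k) = z * (starRingEnd ℂ) (ω ^ (5 * j + k)) by
    have h6 : ω ^ j = (starRingEnd ℂ) (ω ^ (5 * j)) := by
      have h1 := ω_pow_mul_conj (5 * j)
      have h2 : ω ^ j * ω ^ (5 * j) = 1 := by
        rw [← pow_add, show j + 5 * j = 6 * j by ring, pow_mul, ω_pow_six, one_pow]
      calc ω ^ j = ω ^ j * (ω ^ (5 * j) * (starRingEnd ℂ) (ω ^ (5 * j))) := by rw [h1, mul_one]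
        _ = _ := by rw [← mul_assoc, h2, one_mul]
    rw [h6, pow_add, map_mul]; ring]

/-- The heights over the centre in three directions. -/
lemma hexagon_abs {z : ℂ} (h : z ∈ hexagon) : |z.re| ≤ 1 / 2 ∧
    |z.re / 2 + z.im * ω.im| ≤ 1 / 2 ∧ |z.im * ω.im - z.re / 2| ≤ 1 / 2 := by
  rw [mem_hexagon_iff_nat] at h
  have h0 := h 0
  have h1 := h 1
  have h2 := h 2
  have h3 := h 3
  have h4 := h 4
  have h5 := h 5
  have e4 : ω ^ 4 = -ω := by linear_combination ω * ω_pow_three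
  have e5 : ω ^ 5 = 1 - ω := by linear_combination ω ^ 2 * ω_pow_three - ω_sq
  simp only [ω_pow_three, e4, e5, ω_sq, pow_zero, pow_one, map_one, map_neg, map_sub,
    Complex.mul_re, Complex.conj_re, Complex.conj_im, Complex.sub_re, Complex.sub_im, Complex.neg_re,
    Complex.neg_im, Complex.one_re, Complex.one_im, ω_re] at h0 h1 h2 h3 h4 h5
  refine ⟨abs_le.mpr ⟨?_, ?_⟩, abs_le.mpr ⟨?_, ?_⟩, abs_le.mpr ⟨?_, ?_⟩⟩ <;> linarith

lemma norm_sq_eq (z : ℂ) : ‖z‖ ^ 2 = 2 / 3 * (z.re ^ 2 + (z.re / 2 + z.im * ω.im) ^ 2 +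
    (z.im * ω.im - z.re / 2) ^ 2) := by
  rw [← Complex.normSq_eq_norm_sq, Complex.normSq_apply]
  linear_combination (-(4 / 3) * z.im ^ 2) * ω_im_mul_self

/-- Up to signs, one of the three numbers is the sum of the other two with `x * y ≥ 0`, and `x ^ 2 +
y ^ 2 + (x + y) ^ 2 = 2 * (x + y) ^ 2 - 2 * (x * y)`. -/
lemma three_sq_le {a b c : ℝ} (ha : |a| ≤ 1 / 2) (hb : |b| ≤ 1 / 2) (hc : |c| ≤ 1 / 2)
    (h : c = b - a) : a ^ 2 + b ^ 2 + c ^ 2 ≤ 1 / 2 ∧ (a ^ 2 + b ^ 2 + c ^ 2 = 1 / 2 →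
      (a = 1 / 2 ∧ b = 1 / 2) ∨ (a = 0 ∧ b = 1 / 2) ∨ (a = -1 / 2 ∧ b = 0) ∨
      (a = -1 / 2 ∧ b = -1 / 2) ∨ (a = 0 ∧ b = -1 / 2) ∨ (a = 1 / 2 ∧ b = 0)) := by
  have ha2 : a ^ 2 ≤ 1 / 4 := by have := sq_le_sq' (abs_le.mp ha).1 (abs_le.mp ha).2; linarith
  have hb2 : b ^ 2 ≤ 1 / 4 := by have := sq_le_sq' (abs_le.mp hb).1 (abs_le.mp hb).2; linarith
  have hc2 : c ^ 2 ≤ 1 / 4 := by have := sq_le_sq' (abs_le.mp hc).1 (abs_le.mp hc).2; linarith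
  have hsq : ∀ x : ℝ, x ^ 2 = 1 / 4 → x = 1 / 2 ∨ x = -1 / 2 := by
    intro x hx
    have : (x - 1 / 2) * (x + 1 / 2) = 0 := by linarith
    rcases mul_eq_zero.mp this with h | h
    · left; linarith
    · right; linarith
  have key : ∀ x y z : ℝ, z ^ 2 ≤ 1 / 4 → z = x + y → 0 ≤ x * y →
      x ^ 2 + y ^ 2 + z ^ 2 ≤ 1 / 2 ∧ (x ^ 2 + y ^ 2 + z ^ 2 = 1 / 2 → z ^ 2 = 1 / 4 ∧
        (x = 0 ∨ y = 0)) := by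
    intro x y z hz h hxy
    have e : x ^ 2 + y ^ 2 + z ^ 2 = 2 * z ^ 2 - 2 * (x * y) := by rw [h]; ring
    refine ⟨by linarith, fun h' => ⟨by linarith, ?_⟩⟩
    exact mul_eq_zero.mp (by linarith)
  by_cases hc0 : c = 0
  · obtain ⟨k1, k2⟩ := key a c b hb2 (by linarith) (by rw [hc0, mul_zero])
    refine ⟨by linarith, fun h' => ?_⟩
    obtain ⟨h2, -⟩ := k2 (by linarith)
    rcases hsq b h2 with hb | hb
    · exact Or.inl ⟨by linarith, hb⟩
    · exact Or.inr (Or.inr (Or.inr (Or.inl ⟨by linarith, hb⟩)))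
  rcases le_total 0 (a * c) with h1 | h1
  · obtain ⟨k1, k2⟩ := key a c b hb2 (by linarith) h1
    refine ⟨by linarith, fun h' => ?_⟩
    obtain ⟨h2, h3⟩ := k2 (by linarith)
    rcases hsq b h2 with hb | hb <;> rcases h3 with h3 | h3
    · exact Or.inr (Or.inl ⟨h3, hb⟩)
    · exact Or.inl ⟨by linarith, hb⟩
    · exact Or.inr (Or.inr (Or.inr (Or.inr (Or.inl ⟨h3, hb⟩))))
    · exact Or.inr (Or.inr (Or.inr (Or.inl ⟨by linarith, hb⟩)))
  rcases le_total (b * c) 0 with h2 | h2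
  · obtain ⟨k1, k2⟩ := key b (-c) a ha2 (by linarith) (by linarith)
    refine ⟨by linarith, fun h' => ?_⟩
    obtain ⟨h4, h3⟩ := k2 (by linarith)
    rcases hsq a h4 with ha | ha <;> rcases h3 with h3 | h3
    · exact Or.inr (Or.inr (Or.inr (Or.inr (Or.inr ⟨ha, h3⟩))))
    · exact Or.inl ⟨ha, by linarith⟩
    · exact Or.inr (Or.inr (Or.inl ⟨ha, h3⟩))
    · exact Or.inr (Or.inr (Or.inr (Or.inl ⟨ha, by linarith⟩)))
  · have h5 : 0 ≤ b * -a := by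
      have : a * b * c ^ 2 ≤ 0 := by nlinarith
      have hc3 : 0 < c ^ 2 := by positivity
      by_contra hneg
      nlinarith
    obtain ⟨k1, k2⟩ := key b (-a) c hc2 (by linarith) h5
    refine ⟨by linarith, fun h' => ?_⟩
    obtain ⟨h4, h3⟩ := k2 (by linarith)
    rcases hsq c h4 with hc | hc <;> rcases h3 with h3 | h3
    · exact Or.inr (Or.inr (Or.inl ⟨by linarith, h3⟩))
    · exact Or.inr (Or.inl ⟨by linarith, by linarith⟩)
    · exact Or.inr (Or.inr (Or.inr (Or.inr (Or.inr ⟨by linarith, h3⟩))))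
    · exact Or.inr (Or.inr (Or.inr (Or.inr (Or.inl ⟨by linarith, by linarith⟩))))

lemma norm_sq_le_of_mem_hexagon {z : ℂ} (h : z ∈ hexagon) : ‖z‖ ^ 2 ≤ 1 / 3 := by
  obtain ⟨h0, h1, h2⟩ := hexagon_abs h
  have := (three_sq_le h0 h1 h2 (by ring)).1
  rw [norm_sq_eq]; linarith

lemma eq_add_mul_ω (z : ℂ) : z = ((2 / 3 * (2 * z.re - (z.re / 2 + z.im * ω.im)) : ℝ) : ℂ) +
    ((2 / 3 * (2 * (z.re / 2 + z.im * ω.im) - z.re) : ℝ) : ℂ) * ω := by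
  apply Complex.ext
  · simp only [Complex.add_re, Complex.mul_re, Complex.ofReal_re, Complex.ofReal_im, ω_re]; ring
  · simp only [Complex.add_im, Complex.mul_im, Complex.ofReal_re, Complex.ofReal_im]
    linear_combination (-(4 / 3) * z.im) * ω_im_mul_self

/-- The points of the hexagon farthest from the centre are its vertices. -/
lemma exists_eq_vertex {z : ℂ} (h : z ∈ hexagon) (hz : ‖z‖ ^ 2 = 1 / 3) :
    ∃ k : ℕ, z = ω ^ k * ((1 + ω) / 3) := by
  obtain ⟨h0, h1, h2⟩ := hexagon_abs h
  rw [norm_sq_eq] at hz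
  have e4 : ω ^ 4 = -ω := by linear_combination ω * ω_pow_three
  have e5 : ω ^ 5 = 1 - ω := by linear_combination ω ^ 2 * ω_pow_three - ω_sq
  have key := eq_add_mul_ω z
  rcases (three_sq_le h0 h1 h2 (by ring)).2 (by linarith) with
    ⟨ha, hb⟩ | ⟨ha, hb⟩ | ⟨ha, hb⟩ | ⟨ha, hb⟩ | ⟨ha, hb⟩ | ⟨ha, hb⟩ <;> rw [hb, ha] at key <;>
    rw [key] <;> push_cast
  · exact ⟨0, by ring⟩
  · exact ⟨1, by linear_combination (-1 / 3 : ℂ) * ω_sq⟩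
  · exact ⟨2, by linear_combination (-1 / 3 : ℂ) * ω_pow_three - (1 / 3 : ℂ) * ω_sq⟩
  · exact ⟨3, by linear_combination (-(1 + ω) / 3 : ℂ) * ω_pow_three⟩
  · exact ⟨4, by linear_combination (-(1 + ω) / 3 : ℂ) * e4 + (1 / 3 : ℂ) * ω_sq⟩
  · exact ⟨5, by linear_combination (-(1 + ω) / 3 : ℂ) * e5 + (1 / 3 : ℂ) * ω_sq⟩

lemma mem_hexagon_of_norm_le {z : ℂ} (h : ‖z‖ ≤ 1 / 2) : z ∈ hexagon := by
  rw [mem_hexagon_iff_nat]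
  intro k
  refine (Complex.re_le_norm _).trans ?_
  rwa [norm_mul, RCLike.norm_conj, norm_ω_pow, mul_one]

lemma isCompact_hexagon : IsCompact hexagon := by
  refine Metric.isCompact_of_isClosed_isBounded ?_ ?_
  · have : hexagon = ⋂ k : Fin 6, {z : ℂ | (z * (starRingEnd ℂ) (ω ^ (k : ℕ))).re ≤ 1 / 2} := by
      ext z; simp [hexagon]
    rw [this]
    exact isClosed_iInter fun k => isClosed_le (by fun_prop) continuous_const
  · refine (Metric.isBounded_closedBall (x := (0 : ℂ)) (r := 1)).subset fun z hz => ?_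
    rw [mem_closedBall_zero_iff]
    have := norm_sq_le_of_mem_hexagon hz
    nlinarith [norm_nonneg z]

/-! ### Inscribed and circumscribed discs of the tiles -/

namespace Tile

lemma continuous_map (f : Tile) : Continuous f.map := by
  unfold map; fun_prop

lemma isCompact_region (f : Tile) : IsCompact f.region := isCompact_hexagon.image f.continuous_map

lemma norm_map_sub (f : Tile) (w : ℂ) : ‖f.map w - f.center‖ = ‖w‖ := by
  simp [map, Circle.norm_coe]

lemma norm_sq_le {f : Tile} {z : ℂ} (h : z ∈ f.region) : ‖z - f.center‖ ^ 2 ≤ 1 / 3 := by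
  obtain ⟨w, hw, rfl⟩ := h
  rw [norm_map_sub]; exact norm_sq_le_of_mem_hexagon hw

lemma exists_map_eq (f : Tile) (z : ℂ) : ∃ w, f.map w = z :=
  ⟨(f.rot⁻¹ : Circle) * (z - f.center), by
    rw [map, ← mul_assoc, ← Circle.coe_mul, mul_inv_cancel, Circle.coe_one]; ring⟩

lemma ball_subset_region (f : Tile) : Metric.ball f.center (1 / 2) ⊆ f.region := by
  intro z hz
  obtain ⟨w, rfl⟩ := f.exists_map_eq z
  rw [mem_ball_iff_norm, norm_map_sub] at hz
  exact mem_image_of_mem _ (mem_hexagon_of_norm_le hz.le)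

lemma ball_subset_interior (f : Tile) : Metric.ball f.center (1 / 2) ⊆ interior f.region :=
  interior_maximal f.ball_subset_region Metric.isOpen_ball

end Tile

variable {T : Set Tile} {f g : Tile}

/-- Otherwise the inscribed discs overlap at the midpoint of the centres. -/
lemma IsTiling.one_le_norm (hT : IsTiling T) (hf : f ∈ T) (hg : g ∈ T) (hfg : f ≠ g) :
    1 ≤ ‖f.center - g.center‖ := by
  by_contra! hlt
  have h1 : (f.center + g.center) / 2 ∈ interior f.region := f.ball_subset_interior (by
    rw [mem_ball_iff_norm, show (f.center + g.center) / 2 - f.center =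
      -((f.center - g.center) / 2) by ring, norm_neg, norm_div]
    simp only [Complex.norm_ofNat]; linarith)
  have h2 : (f.center + g.center) / 2 ∈ interior g.region := g.ball_subset_interior (by
    rw [mem_ball_iff_norm, show (f.center + g.center) / 2 - g.center =
      (f.center - g.center) / 2 by ring, norm_div]
    simp only [Complex.norm_ofNat]; linarith)
  exact Set.disjoint_left.mp (hT.2 f hf g hg hfg) h1 h2

lemma IsTiling.eq_of_norm_lt (hT : IsTiling T) (hf : f ∈ T) (hg : g ∈ T)
    (h : ‖f.center - g.center‖ < 1) : f = g := by
  by_contra hne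
  exact absurd (hT.one_le_norm hf hg hne) (not_le.mpr h)

lemma IsTiling.exists_mem (hT : IsTiling T) (z : ℂ) : ∃ f ∈ T, z ∈ f.region := by
  have : z ∈ ⋃ f ∈ T, f.region := hT.1 ▸ mem_univ z
  simpa using this

lemma IsTiling.finite_near (hT : IsTiling T) (z : ℂ) (R : ℝ) :
    {f ∈ T | ‖f.center - z‖ ≤ R}.Finite := by
  by_contra hinf
  have hinj : InjOn Tile.center {f ∈ T | ‖f.center - z‖ ≤ R} := fun f hf g hg h =>
    hT.eq_of_norm_lt hf.1 hg.1 (by rw [h]; simp)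
  have hinf' := (Set.infinite_image_iff hinj).mpr hinf
  obtain ⟨x, -, hx⟩ := hinf'.exists_accPt_of_subset_isCompact (isCompact_closedBall z R) (by
    rintro _ ⟨f, hf, rfl⟩
    rw [mem_closedBall_iff_norm]; exact hf.2)
  rw [accPt_iff_nhds] at hx
  obtain ⟨y, ⟨hy1, f, hf, rfl⟩, hyx⟩ := hx (Metric.ball x (1 / 2)) (Metric.ball_mem_nhds x (by norm_num))
  have hd : 0 < dist f.center x := dist_pos.mpr hyx
  obtain ⟨y, ⟨hy2, g, hg, rfl⟩, hyx'⟩ := hx (Metric.ball x (min (1 / 2) (dist f.center x)))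
    (Metric.ball_mem_nhds x (by positivity))
  rw [Metric.mem_ball] at hy1 hy2
  have hfg : f = g := hT.eq_of_norm_lt hf.1 hg.1 (by
    rw [← dist_eq_norm]
    have := dist_triangle_right f.center g.center x
    have := hy2.trans_le (min_le_left _ _)
    linarith)
  have := hy2.trans_le (min_le_right _ _)
  rw [hfg] at this
  exact lt_irrefl _ this

/-! ### The neighbours of a tile -/

lemma half_add_mul_I_mem_hexagon {t : ℝ} (ht : |t| ≤ ω.im / 3) :
    (1 / 2 : ℂ) + t * Complex.I ∈ hexagon := by
  have h : |t * ω.im| ≤ 1 / 4 := by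
    rw [abs_mul, abs_of_pos ω_im_pos]
    have := mul_le_mul_of_nonneg_right ht ω_im_pos.le
    have := ω_im_mul_self
    linarith
  obtain ⟨h1, h2⟩ := abs_le.mp h
  have e4 : ω ^ 4 = -ω := by linear_combination ω * ω_pow_three
  have e5 : ω ^ 5 = 1 - ω := by linear_combination ω ^ 2 * ω_pow_three - ω_sq
  intro k
  fin_cases k <;>
  simp only [ω_pow_three, e4, e5, ω_sq, pow_zero, pow_one, map_one, map_neg, map_sub,
    Complex.mul_re, Complex.conj_re, Complex.conj_im, Complex.sub_re, Complex.sub_im,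
    Complex.neg_re, Complex.neg_im, Complex.one_re, Complex.one_im, ω_re, Complex.add_re,
    Complex.add_im, Complex.I_re, Complex.I_im, Complex.ofReal_re, Complex.ofReal_im,
    Complex.mul_im] <;> norm_num <;> linarith

lemma norm_sq_mul_add_mul_I (n : ℂ) (hn : ‖n‖ = 1) (s t : ℝ) :
    ‖n * (s + t * Complex.I)‖ ^ 2 = s ^ 2 + t ^ 2 := by
  rw [norm_mul, hn, one_mul, ← Complex.normSq_eq_norm_sq, Complex.normSq_add_mul_I]

lemma norm_sq_sub_add (a b c : ℂ) : ‖a - b‖ ^ 2 + ‖b - c‖ ^ 2 + ‖c - a‖ ^ 2 + ‖a + b + c‖ ^ 2 =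
    3 * (‖a‖ ^ 2 + ‖b‖ ^ 2 + ‖c‖ ^ 2) := by
  simp only [← Complex.normSq_eq_norm_sq, Complex.normSq_apply, Complex.sub_re, Complex.sub_im,
    Complex.add_re, Complex.add_im]
  ring

variable {h : Tile}

lemma IsTiling.one_le_norm_sq (hT : IsTiling T) (hf : f ∈ T) (hg : g ∈ T) (hfg : f ≠ g) :
    1 ≤ ‖f.center - g.center‖ ^ 2 := by
  have := hT.one_le_norm hf hg hfg
  nlinarith

/-- The centres are at mutual distances at least `1`, and `z` is within the circumradius of each; by
`norm_sq_sub_add` all these bounds are attained. -/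
lemma IsTiling.norm_sq_eq_of_mem_three (hT : IsTiling T) (hf : f ∈ T) (hg : g ∈ T) (hh : h ∈ T)
    (hfg : f ≠ g) (hgh : g ≠ h) (hhf : h ≠ f) {z : ℂ} (zf : z ∈ f.region) (zg : z ∈ g.region)
    (zh : z ∈ h.region) : ‖z - f.center‖ ^ 2 = 1 / 3 := by
  have h1 := hT.one_le_norm_sq hf hg hfg
  have h2 := hT.one_le_norm_sq hg hh hgh
  have h3 := hT.one_le_norm_sq hh hf hhf
  have key := norm_sq_sub_add (f.center - z) (g.center - z) (h.center - z)
  simp only [sub_sub_sub_cancel_right] at key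
  have a1 := Tile.norm_sq_le zf
  have a2 := Tile.norm_sq_le zg
  have a3 := Tile.norm_sq_le zh
  rw [norm_sub_rev] at a1 a2 a3 ⊢
  have := sq_nonneg ‖f.center - z + (g.center - z) + (h.center - z)‖
  linarith

/-- Every edge of a tile is an edge of another tile. -/
lemma IsTiling.exists_vertices_mem (hT : IsTiling T) (hf : f ∈ T) (k : ℕ) :
    ∃ g ∈ T, g ≠ f ∧ ∀ t : ℝ, |t| ≤ ω.im / 3 →
      f.center + f.rot * ω ^ k * ((1 / 2 : ℝ) + t * Complex.I) ∈ g.region := by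
  set n : ℂ := f.rot * ω ^ k with hn
  have hn1 : ‖n‖ = 1 := by rw [hn, norm_mul, Circle.norm_coe, norm_ω_pow, one_mul]
  set E : ℝ → ℂ := fun t => f.center + n * ((1 / 2 : ℝ) + t * Complex.I) with hE
  have hEc : Continuous E := by rw [hE]; fun_prop
  have ha : 0 < ω.im / 3 := by have := ω_im_pos; positivity
  have ha2 : (ω.im / 3) ^ 2 = 1 / 12 := by have := ω_im_mul_self; linarith
  set F : Set Tile := {g ∈ T | ‖g.center - f.center‖ ≤ 2} with hF
  have hFfin : F.Finite := hT.finite_near f.center 2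
  have hcl : ∀ S : Set Tile, IsClosed (⋃ g ∈ F \ S, g.region) := fun S =>
    (hFfin.subset sdiff_subset).isClosed_biUnion fun g _ => g.isCompact_region.isClosed
  have hEf : ∀ t : ℝ, |t| ≤ ω.im / 3 → E t ∈ f.region := fun t ht =>
    ⟨ω ^ k * ((1 / 2 : ℂ) + t * Complex.I), mul_mem_hexagon (half_add_mul_I_mem_hexagon ht) k, by
      simp only [Tile.map, hE, hn]; push_cast; ring⟩
  -- A point of the edge is a limit of points outside `f`, which lie in finitely many closed tiles.
  have hcov : ∀ t : ℝ, |t| ≤ ω.im / 3 → E t ∈ ⋃ g ∈ F \ {f}, g.region := by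
    intro t ht
    have ht2 : t ^ 2 ≤ 1 / 12 := by
      rw [← ha2, ← sq_abs t]; exact pow_le_pow_left₀ (abs_nonneg _) ht 2
    have htend : Tendsto (fun s : ℝ => f.center + n * (s + t * Complex.I)) (𝓝[>] (1 / 2 : ℝ))
        (𝓝 (E t)) := by
      have : Continuous fun s : ℝ => f.center + n * (s + t * Complex.I) := by fun_prop
      exact (this.tendsto (1 / 2 : ℝ)).mono_left nhdsWithin_le_nhds
    refine (hcl {f}).mem_of_tendsto htend ?_
    have hev : ∀ᶠ s : ℝ in 𝓝[>] (1 / 2 : ℝ), s < 3 / 4 :=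
      nhdsWithin_le_nhds (eventually_lt_nhds (by norm_num))
    filter_upwards [hev, self_mem_nhdsWithin] with s hs hs'
    rw [mem_Ioi] at hs'
    obtain ⟨g, hg, hz⟩ := hT.exists_mem (f.center + n * (s + t * Complex.I))
    have hgc := Tile.norm_sq_le hz
    have hnorm : ‖f.center + n * (s + t * Complex.I) - f.center‖ ^ 2 = s ^ 2 + t ^ 2 := by
      rw [add_sub_cancel_left, norm_sq_mul_add_mul_I n hn1]
    simp only [mem_iUnion]
    refine ⟨g, ⟨⟨hg, ?_⟩, ?_⟩, hz⟩
    · set z := f.center + n * (s + t * Complex.I)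
      have h1 : ‖z - g.center‖ ≤ 1 := by nlinarith [norm_nonneg (z - g.center)]
      have h2 : ‖z - f.center‖ ≤ 1 := by nlinarith [norm_nonneg (z - f.center)]
      have := norm_sub_le (z - f.center) (z - g.center)
      rw [sub_sub_sub_cancel_left] at this
      linarith
    · rintro rfl
      obtain ⟨w, hw, hwz⟩ := hz
      rw [mem_hexagon_iff_nat] at hw
      have hw1 : w = ω ^ k * (s + t * Complex.I) := by
        have : (g.rot : ℂ) * w = g.rot * (ω ^ k * (s + t * Complex.I)) := by
          simp only [Tile.map, hn] at hwz; linear_combination hwz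
        exact mul_left_cancel₀ (Circle.coe_ne_zero _) this
      have := hw k
      rw [hw1, mul_right_comm, ω_pow_mul_conj] at this
      simp at this
      linarith
  obtain ⟨g, ⟨hgF, hgf⟩, hg0⟩ : ∃ g ∈ F \ {f}, E 0 ∈ g.region := by
    simpa only [mem_iUnion, exists_prop] using hcov 0 (by simpa using ha.le)
  refine ⟨g, hgF.1, hgf, ?_⟩
  -- The open edge is connected, so if `g` does not contain it, some point of it lies in `f`, `g`
  -- and a third tile. Such a point has the distance of a vertex from the centre of `f`, which only
  -- the ends of the edge have.
  have hopen : ∀ t ∈ Ioo (-(ω.im / 3)) (ω.im / 3), E t ∈ g.region := by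
    intro t ht
    by_contra hnot
    have hpre : IsPreconnected (Ioo (-(ω.im / 3)) (ω.im / 3)) := isPreconnected_Ioo
    rw [isPreconnected_closed_iff] at hpre
    have split : ∀ t, |t| ≤ ω.im / 3 → t ∈ E ⁻¹' g.region ∨
        t ∈ E ⁻¹' (⋃ h ∈ F \ {f, g}, h.region) := by
      intro t ht
      have := hcov t ht
      simp only [mem_iUnion, exists_prop] at this
      obtain ⟨h, ⟨hhF, hhf⟩, hz⟩ := this
      by_cases hhg : h = g
      · left; rwa [← hhg]
      · right
        simp only [mem_preimage, mem_iUnion, exists_prop]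
        exact ⟨h, ⟨hhF, by simp only [mem_insert_iff, mem_singleton_iff, not_or]; exact ⟨hhf, hhg⟩⟩, hz⟩
    obtain ⟨s, hs, hsg, hsh⟩ := hpre (E ⁻¹' g.region) (E ⁻¹' (⋃ h ∈ F \ {f, g}, h.region))
      (g.isCompact_region.isClosed.preimage hEc) ((hcl _).preimage hEc)
      (fun t ht => split t (abs_le.mpr ⟨ht.1.le, ht.2.le⟩))
      ⟨0, ⟨by linarith, ha⟩, hg0⟩
      ⟨t, ht, (split t (abs_le.mpr ⟨ht.1.le, ht.2.le⟩)).resolve_left hnot⟩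
    simp only [mem_preimage, mem_iUnion, exists_prop] at hsh hsg
    obtain ⟨h, ⟨hhF, hh⟩, hz⟩ := hsh
    simp only [mem_insert_iff, mem_singleton_iff, not_or] at hh
    have h3 := hT.norm_sq_eq_of_mem_three hf hgF.1 hhF.1 (Ne.symm hgf) (Ne.symm hh.2) hh.1
      (hEf s (abs_le.mpr ⟨hs.1.le, hs.2.le⟩)) hsg hz
    rw [hE] at h3
    simp only [add_sub_cancel_left] at h3
    rw [norm_sq_mul_add_mul_I n hn1] at h3
    have : s ^ 2 < (ω.im / 3) ^ 2 := sq_lt_sq' hs.1 hs.2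
    linarith
  intro t ht
  have hclos : t ∈ closure (Ioo (-(ω.im / 3)) (ω.im / 3)) := by
    rw [closure_Ioo (by linarith)]
    exact abs_le.mp ht
  have := (g.isCompact_region.isClosed.preimage hEc).closure_subset_iff.mpr hopen hclos
  exact this

/-- The tile across an edge of a given tile. -/
lemma IsTiling.exists_neighbor (hT : IsTiling T) (hf : f ∈ T) (k : ℕ) :
    ∃ g ∈ T, g.center = f.center + f.rot * ω ^ k ∧ ∃ r : ℕ, (g.rot : ℂ) = f.rot * ω ^ r := by
  obtain ⟨g, hg, hgf, hmem⟩ := hT.exists_vertices_mem hf k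
  set n : ℂ := f.rot * ω ^ k with hn
  have hn1 : ‖n‖ = 1 := by rw [hn, norm_mul, Circle.norm_coe, norm_ω_pow, one_mul]
  have ha : 0 < ω.im / 3 := by have := ω_im_pos; positivity
  have ha2 : (ω.im / 3) ^ 2 = 1 / 12 := by have := ω_im_mul_self; linarith
  have hv1 := hmem (ω.im / 3) (abs_of_pos ha).le
  have hv2 := hmem (-(ω.im / 3)) (by rw [abs_neg, abs_of_pos ha])
  have hfg := hT.one_le_norm_sq hg hf hgf
  -- Both ends of the edge are within the circumradius of `g.center`, so the midpoint of the edge is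
  -- within `1 / 2` of it. As the centres are at distance at least `1`, the parallelogram law leaves
  -- only the reflection of `f.center` in that midpoint.
  have hc : g.center = f.center + n := by
    have b1 := Tile.norm_sq_le hv1
    have b2 := Tile.norm_sq_le hv2
    have h1 := parallelogram_law_with_norm ℝ (f.center + n / 2 - g.center)
      (n * ((0 : ℝ) + (ω.im / 3 : ℝ) * Complex.I))
    have h2 := parallelogram_law_with_norm ℝ (g.center - f.center - n / 2) (n / 2)
    have h3 := norm_sq_mul_add_mul_I n hn1 0 (ω.im / 3)
    rw [show f.center + n / 2 - g.center + n * ((0 : ℝ) + (ω.im / 3 : ℝ) * Complex.I) =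
        f.center + n * ((1 / 2 : ℝ) + (ω.im / 3 : ℝ) * Complex.I) - g.center by push_cast; ring,
      show f.center + n / 2 - g.center - n * ((0 : ℝ) + (ω.im / 3 : ℝ) * Complex.I) =
        f.center + n * ((1 / 2 : ℝ) + (-(ω.im / 3) : ℝ) * Complex.I) - g.center by push_cast; ring,
      h3] at h1
    rw [sub_add_cancel, norm_div, hn1, show g.center - f.center - n / 2 =
      -(f.center + n / 2 - g.center) by ring, norm_neg, Complex.norm_ofNat] at h2
    have h4 : ‖-(f.center + n / 2 - g.center) - n / 2‖ ^ 2 ≤ 0 := by linarith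
    have h5 : ‖-(f.center + n / 2 - g.center) - n / 2‖ = 0 := by
      nlinarith [norm_nonneg (-(f.center + n / 2 - g.center) - n / 2)]
    rw [norm_eq_zero] at h5
    linear_combination h5
  refine ⟨g, hg, hc, ?_⟩
  obtain ⟨w, hw, hwz⟩ := hv1
  have hw1 : (g.rot : ℂ) * w = n * ((-(1 / 2) : ℝ) + (ω.im / 3 : ℝ) * Complex.I) := by
    simp only [Tile.map, hc] at hwz
    push_cast at hwz ⊢
    linear_combination hwz
  -- The end of the edge is also a vertex of `g`, which determines the rotation of `g` up to sixth
  -- roots of unity.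
  obtain ⟨j, hj⟩ := exists_eq_vertex hw (by
    have : ‖(g.rot : ℂ) * w‖ ^ 2 = ‖w‖ ^ 2 := by rw [norm_mul, Circle.norm_coe, one_mul]
    rw [← this, hw1, norm_sq_mul_add_mul_I n hn1, ha2]; norm_num)
  have hω : ((-(1 / 2) : ℝ) : ℂ) + (ω.im / 3 : ℝ) * Complex.I = ω ^ 2 * ((1 + ω) / 3) := by
    have h1 : ω ^ 2 * ((1 + ω) / 3) = (ω - 2) / 3 := by
      linear_combination (1 / 3 : ℂ) * ω_sq + (1 / 3 : ℂ) * ω_pow_three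
    rw [h1]
    apply Complex.ext
    · simp [ω_re]; norm_num
    · simp
  have hne : (1 + ω) / 3 ≠ 0 := by
    intro h0
    have := congrArg Complex.re h0
    simp [ω_re] at this
    norm_num at this
  refine ⟨k + 2 + 5 * j, ?_⟩
  rw [hω, hj, ← mul_assoc, ← mul_assoc] at hw1
  have h2 := mul_right_cancel₀ hne hw1
  have h6 : ω ^ (5 * j) * ω ^ j = 1 := by
    rw [← pow_add, show 5 * j + j = 6 * j by ring, pow_mul, ω_pow_six, one_pow]
  rw [hn] at h2
  calc (g.rot : ℂ) = g.rot * ω ^ j * ω ^ (5 * j) := by linear_combination (-(g.rot : ℂ)) * h6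
    _ = _ := by rw [h2]; ring

/-! ### The lattice of the centres -/

/-- The point of the triangular lattice with given coordinates. -/
noncomputable def pos (x : Site) : ℂ := x.1 + x.2 * ω

lemma pos_add (x y : Site) : pos (x + y) = pos x + pos y := by
  simp only [pos, Prod.fst_add, Prod.snd_add]; push_cast; ring

lemma pos_zsmul (n : ℤ) (x : Site) : pos (n • x) = n * pos x := by
  simp only [pos, Prod.smul_fst, Prod.smul_snd, smul_eq_mul]; push_cast; ring

lemma pos_zero : pos 0 = 0 := by simp [pos]

lemma pos_neg (x : Site) : pos (-x) = -pos x := by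
  simp only [pos, Prod.fst_neg, Prod.snd_neg]; push_cast; ring

lemma pos_sub (x y : Site) : pos (x - y) = pos x - pos y := by
  rw [sub_eq_add_neg, pos_add, pos_neg, sub_eq_add_neg]

lemma norm_sq_add_mul_ω (s t : ℝ) : ‖(s : ℂ) + t * ω‖ ^ 2 = s ^ 2 + s * t + t ^ 2 := by
  rw [← Complex.normSq_eq_norm_sq, Complex.normSq_apply]
  simp only [Complex.add_re, Complex.add_im, Complex.mul_re, Complex.mul_im, Complex.ofReal_re,
    Complex.ofReal_im, ω_re]
  linear_combination t ^ 2 * ω_im_mul_self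

lemma norm_sq_pos (x : Site) : ‖pos x‖ ^ 2 = ((x.1 ^ 2 + x.1 * x.2 + x.2 ^ 2 : ℤ) : ℝ) := by
  have := norm_sq_add_mul_ω x.1 x.2
  push_cast at this ⊢
  exact this

lemma eq_zero_of_pos_eq_zero {x : Site} (h : pos x = 0) : x = 0 := by
  have h1 := norm_sq_pos x
  rw [h, norm_zero, zero_pow two_ne_zero, ← Int.cast_zero, Int.cast_inj] at h1
  have h2 : x.2 = 0 := by
    have : 3 * x.2 ^ 2 ≤ 0 := by nlinarith [sq_nonneg (2 * x.1 + x.2)]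
    exact pow_eq_zero_iff two_ne_zero |>.mp (le_antisymm (by linarith) (sq_nonneg _))
  rw [h2] at h1
  have h3 : x.1 = 0 := pow_eq_zero_iff two_ne_zero |>.mp (by linarith)
  exact Prod.ext h3 h2

lemma exists_norm_sub_pos_lt (z : ℂ) : ∃ x : Site, ‖z - pos x‖ < 1 := by
  obtain ⟨u, v, rfl⟩ : ∃ u v : ℝ, z = u + v * ω := ⟨_, _, eq_add_mul_ω z⟩
  refine ⟨(round u, round v), ?_⟩
  have hu := abs_le.mp (abs_sub_round u)
  have hv := abs_le.mp (abs_sub_round v)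
  have h := norm_sq_add_mul_ω (u - round u) (v - round v)
  rw [show ((u - round u : ℝ) : ℂ) + (v - round v : ℝ) * ω = u + v * ω -
    pos (round u, round v) by simp only [pos]; push_cast; ring] at h
  nlinarith [norm_nonneg (u + v * ω - pos (round u, round v))]

/-- The lattice vector that corresponds to `ω ^ j`. -/
def dir (j : ℕ) : Site := ((-1) ^ j : ℤ) • e (j : ZMod 3)

lemma pos_e_add_one (k : ZMod 3) : pos (e (k + 1)) = -ω * pos (e k) := by
  revert k
  have h0 : pos (e 0) = 1 := by simp [pos, e]
  have h1 : pos (e 1) = -ω := by simp [pos, e]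
  have h2 : pos (e 2) = ω - 1 := by
    rw [show e 2 = (-1, 1) from rfl]
    simp [pos]; ring
  intro k
  fin_cases k
  · change pos (e 1) = -ω * pos (e 0); rw [h0, h1]; ring
  · change pos (e 2) = -ω * pos (e 1); rw [h1, h2]; linear_combination -ω_sq
  · change pos (e 0) = -ω * pos (e 2); rw [h0, h2]; linear_combination ω_sq

lemma pos_dir (j : ℕ) : pos (dir j) = ω ^ j := by
  induction j with
  | zero => simp [dir, pos, e]
  | succ j ih =>
    rw [dir, pos_zsmul] at ih ⊢
    push_cast at ih ⊢
    rw [pos_e_add_one, pow_succ ω, ← ih]; ring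

lemma add_dir (x : Site) (j : ℕ) : x + dir j = ray x (j : ZMod 3) ((-1) ^ j) 1 := by
  simp [ray, dir]

lemma exists_dir (k : ZMod 3) (ε : ℤˣ) : ∃ j : ℕ, (j : ZMod 3) = k ∧ ((-1) ^ j : ℤˣ) = ε := by
  rcases Int.units_eq_one_or ε with rfl | rfl <;> fin_cases k
  · exact ⟨0, rfl, rfl⟩
  · exact ⟨4, rfl, rfl⟩
  · exact ⟨2, rfl, rfl⟩
  · exact ⟨3, rfl, rfl⟩
  · exact ⟨1, rfl, rfl⟩
  · exact ⟨5, rfl, rfl⟩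

lemma exists_eq_dir {x : Site} (hx : x ≠ 0) (h : ‖pos x‖ ≤ 1) : ∃ j, x = dir j := by
  obtain ⟨a, b⟩ := x
  have h1 := norm_sq_pos (a, b)
  have h2 : ‖pos (a, b)‖ ^ 2 ≤ 1 := by nlinarith [norm_nonneg (pos (a, b))]
  rw [h1] at h2
  have h3 : a ^ 2 + a * b + b ^ 2 ≤ 1 := by exact_mod_cast h2
  have hb : b ^ 2 ≤ 1 := by nlinarith [sq_nonneg (2 * a + b)]
  have ha : a ^ 2 ≤ 1 := by nlinarith [sq_nonneg (2 * b + a)]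
  have hb1 : -1 ≤ b ∧ b ≤ 1 := by constructor <;> nlinarith
  have ha1 : -1 ≤ a ∧ a ≤ 1 := by constructor <;> nlinarith
  obtain ⟨ha1, ha2⟩ := ha1
  obtain ⟨hb1, hb2⟩ := hb1
  interval_cases a <;> interval_cases b <;> first
    | exact absurd rfl hx
    | exact ⟨0, rfl⟩
    | exact ⟨1, rfl⟩
    | exact ⟨2, rfl⟩
    | exact ⟨3, rfl⟩
    | exact ⟨4, rfl⟩
    | exact ⟨5, rfl⟩
    | norm_num at h3

lemma site_induction {S : Set Site} (h0 : (0 : Site) ∈ S) (h : ∀ x ∈ S, ∀ j, x + dir j ∈ S)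
    (x : Site) : x ∈ S := by
  have hd : dir 0 = (1, 0) ∧ dir 1 = (0, 1) ∧ dir 3 = (-1, 0) ∧ dir 4 = (0, -1) :=
    ⟨rfl, rfl, rfl, rfl⟩
  obtain ⟨d0, d1, d3, d4⟩ := hd
  have hrow : ∀ a : ℤ, ((a, 0) : Site) ∈ S := by
    intro a
    induction a using Int.induction_on with
    | zero => exact h0
    | succ a ih => simpa [d0] using h _ ih 0
    | pred a ih => simpa [d3, sub_eq_add_neg] using h _ ih 3
  obtain ⟨a, b⟩ := x
  induction b using Int.induction_on with
  | zero => exact hrow a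
  | succ b ih => simpa [d1] using h _ ih 1
  | pred b ih => simpa [d4, sub_eq_add_neg] using h _ ih 4

/-! ### Tilings as configurations -/

/-- `ω` as an element of the unit circle. -/
noncomputable def ωc : Circle := Circle.exp (Real.pi / 3)

lemma coe_ωc : (ωc : ℂ) = ω := by rw [ωc, Circle.coe_exp, ω]

/-- The tile at a lattice site, with respect to a frame, turned by `r x` sixths of a full turn. -/
noncomputable def tileAt (ρ : Circle) (c : ℂ) (r : Site → ℕ) (x : Site) : Tile :=
  ⟨ρ * ωc ^ r x, c + ρ * pos x⟩

variable {ρ : Circle} {c : ℂ} {r : Site → ℕ} {x y : Site}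

lemma tileAt_center : (tileAt ρ c r x).center = c + ρ * pos x := rfl

lemma tileAt_rot : ((tileAt ρ c r x).rot : ℂ) = ρ * ω ^ r x := by
  rw [tileAt, Circle.coe_mul, Circle.coe_pow, coe_ωc]

lemma tileAt_map (z : ℂ) : (tileAt ρ c r x).map z = c + ρ * (pos x + ω ^ r x * z) := by
  rw [Tile.map, tileAt_rot, tileAt_center]; ring

lemma norm_sub_tileAt_center : ‖(tileAt ρ c r x).center - (tileAt ρ c r y).center‖ =
    ‖pos (x - y)‖ := by
  rw [tileAt_center, tileAt_center, add_sub_add_left_eq_sub, ← mul_sub, norm_mul, Circle.norm_coe,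
    one_mul, pos_sub]

lemma tileAt_injective : Function.Injective (tileAt ρ c r) := by
  intro x y h
  have h1 := norm_sub_tileAt_center (ρ := ρ) (c := c) (r := r) (x := x) (y := y)
  rw [h, sub_self, norm_zero] at h1
  exact sub_eq_zero.mp (eq_zero_of_pos_eq_zero (norm_eq_zero.mp h1.symm))

/-- Passing from tile to neighbour reaches every lattice site. Any further tile would have its
centre at distance less than `1` from a site. -/
theorem IsTiling.exists_eq_range (hT : IsTiling T) (hf : f ∈ T) :
    ∃ r : Site → ℕ, T = range (tileAt f.rot f.center r) := by
  have key : ∀ x : Site, ∃ r : ℕ, (⟨f.rot * ωc ^ r, f.center + f.rot * pos x⟩ : Tile) ∈ T := by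
    refine site_induction (S := {x | ∃ r : ℕ, _}) ⟨0, by simpa [pos_zero] using hf⟩ ?_
    rintro x ⟨r, hr⟩ j
    -- Modulo 6, `5 * r` is `-r`: the direction `j` of the frame is edge `j - r` of a tile turned by
    -- `r`.
    obtain ⟨g, hg, hgc, s, hgs⟩ := hT.exists_neighbor hr (j + 5 * r)
    refine ⟨r + s, ?_⟩
    convert hg using 1
    ext1
    · apply Circle.ext
      rw [hgs]
      simp only [Circle.coe_mul, Circle.coe_pow, coe_ωc]
      ring
    · rw [hgc]
      simp only [Circle.coe_mul, Circle.coe_pow, coe_ωc]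
      have h6 : ω ^ r * ω ^ (5 * r) = 1 := by
        rw [← pow_add, show r + 5 * r = 6 * r by ring, pow_mul, ω_pow_six, one_pow]
      rw [pos_add, pos_dir, pow_add]
      linear_combination (-(f.rot : ℂ) * ω ^ j) * h6
  choose r hr using key
  refine ⟨r, Subset.antisymm (fun g hg => ?_) (range_subset_iff.mpr hr)⟩
  obtain ⟨x, hx⟩ := exists_norm_sub_pos_lt ((f.rot⁻¹ : Circle) * (g.center - f.center))
  refine ⟨x, hT.eq_of_norm_lt (hr x) hg ?_⟩
  have : g.center - (f.center + f.rot * pos x) =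
      f.rot * ((f.rot⁻¹ : Circle) * (g.center - f.center) - pos x) := by
    rw [mul_sub, ← mul_assoc, ← Circle.coe_mul, mul_inv_cancel, Circle.coe_one]; ring
  change ‖f.center + f.rot * pos x - g.center‖ < 1
  rwa [norm_sub_rev, this, norm_mul, Circle.norm_coe, one_mul]

/-- The direction of the long R1-curve of the tiles of a configuration. -/
def lineDir (r : Site → ℕ) (x : Site) : ZMod 3 := (r x : ZMod 3) + 1

/-! ### Rule R1 -/

lemma mark_eq (k : ℕ) (s : ℝ) : mark k s = ω ^ k * ((1 / 2 : ℂ) + (s / 8 : ℝ) * Complex.I) := by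
  rw [mark, midpt]; push_cast; ring

lemma conj_ω_pow (i : ℕ) : (starRingEnd ℂ) (ω ^ i) = ω ^ (5 * i) := by
  have h1 := ω_pow_mul_conj i
  have h2 : ω ^ i * ω ^ (5 * i) = 1 := by
    rw [← pow_add, show i + 5 * i = 6 * i by ring, pow_mul, ω_pow_six, one_pow]
  linear_combination (-(starRingEnd ℂ) (ω ^ i)) * h2 + ω ^ (5 * i) * h1

lemma re_mark_mul_conj_self (i : ℕ) (s : ℝ) : (mark i s * (starRingEnd ℂ) (ω ^ i)).re = 1 / 2 := by
  rw [mark_eq, mul_right_comm, ω_pow_mul_conj]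
  simp

lemma re_mark_mul_conj_lt {i k : ℕ} {s : ℝ} (hs : |s| ≤ 1) (hik : i % 6 ≠ k % 6) :
    (mark k s * (starRingEnd ℂ) (ω ^ i)).re < 1 / 2 := by
  obtain ⟨hs1, hs2⟩ := abs_le.mp hs
  have e4 : ω ^ 4 = -ω := by linear_combination ω * ω_pow_three
  have e5 : ω ^ 5 = 1 - ω := by linear_combination ω ^ 2 * ω_pow_three - ω_sq
  have hω : |s * ω.im| ≤ 1 := by
    have : ω.im ≤ 1 := by nlinarith [ω_im_mul_self, ω_im_pos]
    rw [abs_mul, abs_of_pos ω_im_pos]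
    exact mul_le_one₀ hs ω_im_pos.le this
  obtain ⟨h1, h2⟩ := abs_le.mp hω
  rw [mark_eq, conj_ω_pow, mul_right_comm, ← pow_add, ← ω_pow_mod]
  have hm : (k + 5 * i) % 6 ≠ 0 := by omega
  have hm6 : (k + 5 * i) % 6 < 6 := Nat.mod_lt _ (by norm_num)
  generalize (k + 5 * i) % 6 = m at hm hm6
  interval_cases m
  · exact absurd rfl hm
  all_goals
    simp only [ω_pow_three, e4, e5, ω_sq, pow_one, Complex.mul_re, Complex.sub_re, Complex.sub_im,
      Complex.neg_re, Complex.neg_im, Complex.one_re, Complex.one_im, ω_re, Complex.add_re,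
      Complex.add_im, Complex.I_re, Complex.I_im, Complex.ofReal_re, Complex.ofReal_im,
      Complex.mul_im]
    norm_num <;> linarith

lemma mark_right_injective {i : ℕ} {s t : ℝ} (h : mark i s = mark i t) : s = t := by
  rw [mark_eq, mark_eq] at h
  have h1 := mul_left_cancel₀ (norm_ne_zero_iff.mp (by rw [norm_ω_pow]; norm_num)) h
  have h2 := congrArg Complex.im h1
  simp at h2
  linarith

lemma mark_mod (i : ℕ) (s : ℝ) : mark (i % 6) s = mark i s := by
  rw [mark_eq, mark_eq, ω_pow_mod]

/-- The linear form `re (z * conj (ω ^ i))` equals `1 / 2` at marks of edge `i` and is smaller at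
marks of other edges, so the segment meets edge `i` only in an endpoint. -/
lemma mark_mem_segment {i k l : ℕ} {s t u : ℝ} (hs : |s| ≤ 1) (hu : |u| ≤ 1) (hkl : k % 6 ≠ l % 6)
    (h : mark i t ∈ segment ℝ (mark k s) (mark l u)) :
    (i % 6 = k % 6 ∧ t = s) ∨ (i % 6 = l % 6 ∧ t = u) := by
  obtain ⟨a, b, ha, hb, hab, h⟩ := h
  have hre : a * (mark k s * (starRingEnd ℂ) (ω ^ i)).re +
      b * (mark l u * (starRingEnd ℂ) (ω ^ i)).re = 1 / 2 := by
    rw [← re_mark_mul_conj_self i t, ← h]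
    simp only [Complex.real_smul, add_mul, mul_assoc, Complex.add_re, Complex.re_ofReal_mul]
  by_cases hik : i % 6 = k % 6
  · have hil : i % 6 ≠ l % 6 := by omega
    have h1 := re_mark_mul_conj_lt hu hil
    rw [← mark_mod k, ← hik, mark_mod, re_mark_mul_conj_self] at hre
    have hb0 : b = 0 := by
      by_contra hne
      have := lt_of_le_of_ne hb (Ne.symm hne)
      nlinarith
    rw [hb0, add_zero] at hab
    rw [hb0, hab, one_smul, zero_smul, add_zero, ← mark_mod k, ← hik, mark_mod] at h
    exact Or.inl ⟨hik, (mark_right_injective h).symm⟩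
  · have h1 := re_mark_mul_conj_lt hs hik
    by_cases hil : i % 6 = l % 6
    · rw [← mark_mod l, ← hil, mark_mod, re_mark_mul_conj_self] at hre
      have ha0 : a = 0 := by
        by_contra hne
        have := lt_of_le_of_ne ha (Ne.symm hne)
        nlinarith
      rw [ha0, zero_add] at hab
      rw [ha0, hab, one_smul, zero_smul, zero_add, ← mark_mod l, ← hil, mark_mod] at h
      exact Or.inr ⟨hil, (mark_right_injective h).symm⟩
    · have h2 := re_mark_mul_conj_lt hu hil
      exfalso
      rcases ha.eq_or_lt with h0 | h0
      · rw [← h0, zero_add] at hab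
        rw [← h0, hab] at hre
        linarith
      · nlinarith

/-- The edges of the prototile on which the R1-curve ends counterclockwise of the midpoint. -/
def Positive (i : ℕ) : Prop := i % 6 = 2 ∨ i % 6 = 4 ∨ i % 6 = 5

lemma mark_mem_protoR1 {i : ℕ} {t : ℝ} (ht : t = 1 ∨ t = -1) :
    mark i t ∈ protoR1 ↔ (t = 1 ↔ Positive i) := by
  have hneg : ¬ (-1 : ℝ) = 1 := by norm_num
  constructor
  · rintro ((h | h) | h)
    all_goals
      rcases mark_mem_segment (by norm_num) (by norm_num) (by norm_num) h with ⟨h, rfl⟩ | ⟨h, rfl⟩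
      all_goals
        simp only [Positive, hneg, true_iff, false_iff]
        omega
  · intro h
    have hi : i % 6 < 6 := Nat.mod_lt _ (by norm_num)
    rw [← mark_mod]
    unfold Positive at h
    generalize i % 6 = j at h hi
    rcases ht with rfl | rfl
    · simp only [true_iff] at h
      rcases h with rfl | rfl | rfl
      · exact Or.inl (Or.inr (left_mem_segment ℝ _ _))
      · exact Or.inl (Or.inl (right_mem_segment ℝ _ _))
      · exact Or.inr (left_mem_segment ℝ _ _)
    · simp only [hneg, false_iff] at h
      have : j = 0 ∨ j = 1 ∨ j = 3 := by omega
      rcases this with rfl | rfl | rfl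
      · exact Or.inr (right_mem_segment ℝ _ _)
      · exact Or.inl (Or.inl (left_mem_segment ℝ _ _))
      · exact Or.inl (Or.inr (right_mem_segment ℝ _ _))

/-- A point of an edge, seen from the tile. -/
lemma tileAt_map_mark (j : ℕ) (s : ℝ) : (tileAt ρ c r x).map (mark (j + 5 * r x) s) =
    c + ρ * (pos x + mark j s) := by
  have h6 : ω ^ r x * ω ^ (5 * r x) = 1 := by
    rw [← pow_add, show r x + 5 * r x = 6 * r x by ring, pow_mul, ω_pow_six, one_pow]
  rw [tileAt_map, mark_eq, mark_eq, pow_add]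
  linear_combination (ρ * ω ^ j * (1 / 2 + (s / 8 : ℝ) * Complex.I)) * h6

lemma pos_add_mark (x : Site) (j : ℕ) (s : ℝ) :
    pos x + mark j s = pos (x + dir j) + mark (j + 3) (-s) := by
  rw [pos_add, pos_dir, mark_eq, mark_eq, pow_add, ω_pow_three]
  push_cast; ring

lemma mark_mem_hexagon (j : ℕ) {s : ℝ} (hs : |s| ≤ 1) : mark j s ∈ hexagon := by
  rw [mark_eq]
  refine mul_mem_hexagon (half_add_mul_I_mem_hexagon ?_) j
  have : 1 / 2 ≤ ω.im := by nlinarith [ω_im_mul_self, ω_im_pos]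
  rw [abs_div, abs_of_pos (by norm_num : (0 : ℝ) < 8)]
  linarith

lemma Tile.map_injective (f : Tile) : Function.Injective f.map := fun _ _ h =>
  mul_left_cancel₀ (Circle.coe_ne_zero f.rot) (add_right_cancel h)

/-- The curve that ends on the common edge must continue at the same point, and seen from the other
tile the orientation of the edge is reversed. -/
lemma SatisfiesR1.positive_iff (h : SatisfiesR1 (range (tileAt ρ c r))) (x : Site) (j : ℕ) :
    Positive (j + 5 * r x) ↔ ¬ Positive (j + 3 + 5 * r (x + dir j)) := by
  have hne : tileAt ρ c r x ≠ tileAt ρ c r (x + dir j) := by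
    intro h
    have h1 := tileAt_injective h
    have h2 := pos_dir j
    rw [show dir j = 0 by simpa using h1, pos_zero] at h2
    have := norm_ω_pow j
    rw [← h2, norm_zero] at this
    norm_num at this
  have key := h _ (mem_range_self x) _ (mem_range_self (x + dir j)) hne
  have key2 : ∀ s : ℝ, (s = 1 ∨ s = -1) → (s = 1 ↔ Positive (j + 5 * r x)) →
      (-s = 1 ↔ Positive (j + 3 + 5 * r (x + dir j))) := by
    intro s hs hsx
    have h1 : c + ρ * (pos x + mark j s) ∈ (tileAt ρ c r x).r1 :=
      ⟨_, (mark_mem_protoR1 hs).mpr hsx, tileAt_map_mark j s⟩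
    have h2 : (tileAt ρ c r (x + dir j)).map (mark (j + 3 + 5 * r (x + dir j)) (-s)) =
        c + ρ * (pos x + mark j s) := by rw [tileAt_map_mark, pos_add_mark x]
    have h3 : c + ρ * (pos x + mark j s) ∈ (tileAt ρ c r (x + dir j)).region := by
      refine ⟨_, mark_mem_hexagon _ ?_, h2⟩
      rcases hs with rfl | rfl <;> norm_num
    obtain ⟨w, hw, hw2⟩ := key ⟨h1, h3⟩
    rw [← h2] at hw2
    rw [(tileAt ρ c r (x + dir j)).map_injective hw2] at hw
    refine (mark_mem_protoR1 ?_).mp hw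
    rcases hs with rfl | rfl <;> norm_num
  by_cases hp : Positive (j + 5 * r x)
  · have := key2 1 (Or.inl rfl) (by simp [hp])
    simp only [hp, true_iff]
    intro h; have := this.mpr h; norm_num at this
  · have := key2 (-1) (Or.inr rfl) (by simp only [hp, iff_false]; norm_num)
    simp only [hp, false_iff, not_not]
    exact this.mp (by norm_num)

/-- The opposite edges 1 and 4 of the prototile have different signs, edges 0 and 3 are both
negative, and edges 2 and 5 both positive. As the sign flips at each crossing of an edge, tiles
whose long curve follows the line transmit the sign at which it is left; the next tile of another
value is entered with the opposite sign and so has the other type. -/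
theorem SatisfiesR1.alternating (h : SatisfiesR1 (range (tileAt ρ c r))) :
    Alternating (lineDir r) := by
  intro p k ε L hL hpk hrun hend
  obtain ⟨j, rfl, rfl⟩ := exists_dir k ε
  have hstep : ∀ i : ℕ, ray p (j : ZMod 3) ((-1) ^ j) ((i + 1 : ℕ) : ℤ) =
      ray p (j : ZMod 3) ((-1) ^ j) i + dir j := by
    intro i
    rw [add_dir]
    simp only [ray]; push_cast; module
  have hiff : ∀ (n : ℕ) (m : ℕ), ((n : ZMod 3) + 1 = (m : ZMod 3)) ↔ (n + 1) % 3 = m % 3 := by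
    intro n m
    rw [← ZMod.natCast_eq_natCast_iff' (n + 1) m 3]; push_cast; rfl
  simp only [lineDir] at hpk hend
  have hb : ∀ i : ℕ, i < L → (Positive (j + 5 * r (ray p (j : ZMod 3) ((-1) ^ j) i)) ↔
      Positive (j + 5 * r p)) := by
    intro i
    induction i with
    | zero => intro _; simp [ray]
    | succ i ih =>
      intro hi
      rw [← ih (by omega), h.positive_iff (ray p (j : ZMod 3) ((-1) ^ j) i) j, ← hstep]
      have h1 := hrun (i + 1) (by omega) hi
      simp only [lineDir] at h1
      rw [hiff] at h1
      unfold Positive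
      omega
  obtain ⟨M, rfl⟩ : ∃ M, L = M + 1 := ⟨L - 1, by omega⟩
  have h2 := hb M (by omega)
  rw [h.positive_iff (ray p (j : ZMod 3) ((-1) ^ j) M) j, ← hstep] at h2
  rw [Ne, hiff] at hpk
  have h3 : (r (ray p (j : ZMod 3) ((-1) ^ j) ((M + 1 : ℕ) : ℤ)) + 1) % 3 = (r p + 1) % 3 := by
    rw [← hiff]; push_cast at hend ⊢; exact hend
  generalize r (ray p (j : ZMod 3) ((-1) ^ j) ((M + 1 : ℕ) : ℤ)) = R at h2 h3
  unfold Positive at h2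
  omega

/-! ### Rule R2 -/

lemma mem_protoTree_iff {z : ℂ} :
    z ∈ protoTree ↔ ∃ i : ℕ, i % 3 ≠ 2 ∧ ∃ t ∈ Icc (0 : ℝ) 1, z = t * (ω ^ i / 2) := by
  have hseg : ∀ i, z ∈ segment ℝ 0 (midpt i) ↔ ∃ t ∈ Icc (0 : ℝ) 1, z = t * (ω ^ i / 2) := by
    intro i
    rw [segment_eq_image]
    simp only [mem_image, smul_zero, zero_add, midpt, Complex.real_smul, eq_comm]
  simp only [protoTree, mem_union, hseg]
  constructor
  · rintro (((h | h) | h) | h)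
    · exact ⟨0, by norm_num, h⟩
    · exact ⟨1, by norm_num, h⟩
    · exact ⟨3, by norm_num, h⟩
    · exact ⟨4, by norm_num, h⟩
  · rintro ⟨i, hi, h⟩
    rw [← ω_pow_mod] at h
    have : i % 6 = 0 ∨ i % 6 = 1 ∨ i % 6 = 3 ∨ i % 6 = 4 := by omega
    rcases this with h' | h' | h' | h' <;> rw [h'] at h
    · exact Or.inl (Or.inl (Or.inl h))
    · exact Or.inl (Or.inl (Or.inr h))
    · exact Or.inl (Or.inr h)
    · exact Or.inr h

lemma starConvex_protoTree : StarConvex ℝ 0 protoTree := by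
  have h : ∀ i, StarConvex ℝ 0 (segment ℝ 0 (midpt i)) := fun i =>
    (convex_segment _ _).starConvex (left_mem_segment ℝ _ _)
  exact (((h 0).union (h 1)).union (h 3)).union (h 4)

lemma isCompact_protoTree : IsCompact protoTree := by
  have h : ∀ i, IsCompact (segment ℝ 0 (midpt i)) := fun i => by
    rw [segment_eq_image]
    exact isCompact_Icc.image (by fun_prop)
  exact (((h 0).union (h 1)).union (h 3)).union (h 4)

lemma zero_mem_protoTree : (0 : ℂ) ∈ protoTree :=
  mem_protoTree_iff.mpr ⟨0, by norm_num, 0, by simp, by simp⟩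

lemma Tile.center_mem_tree (f : Tile) : f.center ∈ f.tree :=
  ⟨0, zero_mem_protoTree, by simp [Tile.map]⟩

lemma Tile.isPreconnected_tree (f : Tile) : IsPreconnected f.tree :=
  (starConvex_protoTree.isPathConnected zero_mem_protoTree).isConnected.isPreconnected.image _
    f.continuous_map.continuousOn

lemma Tile.isClosed_tree (f : Tile) : IsClosed f.tree :=
  (isCompact_protoTree.image f.continuous_map).isClosed

lemma Tile.norm_sub_le_of_mem_tree {f : Tile} {z : ℂ} (h : z ∈ f.tree) :
    ‖z - f.center‖ ≤ 1 / 2 := by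
  obtain ⟨w, hw, rfl⟩ := h
  obtain ⟨i, -, t, ht, rfl⟩ := mem_protoTree_iff.mp hw
  rw [Tile.norm_map_sub, norm_mul, norm_div, norm_ω_pow, Complex.norm_real, Real.norm_eq_abs,
    abs_of_nonneg ht.1, Complex.norm_ofNat]
  linarith [ht.2]

lemma lineDir_add_one_ne_iff (j : ℕ) :
    lineDir r x + 1 ≠ (j : ZMod 3) ↔ (j + 5 * r x) % 3 ≠ 2 := by
  have h : lineDir r x + 1 = (j : ZMod 3) ↔ (r x + 1 + 1) % 3 = j % 3 := by
    rw [lineDir, ← ZMod.natCast_eq_natCast_iff' (r x + 1 + 1) j 3]; push_cast; rfl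
  rw [Ne, h]
  omega

lemma mem_tree_tileAt {z : ℂ} : z ∈ (tileAt ρ c r x).tree ↔
    ∃ j : ℕ, lineDir r x + 1 ≠ (j : ZMod 3) ∧ ∃ t ∈ Icc (0 : ℝ) 1,
      z = c + ρ * (pos x + t * (ω ^ j / 2)) := by
  simp only [lineDir_add_one_ne_iff]
  constructor
  · rintro ⟨w, hw, rfl⟩
    obtain ⟨i, hi, t, ht, rfl⟩ := mem_protoTree_iff.mp hw
    refine ⟨i + r x, by omega, t, ht, ?_⟩
    rw [tileAt_map, pow_add]; ring
  · rintro ⟨j, hj, t, ht, rfl⟩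
    refine ⟨t * (ω ^ (j + 5 * r x) / 2), mem_protoTree_iff.mpr ⟨_, hj, t, ht, rfl⟩, ?_⟩
    have h6 : ω ^ r x * ω ^ (5 * r x) = 1 := by
      rw [← pow_add, show r x + 5 * r x = 6 * r x by ring, pow_mul, ω_pow_six, one_pow]
    rw [tileAt_map, pow_add]
    linear_combination (ρ * t * ω ^ j / 2) * h6

lemma lineDir_cast_mod {i j : ℕ} (h : i % 6 = j % 6) : (i : ZMod 3) = j := by
  rw [ZMod.natCast_eq_natCast_iff']; omega

lemma adj_of_mem_tree {z : ℂ} (hxy : x ≠ y) (hx : z ∈ (tileAt ρ c r x).tree)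
    (hy : z ∈ (tileAt ρ c r y).tree) : Adj (lineDir r) x y := by
  have h1 := Tile.norm_sub_le_of_mem_tree hx
  have h2 := Tile.norm_sub_le_of_mem_tree hy
  obtain ⟨i, hi, s, hs, hzx⟩ := mem_tree_tileAt.mp hx
  obtain ⟨j, hj, t, ht, hzy⟩ := mem_tree_tileAt.mp hy
  have h3 : ‖pos (y - x)‖ ≤ 1 := by
    rw [← norm_sub_tileAt_center (ρ := ρ) (c := c) (r := r)]
    have := norm_sub_le (z - (tileAt ρ c r x).center) (z - (tileAt ρ c r y).center)
    rw [sub_sub_sub_cancel_left] at this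
    linarith
  obtain ⟨l, hl⟩ := exists_eq_dir (sub_ne_zero.mpr hxy.symm) h3
  have hyl : y = x + dir l := by rw [← hl]; abel
  have h4 : (s : ℂ) * ω ^ i - t * ω ^ j = 2 * ω ^ l := by
    rw [hzx] at hzy
    have h5 := mul_left_cancel₀ (Circle.coe_ne_zero ρ) (add_left_cancel hzy)
    rw [hyl, pos_add, pos_dir] at h5
    linear_combination 2 * h5
  -- Arms have length `1 / 2` and the centres are at distance `1`, so the trees meet only at full
  -- length, along opposite arms.
  have h5 : (2 : ℝ) ≤ s + t := by
    have h6 := norm_sub_le ((s : ℂ) * ω ^ i) (t * ω ^ j)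
    rwa [h4, norm_mul, norm_mul, norm_mul, norm_ω_pow, norm_ω_pow, norm_ω_pow, Complex.norm_ofNat,
      Complex.norm_real, Complex.norm_real, Real.norm_eq_abs, Real.norm_eq_abs,
      abs_of_nonneg hs.1, abs_of_nonneg ht.1, mul_one, mul_one, mul_one] at h6
  have hs1 : s = 1 := le_antisymm hs.2 (by linarith [ht.2])
  have ht1 : t = 1 := le_antisymm ht.2 (by linarith [hs.2])
  rw [hs1, ht1, Complex.ofReal_one, one_mul, one_mul] at h4
  have h6 := parallelogram_law_with_norm ℝ (ω ^ i) (ω ^ j)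
  rw [h4, norm_mul, norm_ω_pow, norm_ω_pow, norm_ω_pow, Complex.norm_ofNat] at h6
  have h7 : ω ^ i + ω ^ j = 0 := norm_eq_zero.mp (by nlinarith [norm_nonneg (ω ^ i + ω ^ j)])
  have hil : ω ^ i = ω ^ l := by linear_combination (h4 + h7) / 2
  have hjl : ω ^ j = ω ^ (l + 3) := by
    rw [pow_add, ω_pow_three]; linear_combination (h7 - h4) / 2
  rw [ω_pow_eq_iff] at hil hjl
  refine ⟨l, (-1) ^ l, by rw [hyl, add_dir], ?_, ?_⟩
  · rwa [← lineDir_cast_mod hil]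
  · have h8 := lineDir_cast_mod hjl
    rw [h8] at hj
    push_cast at hj
    rwa [show (3 : ZMod 3) = 0 from rfl, add_zero] at hj

lemma Adj.exists_mem_tree (h : Adj (lineDir r) x y) :
    ∃ z, z ∈ (tileAt ρ c r x).tree ∧ z ∈ (tileAt ρ c r y).tree := by
  obtain ⟨k, ε, hy, hx1, hy1⟩ := h
  obtain ⟨j, rfl, rfl⟩ := exists_dir k ε
  rw [← add_dir] at hy
  refine ⟨c + ρ * (pos x + (1 : ℝ) * (ω ^ j / 2)), mem_tree_tileAt.mpr ⟨j, hx1, 1, by simp, rfl⟩,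
    mem_tree_tileAt.mpr ⟨j + 3, ?_, 1, by simp, ?_⟩⟩
  · push_cast
    rwa [show (3 : ZMod 3) = 0 from rfl, add_zero]
  · rw [hy, pos_add, pos_dir, pow_add, ω_pow_three]; push_cast; ring

lemma treeUnion_range : treeUnion (range (tileAt ρ c r)) = ⋃ x, (tileAt ρ c r x).tree := by
  rw [treeUnion, biUnion_range]

lemma IsTiling.locallyFinite_tree (hT : IsTiling (range (tileAt ρ c r))) (S : Set Site) :
    LocallyFinite fun x : S => (tileAt ρ c r x).tree := by
  intro z
  refine ⟨Metric.ball z 1, Metric.ball_mem_nhds z one_pos, ?_⟩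
  have hfin := (hT.finite_near z 2).preimage
    ((tileAt_injective (ρ := ρ) (c := c) (r := r)).comp (Subtype.val_injective (p := (· ∈ S)))).injOn
  refine hfin.subset ?_
  rintro x ⟨w, hw, hwz⟩
  refine ⟨mem_range_self _, ?_⟩
  have h1 := Tile.norm_sub_le_of_mem_tree hw
  rw [mem_ball_iff_norm] at hwz
  have := norm_sub_le (w - z) (w - (tileAt ρ c r x).center)
  rw [sub_sub_sub_cancel_left] at this
  change ‖(tileAt ρ c r x).center - z‖ ≤ 2
  linarith

/-- A set closed under adjacency and its complement give two closed unions of trees, by local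
finiteness, and these are disjoint because trees of distinct tiles meet only for adjacent sites. -/
theorem SatisfiesR2.treeConnected (hT : IsTiling (range (tileAt ρ c r)))
    (h : SatisfiesR2 (range (tileAt ρ c r))) : TreeConnected (lineDir r) := by
  intro K ⟨x, hx⟩ hK
  by_contra hne
  obtain ⟨y, hy⟩ := (ne_univ_iff_exists_notMem K).mp hne
  have hcl : ∀ S : Set Site, IsClosed (⋃ x : S, (tileAt ρ c r x).tree) := fun S =>
    (hT.locallyFinite_tree S).isClosed_iUnion fun x => Tile.isClosed_tree _
  have hpre := h.isPreconnected
  rw [isPreconnected_closed_iff, treeUnion_range] at hpre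
  obtain ⟨z, -, hz1, hz2⟩ := hpre _ _ (hcl K) (hcl Kᶜ) (by
      intro z hz
      obtain ⟨x, hx⟩ := mem_iUnion.mp hz
      by_cases hxK : x ∈ K
      · exact Or.inl (mem_iUnion.mpr ⟨⟨x, hxK⟩, hx⟩)
      · exact Or.inr (mem_iUnion.mpr ⟨⟨x, hxK⟩, hx⟩))
    ⟨(tileAt ρ c r x).center, mem_iUnion.mpr ⟨x, Tile.center_mem_tree _⟩,
      mem_iUnion.mpr ⟨⟨x, hx⟩, Tile.center_mem_tree _⟩⟩
    ⟨(tileAt ρ c r y).center, mem_iUnion.mpr ⟨y, Tile.center_mem_tree _⟩,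
      mem_iUnion.mpr ⟨⟨y, hy⟩, Tile.center_mem_tree _⟩⟩
  obtain ⟨⟨a, ha⟩, hza⟩ := mem_iUnion.mp hz1
  obtain ⟨⟨b, hb⟩, hzb⟩ := mem_iUnion.mp hz2
  exact hb (hK a ha b (adj_of_mem_tree (fun h => hb (h ▸ ha)) hza hzb))

/-! ### The components of the trees -/

/-- The component of the union of the trees that contains a given tree. -/
noncomputable def siteComponent (ρ : Circle) (c : ℂ) (r : Site → ℕ) (x : Site) : Set ℂ :=
  connectedComponentIn (treeUnion (range (tileAt ρ c r))) (tileAt ρ c r x).center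

lemma tree_subset_siteComponent : (tileAt ρ c r x).tree ⊆ siteComponent ρ c r x :=
  (Tile.isPreconnected_tree _).subset_connectedComponentIn (Tile.center_mem_tree _)
    (by rw [treeUnion_range]; exact subset_iUnion (fun x => (tileAt ρ c r x).tree) x)

lemma siteComponent_eq_of_mem_tree {z : ℂ} (hz : z ∈ (tileAt ρ c r x).tree) :
    siteComponent ρ c r x = connectedComponentIn (treeUnion (range (tileAt ρ c r))) z :=
  connectedComponentIn_eq (tree_subset_siteComponent hz)

lemma Conn.siteComponent_eq (h : Conn (lineDir r) x y) :
    siteComponent ρ c r x = siteComponent ρ c r y := by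
  induction h with
  | refl => rfl
  | tail _ h ih =>
    obtain ⟨z, hz1, hz2⟩ := h.exists_mem_tree (ρ := ρ) (c := c)
    rw [ih, siteComponent_eq_of_mem_tree hz1, siteComponent_eq_of_mem_tree hz2]

lemma treeComponents_range :
    treeComponents (range (tileAt ρ c r)) = range (siteComponent ρ c r) := by
  ext K
  constructor
  · rintro ⟨z, hz, rfl⟩
    rw [treeUnion_range] at hz
    obtain ⟨x, hx⟩ := mem_iUnion.mp hz
    exact ⟨x, siteComponent_eq_of_mem_tree hx⟩
  · rintro ⟨x, rfl⟩
    exact ⟨_, by rw [treeUnion_range]; exact mem_iUnion.mpr ⟨x, Tile.center_mem_tree _⟩, rfl⟩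

theorem LocallyConnected.encard_treeComponents_le (h : LocallyConnected (lineDir r)) :
    (treeComponents (range (tileAt ρ c r))).encard ≤ 3 := by
  by_contra! hlt
  have h4 : (4 : ℕ∞) ≤ (treeComponents (range (tileAt ρ c r))).encard :=
    Order.add_one_le_of_lt hlt
  obtain ⟨t, ht, hcard⟩ := exists_subset_encard_eq h4
  have hfin : t.Finite := finite_of_encard_eq_coe (k := 4) hcard
  have := hfin.to_subtype
  have hn : t.ncard = 4 := by rw [ncard, hcard]; rfl
  have e4 : Fin 4 ≃ t := (Finite.equivFinOfCardEq hn).symm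
  have hx : ∀ i : Fin 4, ∃ x, siteComponent ρ c r x = e4 i := fun i => by
    have := ht (e4 i).2
    rwa [treeComponents_range] at this
  choose x hx using hx
  obtain ⟨i, j, hij, hconn⟩ := h.exists_conn x
  have := hconn.siteComponent_eq (ρ := ρ) (c := c)
  rw [hx, hx] at this
  exact hij (e4.injective (Subtype.ext this))

/-- Joined sites have trees in the same component, and each tree contains the centre of its tile. -/
theorem LocallyConnected.infinite_tilesCrossed (h : LocallyConnected (lineDir r)) {K : Set ℂ}
    (hK : K ∈ treeComponents (range (tileAt ρ c r))) :
    (tilesCrossed (range (tileAt ρ c r)) K).Infinite := by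
  rw [treeComponents_range] at hK
  obtain ⟨x, rfl⟩ := hK
  refine ((h.infinite_conn x).image tileAt_injective.injOn (f := tileAt ρ c r)).mono ?_
  rintro _ ⟨y, hy, rfl⟩
  refine ⟨mem_range_self y, (tileAt ρ c r y).center, ?_,
    Tile.ball_subset_interior _ (Metric.mem_ball_self (by norm_num))⟩
  rw [Conn.siteComponent_eq hy]
  exact tree_subset_siteComponent (Tile.center_mem_tree _)

/-! ### Translations -/

lemma lineDir_eq_of_ωc_pow_eq {r' : Site → ℕ} (h : ρ * ωc ^ r x = ρ * ωc ^ r' y) :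
    lineDir r x = lineDir r' y := by
  have h1 := congrArg (fun z : Circle => (z : ℂ)) (mul_left_cancel h)
  simp only [Circle.coe_pow, coe_ωc] at h1
  rw [lineDir, lineDir, lineDir_cast_mod (ω_pow_eq_iff.mp h1)]

/-- A period maps centres to centres, so it is a lattice vector, and it is a period of `lineDir r`.
-/
theorem LocallyConnected.nonperiodic (h : LocallyConnected (lineDir r)) :
    Nonperiodic (range (tileAt ρ c r)) := by
  intro v hv
  have key : ∀ y, ∃ y', (tileAt ρ c r y).translate v = tileAt ρ c r y' := fun y => by
    have : (tileAt ρ c r y).translate v ∈ range (tileAt ρ c r) :=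
      hv ▸ mem_image_of_mem _ (mem_range_self y)
    obtain ⟨y', hy'⟩ := this
    exact ⟨y', hy'.symm⟩
  have hcen : ∀ y y', (tileAt ρ c r y).translate v = tileAt ρ c r y' → v = ρ * pos (y' - y) := by
    intro y y' h
    have h1 : c + ρ * pos y + v = c + ρ * pos y' := congrArg Tile.center h
    rw [pos_sub]; linear_combination h1
  obtain ⟨s, hs⟩ := key 0
  have hv0 := hcen 0 s hs
  rw [sub_zero] at hv0
  have hs0 : s = 0 := h.eq_zero_of_period fun y => by
    obtain ⟨y', hy'⟩ := key y
    have h1 := hcen y y' hy'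
    rw [hv0] at h1
    have h2 := mul_left_cancel₀ (Circle.coe_ne_zero ρ) h1
    have h3 : y' = y + s := by
      have : pos (y' - y - s) = 0 := by rw [pos_sub, h2, sub_self]
      have := eq_zero_of_pos_eq_zero this
      rw [← sub_eq_zero, ← this]; abel
    rw [← h3]
    exact (lineDir_eq_of_ωc_pow_eq (congrArg Tile.rot hy')).symm
  rw [hv0, hs0, pos_zero, mul_zero]

lemma Tile.translate_map (v : ℂ) (f : Tile) (z : ℂ) : (f.translate v).map z = f.map z + v := by
  simp only [Tile.map, Tile.translate]; ring

lemma Tile.translate_injective (v : ℂ) : Function.Injective (Tile.translate v) := by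
  intro f g h
  ext1
  · have h1 : (f.translate v).rot = (g.translate v).rot := congrArg Tile.rot h
    exact h1
  · have h1 : (f.translate v).center = (g.translate v).center := congrArg Tile.center h
    exact add_right_cancel h1

/-! ### Passage to the hull -/

/-- Finitely many tiles of a tiling in the hull occur in a translate of a tiling of the class. -/
lemma exists_translate_mem {Λ : Set (Set Tile)} (hT : T ∈ continuousHull Λ) {F : Set Tile}
    (hF : F.Finite) (hFT : F ⊆ T) : ∃ S ∈ Λ, ∃ w : ℂ, ∀ f ∈ F, f.translate w ∈ S := by
  obtain ⟨-, S, hS, hlim⟩ := hT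
  obtain ⟨R, hR⟩ := (hF.image fun f : Tile => ‖f.center‖).bddAbove
  have hR' : ∀ f ∈ F, ‖f.center‖ ≤ max R 0 := fun f hf =>
    (hR (mem_image_of_mem _ hf)).trans (le_max_left _ _)
  have hR0 : 0 ≤ max R 0 := le_max_right _ _
  generalize max R 0 = M at hR' hR0
  -- Then `1 / ε > M + 2`, so the ball of agreement contains the centres of all tiles of `F` even
  -- after the shift by `v`.
  have hδ : 0 < 1 / (M + 2) := by positivity
  obtain ⟨n, hn⟩ := (hlim.eventually_lt_const hδ).exists
  obtain ⟨ε, hε, hεδ⟩ := exists_lt_of_csInf_lt ⟨1, by simp⟩ hn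
  have hδ1 : 1 / (M + 2) ≤ 1 := by rw [div_le_one (by positivity)]; linarith
  rcases hε with hε | ⟨hε0, u, v, hu, hv, hpatch⟩
  · rw [mem_singleton_iff.mp hε] at hεδ
    linarith
  obtain ⟨S', hS', w, hw⟩ := hS n
  refine ⟨S', hS', v - (w + u), fun f hf => ?_⟩
  have hM : M + 2 < 1 / ε := (lt_one_div (by positivity) hε0).mpr hεδ
  have hmem : f.translate v ∈ patchOn (translate v T) (1 / ε) := by
    refine ⟨mem_image_of_mem _ (hFT hf), (f.translate v).center,
      (f.translate v).ball_subset_region (Metric.mem_ball_self (by norm_num)), ?_⟩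
    rw [mem_closedBall_zero_iff]
    have h1 := norm_add_le f.center v
    have h2 := hR' f hf
    change ‖f.center + v‖ ≤ _
    linarith
  rw [← hpatch, hw] at hmem
  obtain ⟨⟨_, ⟨g, hg, rfl⟩, hgf⟩, -⟩ := hmem
  convert hg using 1
  ext1
  · exact (congrArg Tile.rot hgf).symm
  · have : g.center + w + u = f.center + v := congrArg Tile.center hgf
    change f.center + (v - (w + u)) = g.center
    linear_combination -this

theorem satisfiesR1_of_mem_continuousHull (hT : T ∈ continuousHull classC) : SatisfiesR1 T := by
  intro f hf g hg hfg z hz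
  obtain ⟨S, ⟨-, hS, -⟩, w, hw⟩ := exists_translate_mem hT (F := {f, g}) (by simp)
    (by simp [insert_subset_iff, hf, hg])
  have himg : ∀ (h : Tile) (A : Set ℂ), z ∈ h.map '' A ↔ z + w ∈ (h.translate w).map '' A := by
    intro h A
    simp only [mem_image, Tile.translate_map, add_left_inj]
  have key := hS _ (hw f (by simp)) _ (hw g (by simp)) ((Tile.translate_injective w).ne hfg)
  exact (himg g _).mpr (key ⟨(himg f _).mp hz.1, (himg g _).mp hz.2⟩)

/-- The tile `f` is added to the finite patch so that the approximating tiling can be described in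
the same frame, up to the translation by `w`; equal sites then have equal values. -/
theorem locallyConnected_of_mem_continuousHull (hT : T ∈ continuousHull classC) (hf : f ∈ T)
    (hr : T = range (tileAt f.rot f.center r)) : LocallyConnected (lineDir r) := by
  intro F
  obtain ⟨S, ⟨hS, hS1, hS2⟩, w, hw⟩ := exists_translate_mem hT
    (F := insert f (tileAt f.rot f.center r '' F)) ((F.finite_toSet.image _).insert f)
    (insert_subset hf (by rw [hr]; exact image_subset_range _ _))
  obtain ⟨r', hr'⟩ := hS.exists_eq_range (hw f (mem_insert _ _))
  rw [hr'] at hS hS1 hS2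
  refine ⟨lineDir r', hS1.alternating, hS2.treeConnected hS, fun x hx => ?_⟩
  have hx' := hw _ (mem_insert_of_mem _ (mem_image_of_mem _ hx))
  rw [hr'] at hx'
  obtain ⟨y, hy⟩ := hx'
  have h1 : f.center + w + f.rot * pos y = f.center + f.rot * pos x + w :=
    congrArg Tile.center hy
  have h2 : pos (y - x) = 0 := by
    refine (mul_eq_zero.mp ?_).resolve_left (Circle.coe_ne_zero f.rot)
    rw [pos_sub]; linear_combination h1
  have hyx := sub_eq_zero.mp (eq_zero_of_pos_eq_zero h2)
  rw [hyx] at hy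
  exact (lineDir_eq_of_ωc_pow_eq (congrArg Tile.rot hy)).symm

end DendriteTile

theorem mainTheorem4 :
    ∀ T ∈ DendriteTile.continuousHull DendriteTile.classC,
      DendriteTile.Nonperiodic T ∧ DendriteTile.SatisfiesR1 T ∧
        (DendriteTile.treeComponents T).encard ≤ 3 ∧
        ∀ K ∈ DendriteTile.treeComponents T, (DendriteTile.tilesCrossed T K).Infinite := by
  intro T hT
  obtain ⟨f, hf, -⟩ := hT.1.exists_mem 0
  obtain ⟨r, hr⟩ := hT.1.exists_eq_range hf
  have h := DendriteTile.locallyConnected_of_mem_continuousHull hT hf hr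
  refine ⟨?_, DendriteTile.satisfiesR1_of_mem_continuousHull hT, ?_, ?_⟩
  · rw [hr]; exact h.nonperiodic
  · rw [hr]; exact h.encard_treeComponents_le
  · rw [hr]; exact fun K hK => h.infinite_tilesCrossed hK
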